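/- Fix $n$. A *virtual link diagram* is an immersion of $n$ numbered oriented circles in the plane whose singular set consists of finitely many transverse double points, each labelled as a classical crossing (with over/under information) or as a virtual crossing; it is *classical* if it has no virtual crossing. Diagrams are considered up to planar isotopy. A *local move* replaces the contents of a disk, with arbitrary orientations of the strands in it. *Links* are classical diagrams up to the classical Reidemeister moves R1, R2, R3. *Welded links* are virtual diagrams up to the welded Reidemeister moves: R1, R2, R3, the virtual Reidemeister moves, the mixed move (a strand crossing two others virtually passes through their classical crossing) and the over-commute move OC (a strand passing over two others passes through their virtual crossing). Consider the following local moves. - $\Delta$: three strands cross pairwise, each being over one of the two others and under the other one; one strand is moved through the crossing of the two others, the over/under information being kept. - $\mathrm{BP}$: two parallel strands passing over two other parallel strands are changed so as to pass under them. - $\mathrm{F}$: a strand which passes over one of two strands and under the other one is moved through the virtual crossing of these two. - $\mathrm{VC}$: a classical crossing is replaced by the same crossing preceded and followed by a virtual crossing of the same two strands (in terms of Gauss diagrams, an arrow is reversed, its sign being kept). - $\mathrm{wBP}$: starting from two parallel strands passing over (or under) two other parallel strands, three of the four crossings are changed, and the remaining one is modified by $\mathrm{VC}$. **Theorem.** For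 every $n$, the inclusion of classical diagrams into virtual diagrams induces well-defined and injective maps 1. from links up to $\Delta$ to welded links up to $\mathrm{F}$; 2. from links up to $\Delta$ to welded links up to $\mathrm{VC}$; moreover, it induces a well-defined and injective map from classical diagrams up to the equivalence relation generated by welded Reidemeister moves and $\mathrm{VC}$ on virtual diagrams, to welded links up to $\mathrm{F}$; 3. from links up to $\mathrm{BP}$ to welded links up to $\mathrm{wBP}$. -/

import Mathlib

/-!
Oriented virtual link diagrams in the plane with `n` numbered components, presented as
decorated plane curves in general position with respect to the height function: a diagram is
read from bottom to top as a finite sequence of elementary slices, each of which contains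
exactly one minimum, one maximum or one crossing.  Two such presentations describe the same
diagram up to planar isotopy exactly when they are related by the moves `Isotopy` below.
-/

namespace LinkDiag

/-- The label of a crossing.  `cl true`: classical crossing in which the branch going from bottom
left to top right passes over; `cl false`: classical crossing in which it passes under;
`virt`: virtual crossing.  (Given the orientations of the two branches, this is the same
information as the labels positive / negative / virtual.) -/
inductive Kind
  | cl (a : Bool)
  | virt
  deriving DecidableEq

/-- The label seen after a quarter turn. -/
def Kind.flip : Kind → Kind
  | .cl b => .cl (!b)
  | .virt => .virt

/-- The elementary pieces.  The two legs of a minimum (`cup i s`) belong to the `i`-th component;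
the left leg is oriented upwards if `s = true` and downwards if `s = false`, and the right leg the
other way round.  Away from minima, components and orientations are inherited from below. -/
inductive Piece (n : ℕ)
  | cup (i : Fin n) (s : Bool)
  | cap
  | cross (k : Kind)
  deriving DecidableEq

/-- The number of strands entering a piece from below. -/
def Piece.dom {n : ℕ} : Piece n → ℕ
  | .cup _ _ => 0
  | .cap => 2
  | .cross _ => 2

/-- The number of strands leaving a piece at the top. -/
def Piece.cod {n : ℕ} : Piece n → ℕ
  | .cup _ _ => 2
  | .cap => 0
  | .cross _ => 2

/-- A slice: a piece with the number of vertical strands to its left. -/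
abbrev Slice (n : ℕ) := ℕ × Piece n

/-- A sequence of slices, from bottom to top. -/
abbrev Word (n : ℕ) := List (Slice n)

/-- The strands cut by a horizontal line, from left to right: the component to which each of them
belongs, and whether it is oriented upwards (`true`) or downwards (`false`). -/
abbrev Level (n : ℕ) := List (Fin n × Bool)

/-- The level above a slice in terms of the level below it, `none` if the slice does not fit on
that level (not enough strands, or a maximum joining strands which belong to different components
or whose orientations do not match). -/
def act {n : ℕ} : Slice n → Level n → Option (Level n)
  | (p, .cup i s), l =>
      if p ≤ l.length then some (l.take p ++ (i, s) :: (i, !s) :: l.drop p) else none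
  | (p, .cap), l =>
      match l.drop p with
      | (i, s) :: (j, t) :: r => if i = j ∧ t = !s then some (l.take p ++ r) else none
      | _ => none
  | (p, .cross _), l =>
      match l.drop p with
      | x :: y :: r => some (l.take p ++ y :: x :: r)
      | _ => none

/-- The level above a sequence of slices in terms of the level below it. -/
def run {n : ℕ} : Word n → Level n → Option (Level n)
  | [], l => some l
  | g :: w, l => (act g l).bind (run w)

/-- A point of a diagram: the `q`-th strand (counted from `0`) on the `t`-th level is `(t, q)`. -/
abbrev Point := ℕ × ℕ

/-- The component to which a point of the diagram `w` belongs. -/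
def compAt {n : ℕ} (w : Word n) (x : Point) : Option (Fin n) :=
  (run (w.take x.1) []).bind fun l => (l[x.2]?).map Prod.fst

/-- Two points are joined by an arc contained in a single slice. -/
inductive SliceArc {n : ℕ} (w : Word n) : Point → Point → Prop
  | left (t p q : ℕ) (g : Piece n) (h : w[t]? = some (p, g)) (hq : q < p) :
      SliceArc w (t, q) (t + 1, q)
  | right (t p d : ℕ) (g : Piece n) (h : w[t]? = some (p, g)) :
      SliceArc w (t, p + g.dom + d) (t + 1, p + g.cod + d)
  | cup (t p : ℕ) (i : Fin n) (s : Bool) (h : w[t]? = some (p, .cup i s)) :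
      SliceArc w (t + 1, p) (t + 1, p + 1)
  | cap (t p : ℕ) (h : w[t]? = some (p, .cap)) :
      SliceArc w (t, p) (t, p + 1)
  | rising (t p : ℕ) (k : Kind) (h : w[t]? = some (p, .cross k)) :
      SliceArc w (t, p) (t + 1, p + 1)
  | falling (t p : ℕ) (k : Kind) (h : w[t]? = some (p, .cross k)) :
      SliceArc w (t, p + 1) (t + 1, p)

/-- `w` is a diagram of `n` numbered oriented circles: its slices fit together, it is closed, and
for every `i` the curves numbered `i` form exactly one circle. -/
def IsLink {n : ℕ} (w : Word n) : Prop :=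
  run w [] = some [] ∧
  ∀ i : Fin n, (∃ x, compAt w x = some i) ∧
    ∀ x y, compAt w x = some i → compAt w y = some i → Relation.EqvGen (SliceArc w) x y

/-- Virtual link diagrams with `n` components. -/
def Diagram (n : ℕ) := {w : Word n // IsLink w}

/-- A diagram without virtual crossings. -/
def Diagram.IsClassical {n : ℕ} (D : Diagram n) : Prop :=
  ∀ p, (p, Piece.cross Kind.virt) ∉ D.1

/-- Classical link diagrams with `n` components. -/
def ClassicalDiagram (n : ℕ) := {D : Diagram n // D.IsClassical}

/-- The inclusion of classical diagrams into virtual ones. -/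
def incl {n : ℕ} (D : ClassicalDiagram n) : Diagram n := D.1

/-- The contents of a disk before and after a local move, drawn as sequences of slices.  As the
strands carry no prescribed orientation, every orientation is allowed. -/
abbrev Move (n : ℕ) := Word n → Word n → Prop

/-- A single crossing, with `p` strands to its left. -/
def X {n : ℕ} (p : ℕ) (k : Kind) : Slice n := (p, .cross k)

/-- Planar isotopy. -/
inductive Isotopy {n : ℕ} : Move n
  /-- two distant pieces exchange their heights -/
  | far (g h : Piece n) (p d : ℕ) :
      Isotopy [(p, g), (p + g.cod + d, h)] [(p + g.dom + d, h), (p, g)]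
  /-- a minimum and a maximum cancel -/
  | zigzag (p : ℕ) (i : Fin n) (s : Bool) : Isotopy [(p + 1, .cup i s), (p, .cap)] []
  | zagzig (p : ℕ) (i : Fin n) (s : Bool) : Isotopy [(p, .cup i s), (p + 1, .cap)] []
  /-- a crossing slides through a minimum, or through a maximum -/
  | slideCup (p : ℕ) (i : Fin n) (s : Bool) (k : Kind) :
      Isotopy [(p, .cup i s), X (p + 1) k] [(p + 1, .cup i s), X p k.flip]
  | slideCap (p : ℕ) (k : Kind) :
      Isotopy [X p k, (p + 1, .cap)] [X (p + 1) k.flip, (p, .cap)]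

/-- `Kink p k u`: the word `u` is a strand with one curl, the loop being to the right or to the
left. -/
inductive Kink {n : ℕ} (p : ℕ) (k : Kind) : Word n → Prop
  | right (i : Fin n) (s : Bool) : Kink p k [(p + 1, .cup i s), X p k, (p + 1, .cap)]
  | left (i : Fin n) (s : Bool) : Kink p k [(p, .cup i s), X (p + 1) k, (p, .cap)]

/-- Three strands, numbered from left to right at the bottom, which cross pairwise.  The label of
the crossing of the strands `a < b` is `kab`; as the strand `a` goes from bottom left to top right
there, `kab = cl true` means that `a` passes over `b`.  In `triUp` the third strand passes above
the crossing of the first two, and in `triDown` below it. -/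
def triUp {n : ℕ} (p : ℕ) (k12 k13 k23 : Kind) : Word n := [X p k12, X (p + 1) k13, X p k23]

/-- The other position of the three strands of `triUp`. -/
def triDown {n : ℕ} (p : ℕ) (k12 k13 k23 : Kind) : Word n :=
  [X (p + 1) k23, X p k13, X (p + 1) k12]

/-- The classical Reidemeister moves. -/
inductive Reidemeister {n : ℕ} : Move n
  | R1 (p : ℕ) (a : Bool) (u : Word n) (h : Kink p (.cl a) u) : Reidemeister u []
  | R2 (p : ℕ) (a : Bool) : Reidemeister [X p (.cl a), X p (.cl !a)] []
  /-- one strand is over the two others, and one is under the two others -/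
  | R3 (p : ℕ) (a b c : Bool) (h : b = a ∨ b = c) :
      Reidemeister (triUp p (.cl a) (.cl b) (.cl c)) (triDown p (.cl a) (.cl b) (.cl c))

/-- The virtual Reidemeister moves, the mixed moves, and the over-commute moves. -/
inductive VirtualMoves {n : ℕ} : Move n
  | vR1 (p : ℕ) (u : Word n) (h : Kink p .virt u) : VirtualMoves u []
  | vR2 (p : ℕ) : VirtualMoves [X p .virt, X p .virt] []
  | vR3 (p : ℕ) : VirtualMoves (triUp p .virt .virt .virt) (triDown p .virt .virt .virt)
  | mixed12 (p : ℕ) (a : Bool) :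
      VirtualMoves (triUp p (.cl a) .virt .virt) (triDown p (.cl a) .virt .virt)
  | mixed13 (p : ℕ) (a : Bool) :
      VirtualMoves (triUp p .virt (.cl a) .virt) (triDown p .virt (.cl a) .virt)
  | mixed23 (p : ℕ) (a : Bool) :
      VirtualMoves (triUp p .virt .virt (.cl a)) (triDown p .virt .virt (.cl a))
  /-- `OCi`: the `i`-th strand passes over the virtual crossing of the two others -/
  | OC1 (p : ℕ) :
      VirtualMoves (triUp p (.cl true) (.cl true) .virt) (triDown p (.cl true) (.cl true) .virt)
  | OC2 (p : ℕ) :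
      VirtualMoves (triUp p (.cl false) .virt (.cl true)) (triDown p (.cl false) .virt (.cl true))
  | OC3 (p : ℕ) :
      VirtualMoves (triUp p .virt (.cl false) (.cl false))
        (triDown p .virt (.cl false) (.cl false))

/-- The move Δ: each strand is over one of the two others and under the other one. -/
inductive Delta {n : ℕ} : Move n
  | delta (p : ℕ) (a : Bool) :
      Delta (triUp p (.cl a) (.cl !a) (.cl a)) (triDown p (.cl a) (.cl !a) (.cl a))

/-- The fused move F: a strand which is over one and under the other of two strands passes through
their virtual crossing. -/
inductive Fused {n : ℕ} : Move n
  | F1 (p : ℕ) (a : Bool) :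
      Fused (triUp p (.cl a) (.cl !a) .virt) (triDown p (.cl a) (.cl !a) .virt)
  | F2 (p : ℕ) (a : Bool) :
      Fused (triUp p (.cl a) .virt (.cl a)) (triDown p (.cl a) .virt (.cl a))
  | F3 (p : ℕ) (a : Bool) :
      Fused (triUp p .virt (.cl a) (.cl !a)) (triDown p .virt (.cl a) (.cl !a))

/-- A classical crossing between two virtual crossings of the same two strands. -/
def conj {n : ℕ} (p : ℕ) (a : Bool) : Word n := [X p .virt, X p (.cl a), X p .virt]

/-- The virtual conjugation move VC. -/
inductive VirtualConj {n : ℕ} : Move n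
  | VC (p : ℕ) (a : Bool) : VirtualConj (conj p a) [X p (.cl a)]

/-- Two parallel strands cross two other parallel strands; the first two go from left to right and
are over the other two if `a = true`, and under them if `a = false`. -/
def grid {n : ℕ} (p : ℕ) (a : Bool) : Word n :=
  [X (p + 1) (.cl a), X p (.cl a), X (p + 2) (.cl a), X (p + 1) (.cl a)]

/-- The (unoriented) band-pass move BP: the four crossings are changed. -/
inductive BandPass {n : ℕ} : Move n
  | BP (p : ℕ) : BandPass (grid p true) (grid p false)

/-- The welded band-pass move wBP: three of the four crossings are changed, and the remaining
one is virtually conjugated. -/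
inductive WeldedBandPass {n : ℕ} : Move n
  | bottom (p : ℕ) (a : Bool) : WeldedBandPass (grid p a)
      (conj (p + 1) a ++ [X p (.cl !a)] ++ [X (p + 2) (.cl !a)] ++ [X (p + 1) (.cl !a)])
  | left (p : ℕ) (a : Bool) : WeldedBandPass (grid p a)
      ([X (p + 1) (.cl !a)] ++ conj p a ++ [X (p + 2) (.cl !a)] ++ [X (p + 1) (.cl !a)])
  | right (p : ℕ) (a : Bool) : WeldedBandPass (grid p a)
      ([X (p + 1) (.cl !a)] ++ [X p (.cl !a)] ++ conj (p + 2) a ++ [X (p + 1) (.cl !a)])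
  | top (p : ℕ) (a : Bool) : WeldedBandPass (grid p a)
      ([X (p + 1) (.cl !a)] ++ [X p (.cl !a)] ++ [X (p + 2) (.cl !a)] ++ conj (p + 1) a)

/-- `w'` is obtained from `w` by performing the local move `M` somewhere. -/
def Performs {n : ℕ} (M : Move n) (w w' : Word n) : Prop :=
  ∃ a u v b : Word n, M u v ∧ w = a ++ u ++ b ∧ w' = a ++ v ++ b

/-- Classical links up to the local move `M`: classical link diagrams up to planar isotopy,
classical Reidemeister moves and `M`. -/
def ClassicalLinks (n : ℕ) (M : Move n) : Type :=
  Quot fun D D' : ClassicalDiagram n =>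
    Performs Isotopy D.1.1 D'.1.1 ∨ Performs Reidemeister D.1.1 D'.1.1 ∨ Performs M D.1.1 D'.1.1

/-- Welded links up to the local move `M`: virtual link diagrams up to planar isotopy,
welded Reidemeister moves and `M`. -/
def WeldedLinks (n : ℕ) (M : Move n) : Type :=
  Quot fun D D' : Diagram n =>
    Performs Isotopy D.1 D'.1 ∨ Performs Reidemeister D.1 D'.1 ∨
      Performs VirtualMoves D.1 D'.1 ∨ Performs M D.1 D'.1

/-- The class of a classical diagram. -/
def ClassicalLinks.mk {n : ℕ} (M : Move n) (D : ClassicalDiagram n) : ClassicalLinks n M :=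
  Quot.mk _ D

/-- The class of a virtual diagram. -/
def WeldedLinks.mk {n : ℕ} (M : Move n) (D : Diagram n) : WeldedLinks n M :=
  Quot.mk _ D

/-- Classical links up to a local move `M` that is not itself classical: classical diagrams, two of
them being identified if they are related by welded Reidemeister moves and `M`. -/
def ClassicalLinksUpTo (n : ℕ) (M : Move n) : Type :=
  Quot fun D D' : ClassicalDiagram n => WeldedLinks.mk M (incl D) = WeldedLinks.mk M (incl D')

/-- The class of a classical diagram. -/
def ClassicalLinksUpTo.mk {n : ℕ} (M : Move n) (D : ClassicalDiagram n) :
    ClassicalLinksUpTo n M :=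
  Quot.mk _ D

end LinkDiag

/-! Each assertion combines two facts. The classical move follows from the welded moves together
with the extra one, so the map exists. Classical links up to the classical move are classified by
numbers which extend to welded links and are unchanged by the extra move, so the map is injective.

The numbers are sums over the classical crossings. If the weight of a crossing is compatible with
rotation, is reversed by a crossing change in the sense of R2, and vanishes on self-crossings
(`IsWeight`), then its sum `total` is invariant under all welded Reidemeister moves
(`total_eq_of_mk_eq`). Any move of a strand across the crossing of two others, in particular Δ and
F, keeps the three crossings and hence every such sum. The sum of the signs of the crossings in
which `i` is over `j` (`overWeight`) serves for F, its symmetrisation (`crossWeight`) for VC, and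
the parity of the crossings in which `i` is over another component (`parityWeight`) for wBP.

The classification up to Δ takes place in the group of braid words modulo the moves. Given the braid
relations, Δ says that the squares of neighbouring generators commute (`delta_iff_commute_sq`). It
follows that braids merely permute the clasps of two strands (`IsDeltaFamily.chord_mul`) and that
these clasps, the chords, commute (`IsDeltaFamily.chord_commute`). Every classical diagram is a
plat, that is, a row of minima, a braid and a row of maxima (`exists_plat`). Minima and maxima
absorb certain braids, and a minimum can be merged with another one by undoing a curl (`Rep.merge`),
until the braid is a product of chords (`Rep.reduce`). There is then one minimum for each component,
and chords joining the left legs suffice (`exists_standard`). Their exponents are linking numbers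
(`exists_delta_exponents`).

For BP the same reduction applies, since BP implies the commutation of squares. A curl of a band of
two strands is a full twist, which BP makes equal to its inverse, so the fourth power of a generator
is trivial (`gen_pow_four`); a curl of one more strand then shows that a certain pure braid is an
involution (`isDeltaFamily_bandPass`). Moreover, a relation among the chords of four strands
(`BandRel`) leaves only the chords at the first component (`exists_star`). These are involutions,
and the parities detect them (`eqv_bandPass_of_parityWeight`).

For the existence of the maps, F yields Δ because it makes three pure virtual braids commute
(`delta_of_fused`), and VC together with over-commutation yields F (`fused_of_conj`). Under wBP,
virtual conjugation of a crossing turns out to be a crossing change (`vgen_gen_sq_wbp`), so wBP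
yields BP. In the second half of assertion 2, both VC and F identify two classical diagrams exactly
when Δ does.

Words of slices add two technical concerns. A replacement is meaningful only on levels where both
words fit, so equivalence is relative to a level (`Eqv`). The words met on the way must again be
links, which is deduced from the possibility of lifting labels through every move (`BiLifts`). -/

namespace LinkDiag

/-! ### Levels -/

/-- The strands below and above a piece. -/
inductive Loc {n : ℕ} : Piece n → Level n → Level n → Prop
  | cup (i : Fin n) (s : Bool) : Loc (.cup i s) [] [(i, s), (i, !s)]
  | cap (i : Fin n) (s : Bool) : Loc .cap [(i, s), (i, !s)] []
  | cross (k : Kind) (x y : Fin n × Bool) : Loc (.cross k) [x, y] [y, x]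

theorem Loc.length_dom {n : ℕ} {g : Piece n} {b b' : Level n} (h : Loc g b b') :
    b.length = g.dom := by
  cases h <;> rfl

theorem Loc.length_cod {n : ℕ} {g : Piece n} {b b' : Level n} (h : Loc g b b') :
    b'.length = g.cod := by
  cases h <;> rfl

theorem act_of_loc {n : ℕ} {g : Piece n} {b b' : Level n} (h : Loc g b b') (a c : Level n) :
    act (a.length, g) (a ++ b ++ c) = some (a ++ b' ++ c) := by
  cases h <;> simp [act]

theorem exists_loc_of_act {n : ℕ} {p : ℕ} {g : Piece n} {l m : Level n}
    (h : act (p, g) l = some m) :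
    ∃ a b b' c, a.length = p ∧ l = a ++ b ++ c ∧ m = a ++ b' ++ c ∧ Loc g b b' := by
  cases g with
  | cup i s =>
    simp only [act] at h
    split_ifs at h with hp
    refine ⟨l.take p, [], [(i, s), (i, !s)], l.drop p, by simpa using hp, by simp, ?_, .cup i s⟩
    simpa using h.symm
  | cap =>
    simp only [act] at h
    split at h
    · rename_i i s j t r hd
      split_ifs at h with hc
      obtain ⟨rfl, rfl⟩ := hc
      have hlen := congrArg List.length hd
      simp only [List.length_drop, List.length_cons] at hlen
      refine ⟨l.take p, [(i, s), (i, !s)], [], r, ?_, ?_, ?_, .cap i s⟩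
      · rw [List.length_take]; omega
      · have := List.take_append_drop p l
        rw [hd] at this
        simpa using this.symm
      · simpa using h.symm
    · simp at h
  | cross k =>
    simp only [act] at h
    split at h
    · rename_i x y r hd
      have hlen := congrArg List.length hd
      simp only [List.length_drop, List.length_cons] at hlen
      refine ⟨l.take p, [x, y], [y, x], r, ?_, ?_, ?_, .cross k x y⟩
      · rw [List.length_take]; omega
      · have := List.take_append_drop p l
        rw [hd] at this
        simpa using this.symm
      · simpa using h.symm
    · simp at h

theorem run_append {n : ℕ} (u v : Word n) (l : Level n) :
    run (u ++ v) l = (run u l).bind (run v) := by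
  induction u generalizing l with
  | nil => rfl
  | cons g u ih =>
    simp only [List.cons_append, run]
    cases act g l with
    | none => rfl
    | some m => simp [ih]

theorem run_singleton {n : ℕ} (g : Slice n) (l : Level n) : run [g] l = act g l := by
  simp only [run]
  cases act g l <;> rfl

theorem run_cons {n : ℕ} (g : Slice n) (w : Word n) (l : Level n) :
    run (g :: w) l = (act g l).bind (run w) := rfl

/-- Adding `p` strands to the left of a word. -/
def shift {n : ℕ} (p : ℕ) (w : Word n) : Word n := w.map fun g => (p + g.1, g.2)

theorem act_shift {n : ℕ} (q : ℕ) (g : Piece n) (a l : Level n) :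
    act (a.length + q, g) (a ++ l) = (act (q, g) l).map (a ++ ·) := by
  cases g with
  | cup i s =>
    simp only [act, List.drop_length_add_append, List.take_length_add_append]
    by_cases h : q ≤ l.length <;> simp [h]
  | cap =>
    simp only [act, List.drop_length_add_append, List.take_length_add_append]
    split
    · split_ifs <;> simp
    · rfl
  | cross k =>
    simp only [act, List.drop_length_add_append, List.take_length_add_append]
    split
    · simp
    · rfl

theorem run_shift {n : ℕ} (w : Word n) (a l : Level n) :
    run (shift a.length w) (a ++ l) = (run w l).map (a ++ ·) := by
  induction w generalizing l with
  | nil => rfl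
  | cons g w ih =>
    obtain ⟨q, g⟩ := g
    have : shift a.length ((q, g) :: w) = (a.length + q, g) :: shift a.length w := rfl
    rw [this, run_cons, run_cons, act_shift]
    cases act (q, g) l with
    | none => rfl
    | some m => simp [ih]

theorem length_of_act {n : ℕ} {p : ℕ} {g : Piece n} {l m : Level n} (h : act (p, g) l = some m) :
    p + g.dom ≤ l.length ∧ m.length + g.dom = l.length + g.cod := by
  obtain ⟨a, b, b', c, rfl, rfl, rfl, hl⟩ := exists_loc_of_act h
  simp only [List.length_append, hl.length_dom, hl.length_cod]
  omega

theorem act_eq_none {n : ℕ} {p : ℕ} {g : Piece n} {l : Level n} (h : l.length < p) :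
    act (p, g) l = none := by
  cases hm : act (p, g) l with
  | none => rfl
  | some m => have := (length_of_act hm).1; omega

theorem act_cross_isSome {n : ℕ} {p : ℕ} (k : Kind) {l : Level n} (h : p + 2 ≤ l.length) :
    ∃ m, act (X p k) l = some m ∧ m.length = l.length := by
  obtain ⟨x, y, r, hd⟩ : ∃ x y r, l.drop p = x :: y :: r := by
    match hd : l.drop p with
    | [] => have := congrArg List.length hd; simp at this; omega
    | [_] => have := congrArg List.length hd; simp at this; omega
    | x :: y :: r => exact ⟨x, y, r, rfl⟩
  refine ⟨l.take p ++ y :: x :: r, by simp [act, X, hd], ?_⟩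
  have := congrArg List.length hd
  simp only [List.length_drop, List.length_cons] at this
  simp only [List.length_append, List.length_take, List.length_cons]
  omega

theorem exists_split {n : ℕ} {p : ℕ} {l : Level n} (h : p ≤ l.length) :
    ∃ a c, l = a ++ c ∧ a.length = p :=
  ⟨l.take p, l.drop p, by simp, by simpa using h⟩

theorem far_run_le {n : ℕ} (g h : Piece n) (p d : ℕ) (l m : Level n) :
    run [(p, g), (p + g.cod + d, h)] l = some m ↔
      run [(p + g.dom + d, h), (p, g)] l = some m := by
  constructor
  · intro hm
    rw [run_cons, Option.bind_eq_some_iff] at hm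
    obtain ⟨l₁, h₁, h₂⟩ := hm
    rw [run_singleton] at h₂
    obtain ⟨a, b, b', c, rfl, rfl, rfl, hl⟩ := exists_loc_of_act h₁
    have e : a.length + g.cod + d = (a ++ b').length + d := by simp [hl.length_cod]
    rw [e, act_shift, Option.map_eq_some_iff] at h₂
    obtain ⟨c', hc, rfl⟩ := h₂
    have e' : a.length + g.dom + d = (a ++ b).length + d := by simp [hl.length_dom]
    rw [run_cons, e', act_shift, hc]
    simpa [run_singleton] using act_of_loc hl a c'
  · intro hm
    rw [run_cons, Option.bind_eq_some_iff] at hm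
    obtain ⟨l₁, h₁, h₂⟩ := hm
    rw [run_singleton] at h₂
    obtain ⟨a, b, b', c, ha, rfl, rfl, hl⟩ := exists_loc_of_act h₁
    obtain ⟨e, f, f', r, rfl, he, rfl, hl'⟩ := exists_loc_of_act h₂
    have hlen : (e ++ f).length + d = a.length := by
      rw [ha]; simp [hl'.length_dom]
    obtain ⟨z, rfl⟩ : ∃ z, a = e ++ f ++ z := by
      have h3 : (e ++ f) <+: (a ++ b' ++ c) := ⟨r, he.symm⟩
      have h4 : a <+: (a ++ b' ++ c) := ⟨b' ++ c, by simp⟩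
      obtain ⟨z, hz⟩ := List.prefix_of_prefix_length_le h3 h4 (by omega)
      exact ⟨z, hz.symm⟩
    have hd : z.length = d := by simp only [List.length_append] at hlen; omega
    have hr : r = z ++ b' ++ c := by
      simp only [List.append_assoc, List.append_cancel_left_eq] at he
      simpa using he.symm
    subst hr
    have e1 : (e ++ f ++ z ++ b ++ c) = e ++ f ++ (z ++ b ++ c) := by simp
    rw [run_cons, e1, act_of_loc hl']
    have e2 : e.length + g.cod + d = (e ++ f' ++ z).length := by
      simp [hl'.length_cod, hd]; omega
    have e3 : e ++ f' ++ (z ++ b ++ c) = (e ++ f' ++ z) ++ b ++ c := by simp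
    rw [Option.bind_some, run_singleton, e2, e3, act_of_loc hl]
    simp

theorem far_run {n : ℕ} (g h : Piece n) (p d : ℕ) (l : Level n) :
    run [(p, g), (p + g.cod + d, h)] l = run [(p + g.dom + d, h), (p, g)] l :=
  Option.ext fun m => far_run_le g h p d l m

/-! ### Equivalence of words on a level -/

/-- A move performed on a word starting at the level `l`. -/
def Step {n : ℕ} (R : Move n) (l : Level n) (w w' : Word n) : Prop :=
  Performs R w w' ∧ run w l = run w' l

/-- Two words have the same effect on the level `l` and, if they fit there, are related by
moves. -/
def Eqv {n : ℕ} (R : Move n) (l : Level n) (w w' : Word n) : Prop :=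
  run w l = run w' l ∧ (run w l ≠ none → Relation.EqvGen (Step R l) w w')

/-- Equivalence on every level. -/
def UEqv {n : ℕ} (R : Move n) (w w' : Word n) : Prop := ∀ l, Eqv R l w w'

section Eqv

variable {n : ℕ} {R : Move n} {l m : Level n} {u v w : Word n}

theorem Eqv.refl (w : Word n) : Eqv R l w w := ⟨rfl, fun _ => .refl _⟩

theorem Eqv.symm (h : Eqv R l u v) : Eqv R l v u :=
  ⟨h.1.symm, fun hv => .symm _ _ (h.2 (h.1 ▸ hv))⟩

theorem Eqv.trans (h : Eqv R l u v) (h' : Eqv R l v w) : Eqv R l u w :=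
  ⟨h.1.trans h'.1, fun hu => .trans _ _ _ (h.2 hu) (h'.2 (h.1 ▸ hu))⟩

theorem Eqv.of_move (h : R u v) (hr : run u l = run v l) : Eqv R l u v :=
  ⟨hr, fun _ => .rel _ _ ⟨⟨[], u, v, [], h, by simp, by simp⟩, hr⟩⟩

theorem Eqv.append_right (h : Eqv R l u v) (b : Word n) : Eqv R l (u ++ b) (v ++ b) := by
  refine ⟨by rw [run_append, run_append, h.1], fun hu => ?_⟩
  have hu' : run u l ≠ none := by
    intro h0; rw [run_append, h0] at hu; exact hu rfl
  have key := h.2 hu'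
  clear hu hu' h
  induction key with
  | rel x y hxy =>
    obtain ⟨⟨a, u, v, c, h, rfl, rfl⟩, hr⟩ := hxy
    refine .rel _ _ ⟨⟨a, u, v, c ++ b, h, by simp, by simp⟩, ?_⟩
    rw [run_append, run_append _ b, hr]
  | refl x => exact .refl _
  | symm x y _ ih => exact .symm _ _ ih
  | trans x y z _ _ ih ih' => exact .trans _ _ _ ih ih'

/-- Only the level reached by `a` matters. Cancelling moves such as the straightening of a zigzag
are valid only on levels where the longer word fits, so equivalence on all levels would be too much
to ask. -/
theorem Eqv.append_left {a : Word n} (ha : ∀ m, run a l = some m → Eqv R m u v) :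
    Eqv R l (a ++ u) (a ++ v) := by
  cases hm : run a l with
  | none =>
    refine ⟨by rw [run_append, run_append, hm]; rfl, fun h => ?_⟩
    rw [run_append, hm] at h
    exact absurd rfl h
  | some m =>
    have h := ha m hm
    refine ⟨by rw [run_append, run_append, hm]; exact h.1, fun hu => ?_⟩
    rw [run_append, hm] at hu
    have key := h.2 hu
    clear hu h ha
    induction key with
    | rel x y hxy =>
      obtain ⟨⟨c, u, v, b, h, rfl, rfl⟩, hr⟩ := hxy
      refine .rel _ _ ⟨⟨a ++ c, u, v, b, h, by simp, by simp⟩, ?_⟩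
      rw [run_append, run_append, hm]
      exact hr
    | refl x => exact .refl _
    | symm x y _ ih => exact .symm _ _ ih
    | trans x y z _ _ ih ih' => exact .trans _ _ _ ih ih'

theorem UEqv.refl (w : Word n) : UEqv R w w := fun _ => .refl w
theorem UEqv.symm (h : UEqv R u v) : UEqv R v u := fun l => (h l).symm
theorem UEqv.trans (h : UEqv R u v) (h' : UEqv R v w) : UEqv R u w := fun l => (h l).trans (h' l)
theorem UEqv.of_move (h : R u v) (hr : ∀ l, run u l = run v l) : UEqv R u v :=
  fun l => .of_move h (hr l)
theorem UEqv.append_right (h : UEqv R u v) (b : Word n) : UEqv R (u ++ b) (v ++ b) :=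
  fun l => (h l).append_right b
theorem UEqv.append_left (h : UEqv R u v) (a : Word n) : UEqv R (a ++ u) (a ++ v) :=
  fun _ => .append_left fun m _ => h m
theorem UEqv.mid (h : UEqv R u v) (a b : Word n) : UEqv R (a ++ u ++ b) (a ++ v ++ b) :=
  (h.append_left a).append_right b

end Eqv

/-! ### Recoloring and lifts -/

/-- Change the component carried by a minimum. -/
def Piece.recolor {m n : ℕ} (f : Fin m → Fin n) : Piece m → Piece n
  | .cup i s => .cup (f i) s
  | .cap => .cap
  | .cross k => .cross k

/-- Change the components carried by the minima of a word. -/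
def recolor {m n : ℕ} (f : Fin m → Fin n) (w : Word m) : Word n :=
  w.map fun g => (g.1, g.2.recolor f)

/-- Change the components of the strands of a level. -/
def recolorLevel {m n : ℕ} (f : Fin m → Fin n) (l : Level m) : Level n :=
  l.map fun x => (f x.1, x.2)

/-- The word has a minimum on the component `j`. -/
def HasCup {n : ℕ} (w : Word n) (j : Fin n) : Prop := ∃ p s, (p, Piece.cup j s) ∈ w

section Recolor

variable {m n : ℕ} (f : Fin m → Fin n)

theorem Loc.recolor {g : Piece m} {b b' : Level m} (h : Loc g b b') :
    Loc (g.recolor f) (recolorLevel f b) (recolorLevel f b') := by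
  cases h
  · exact .cup _ _
  · exact .cap _ _
  · exact .cross _ _ _

theorem Piece.dom_recolor (g : Piece m) : (g.recolor f).dom = g.dom := by cases g <;> rfl
theorem Piece.cod_recolor (g : Piece m) : (g.recolor f).cod = g.cod := by cases g <;> rfl

theorem act_recolor {p : ℕ} {g : Piece m} {l k : Level m} (h : act (p, g) l = some k) :
    act (p, g.recolor f) (recolorLevel f l) = some (recolorLevel f k) := by
  obtain ⟨a, b, b', c, rfl, rfl, rfl, hl⟩ := exists_loc_of_act h
  have := act_of_loc (hl.recolor f) (recolorLevel f a) (recolorLevel f c)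
  simpa [recolorLevel] using this

theorem run_recolor {w : Word m} {l k : Level m} (h : run w l = some k) :
    run (recolor f w) (recolorLevel f l) = some (recolorLevel f k) := by
  induction w generalizing l with
  | nil => simp only [run, Option.some.injEq] at h; subst h; rfl
  | cons g w ih =>
    rw [run_cons, Option.bind_eq_some_iff] at h
    obtain ⟨l', h1, h2⟩ := h
    change (act (g.1, g.2.recolor f) (recolorLevel f l)).bind (run (recolor f w)) = _
    rw [act_recolor f h1]
    exact ih h2

end Recolor

/-! ### Components of a word and of its lifts -/

section Basic

variable {n : ℕ}

theorem run_take_isSome {w : Word n} {l : Level n} (h : run w l ≠ none) (t : ℕ) :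
    ∃ k, run (w.take t) l = some k := by
  cases hk : run (w.take t) l with
  | none =>
    rw [← List.take_append_drop t w, run_append, hk] at h
    exact absurd rfl h
  | some k => exact ⟨k, rfl⟩

theorem run_take_succ {w : Word n} {l : Level n} {t : ℕ} {g : Slice n} (h : w[t]? = some g) :
    run (w.take (t + 1)) l = (run (w.take t) l).bind (act g) := by
  rw [List.take_add_one, h, run_append]
  congr 1
  funext k
  exact run_singleton g k

theorem levels_of_slice {w : Word n} (hw : run w [] ≠ none) {t p : ℕ} {g : Piece n}
    (h : w[t]? = some (p, g)) :
    ∃ a b b' c, a.length = p ∧ run (w.take t) [] = some (a ++ b ++ c) ∧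
      run (w.take (t + 1)) [] = some (a ++ b' ++ c) ∧ Loc g b b' := by
  obtain ⟨k, hk⟩ := run_take_isSome hw t
  obtain ⟨k', hk'⟩ := run_take_isSome hw (t + 1)
  have h1 := run_take_succ (l := []) h
  rw [hk, hk', Option.bind_some] at h1
  obtain ⟨a, b, b', c, ha, rfl, rfl, hl⟩ := exists_loc_of_act h1.symm
  exact ⟨a, b, b', c, ha, hk, hk', hl⟩

theorem compAt_eq_of_sliceArc {w : Word n} (hw : run w [] ≠ none) {x y : Point}
    (h : SliceArc w x y) : compAt w x = compAt w y := by
  cases h with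
  | left t p q g h hq =>
    obtain ⟨a, b, b', c, ha, h1, h2, hl⟩ := levels_of_slice hw h
    simp only [compAt, h1, h2, Option.bind_some, List.append_assoc]
    rw [List.getElem?_append_left (by omega), List.getElem?_append_left (by omega)]
  | right t p d g h =>
    obtain ⟨a, b, b', c, ha, h1, h2, hl⟩ := levels_of_slice hw h
    have e1 := hl.length_dom
    have e2 := hl.length_cod
    simp only [compAt, h1, h2, Option.bind_some]
    rw [List.getElem?_append_right (by simp; omega), List.getElem?_append_right (by simp; omega)]
    have e3 : p + g.dom + d - (a ++ b).length = d := by simp; omega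
    have e4 : p + g.cod + d - (a ++ b').length = d := by simp; omega
    rw [e3, e4]
  | cup t p i s h =>
    obtain ⟨a, b, b', c, ha, h1, h2, hl⟩ := levels_of_slice hw h
    cases hl
    simp [compAt, h2, ← ha]
  | cap t p h =>
    obtain ⟨a, b, b', c, ha, h1, h2, hl⟩ := levels_of_slice hw h
    cases hl
    simp [compAt, h1, ← ha]
  | rising t p k h =>
    obtain ⟨a, b, b', c, ha, h1, h2, hl⟩ := levels_of_slice hw h
    cases hl
    simp [compAt, h1, h2, ← ha]
  | falling t p k h =>
    obtain ⟨a, b, b', c, ha, h1, h2, hl⟩ := levels_of_slice hw h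
    cases hl
    simp [compAt, h1, h2, ← ha]

theorem compAt_eq_of_eqvGen {w : Word n} (hw : run w [] ≠ none) {x y : Point}
    (h : Relation.EqvGen (SliceArc w) x y) : compAt w x = compAt w y := by
  induction h with
  | rel x y h => exact compAt_eq_of_sliceArc hw h
  | refl x => rfl
  | symm x y _ ih => exact ih.symm
  | trans x y z _ _ h1 h2 => exact h1.trans h2

theorem HasCup.compAt {w : Word n} (hw : run w [] ≠ none) {j : Fin n} (h : HasCup w j) :
    ∃ x, compAt w x = some j := by
  obtain ⟨p, s, h⟩ := h
  obtain ⟨t, ht⟩ := List.mem_iff_getElem?.1 h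
  obtain ⟨a, b, b', c, ha, h1, h2, hl⟩ := levels_of_slice hw ht
  cases hl
  exact ⟨(t + 1, p), by simp [LinkDiag.compAt, h2, ← ha]⟩

theorem label_of_act {p : ℕ} {g : Piece n} {l k : Level n} (h : act (p, g) l = some k)
    {x : Fin n × Bool} (hx : x ∈ k) : (∃ s, g = .cup x.1 s) ∨ x.1 ∈ l.map Prod.fst := by
  obtain ⟨a, b, b', c, rfl, rfl, rfl, hl⟩ := exists_loc_of_act h
  cases hl with
  | cup i s =>
    simp only [List.mem_append, List.mem_cons, List.not_mem_nil, or_false] at hx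
    rcases hx with (hx | rfl | rfl) | hx
    · right; exact List.mem_map_of_mem (by simp [hx])
    · left; exact ⟨s, rfl⟩
    · left; exact ⟨s, rfl⟩
    · right; exact List.mem_map_of_mem (by simp [hx])
  | cap i s =>
    right; refine List.mem_map_of_mem ?_
    simp only [List.mem_append, List.mem_cons, List.not_mem_nil, or_false] at hx ⊢
    tauto
  | cross k x y =>
    right; refine List.mem_map_of_mem ?_
    simp only [List.mem_append, List.mem_cons, List.not_mem_nil, or_false] at hx ⊢
    tauto

theorem label_of_run {w : Word n} {l k : Level n} (h : run w l = some k)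
    {x : Fin n × Bool} (hx : x ∈ k) : HasCup w x.1 ∨ x.1 ∈ l.map Prod.fst := by
  induction w generalizing l with
  | nil =>
    simp only [run, Option.some.injEq] at h
    subst h
    exact .inr (List.mem_map_of_mem hx)
  | cons g w ih =>
    rw [run_cons, Option.bind_eq_some_iff] at h
    obtain ⟨l', h1, h2⟩ := h
    rcases ih h2 with ⟨p, s, h⟩ | h
    · exact .inl ⟨p, s, List.mem_cons_of_mem _ h⟩
    · obtain ⟨y, hy, hyx⟩ := List.mem_map.1 h
      rw [← hyx]
      rcases label_of_act h1 hy with ⟨s, hs⟩ | h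
      · exact .inl ⟨g.1, s, by rw [← hs]; exact List.mem_cons_self⟩
      · exact .inr h

theorem hasCup_of_compAt {w : Word n} {x : Point} {j : Fin n} (h : compAt w x = some j) :
    HasCup w j := by
  rw [compAt, Option.bind_eq_some_iff] at h
  obtain ⟨l, hl, h⟩ := h
  rw [Option.map_eq_some_iff] at h
  obtain ⟨y, hy, rfl⟩ := h
  rcases label_of_run hl (List.mem_of_getElem? hy) with ⟨p, s, h⟩ | h
  · exact ⟨p, s, List.mem_of_mem_take h⟩
  · simp at h

theorem sliceArc_of_recolor {m : ℕ} {f : Fin m → Fin n} {W : Word m} {x y : Point}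
    (h : SliceArc (recolor f W) x y) : SliceArc W x y := by
  have key : ∀ {t p : ℕ} {g : Piece n}, (recolor f W)[t]? = some (p, g) →
      ∃ g', W[t]? = some (p, g') ∧ g'.recolor f = g := by
    intro t p g h
    simp only [recolor, List.getElem?_map, Option.map_eq_some_iff] at h
    obtain ⟨⟨q, g'⟩, h, h'⟩ := h
    simp only [Prod.mk.injEq] at h'
    exact ⟨g', by rw [h, h'.1], h'.2⟩
  cases h with
  | left t p q g h hq =>
    obtain ⟨g', h', rfl⟩ := key h
    exact .left t p q g' h' hq
  | right t p d g h =>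
    obtain ⟨g', h', rfl⟩ := key h
    rw [Piece.dom_recolor, Piece.cod_recolor]
    exact .right t p d g' h'
  | cup t p i s h =>
    obtain ⟨g', h, hg⟩ := key h
    cases g' <;> simp only [Piece.recolor, reduceCtorEq] at hg
    exact .cup t p _ _ h
  | cap t p h =>
    obtain ⟨g', h, hg⟩ := key h
    cases g' <;> simp only [Piece.recolor, reduceCtorEq] at hg
    exact .cap t p h
  | rising t p k h =>
    obtain ⟨g', h, hg⟩ := key h
    cases g' <;> simp only [Piece.recolor, reduceCtorEq] at hg
    exact .rising t p _ h
  | falling t p k h =>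
    obtain ⟨g', h, hg⟩ := key h
    cases g' <;> simp only [Piece.recolor, reduceCtorEq] at hg
    exact .falling t p _ h

theorem compAt_recolor {m : ℕ} {f : Fin m → Fin n} {W : Word m} (hW : run W [] ≠ none)
    (x : Point) : compAt (recolor f W) x = (compAt W x).map f := by
  obtain ⟨k, hk⟩ := run_take_isSome hW x.1
  have h : (recolor f W).take x.1 = recolor f (W.take x.1) := by simp [recolor, List.map_take]
  have h2 : run (recolor f (W.take x.1)) [] = _ := run_recolor f hk
  simp only [compAt, h, h2, hk, Option.bind_some, recolorLevel, List.getElem?_map, Option.map_map]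
  rfl

/-- All lifts of the word, along all maps of components, have at most one component above every
component. -/
def Monochrome (w : Word n) : Prop :=
  ∀ (m : ℕ) (f : Fin m → Fin n) (W : Word m), recolor f W = w → run W [] = some [] →
    ∀ j j', HasCup W j → HasCup W j' → f j = f j' → j = j'

/-- Arcs do not see the labels, so a lift has all the arcs of `w`. The points of one component of
`w` are connected by arcs, along which the label in the lift is constant. -/
theorem IsLink.monochrome {w : Word n} (h : IsLink w) : Monochrome w := by
  intro m f W hW hr j j' hj hj' hf
  have hr' : run W [] ≠ none := by rw [hr]; simp
  obtain ⟨x, hx⟩ := hj.compAt hr'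
  obtain ⟨y, hy⟩ := hj'.compAt hr'
  have hx' : compAt w x = some (f j) := by rw [← hW, compAt_recolor hr', hx]; rfl
  have hy' : compAt w y = some (f j) := by rw [← hW, compAt_recolor hr', hy, hf]; rfl
  have h1 := (h.2 (f j)).2 x y hx' hy'
  have h2 : Relation.EqvGen (SliceArc W) x y := by
    refine Relation.EqvGen.mono (fun a b hab => ?_) _ _ h1
    rw [← hW] at hab
    exact sliceArc_of_recolor hab
  have := compAt_eq_of_eqvGen hr' h2
  rw [hx, hy] at this
  simpa using this

theorem IsLink.hasCup {w : Word n} (h : IsLink w) (i : Fin n) : HasCup w i :=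
  let ⟨_, hx⟩ := (h.2 i).1
  hasCup_of_compAt hx

/-- A component together with a colour. -/
def paint (i : Fin n) (b : Bool) : Fin (n * 2) := finProdFinEquiv (i, if b then 1 else 0)

theorem paint_inj {i i' : Fin n} {b b' : Bool} (h : paint i b = paint i' b') : b = b' := by
  have := finProdFinEquiv.injective h
  simp only [Prod.mk.injEq] at this
  revert this
  cases b <;> cases b' <;> simp

/-- Forget the colour. -/
def unpaint (j : Fin (n * 2)) : Fin n := (finProdFinEquiv.symm j).1

theorem unpaint_paint (i : Fin n) (b : Bool) : unpaint (paint i b) = i := by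
  simp [unpaint, paint]

/-- Colour the minima of a word according to a colouring of its points. -/
def paintPiece (P : Point → Bool) (t p : ℕ) : Piece n → Piece (n * 2)
  | .cup i s => .cup (paint i (P (t + 1, p))) s
  | .cap => .cap
  | .cross k => .cross k

/-- Colour a word according to a colouring of its points. -/
def paintWord (P : Point → Bool) (w : Word n) : Word (n * 2) :=
  w.mapIdx fun t g => (g.1, paintPiece P t g.1 g.2)

/-- Colour a level according to a colouring of its points. -/
def paintLevel (P : Point → Bool) (t : ℕ) (l : Level n) : Level (n * 2) :=
  l.mapIdx fun q x => (paint x.1 (P (t, q)), x.2)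

theorem recolor_paintWord (P : Point → Bool) (w : Word n) :
    recolor unpaint (paintWord P w) = w := by
  refine List.ext_getElem? fun t => ?_
  simp only [recolor, paintWord, List.getElem?_map, List.getElem?_mapIdx, Option.map_map]
  cases w[t]? with
  | none => rfl
  | some g =>
    obtain ⟨p, g⟩ := g
    cases g <;> simp [paintPiece, Piece.recolor, unpaint_paint]

theorem paintLevel_append (P : Point → Bool) (t : ℕ) (a b : Level n) :
    paintLevel P t (a ++ b) =
      paintLevel P t a ++ b.mapIdx fun q x => (paint x.1 (P (t, q + a.length)), x.2) := by
  simp [paintLevel, List.mapIdx_append]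

/-- Since `P` is constant along arcs, the two strands meeting at a maximum have the same colour, and
the strands beside a slice keep theirs. The coloured word therefore still fits together. -/
theorem run_paintWord {P : Point → Bool} {w : Word n} (hw : run w [] ≠ none)
    (hP : ∀ x y, SliceArc w x y → P x = P y) (t : ℕ) (ht : t ≤ w.length) {l : Level n}
    (hl : run (w.take t) [] = some l) :
    run ((paintWord P w).take t) [] = some (paintLevel P t l) := by
  induction t generalizing l with
  | zero => simp only [List.take_zero, run, Option.some.injEq] at hl ⊢; subst hl; rfl
  | succ t ih =>
    have hg : w[t]? = some (w[t]) := List.getElem?_eq_getElem (by omega)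
    generalize w[t] = g at hg
    obtain ⟨p, g⟩ := g
    obtain ⟨a, b, b', c, ha, h1, h2, hloc⟩ := levels_of_slice hw hg
    rw [hl, Option.some.injEq] at h2
    subst h2
    have hG : (paintWord P w)[t]? = some (p, paintPiece P t p g) := by
      simp [paintWord, List.getElem?_mapIdx, hg]
    rw [run_take_succ hG, ih (by omega) h1, Option.bind_some]
    have hA : paintLevel P t a = paintLevel P (t + 1) a := by
      refine List.ext_getElem? fun q => ?_
      simp only [paintLevel, List.getElem?_mapIdx]
      by_cases hq : q < p
      · rw [hP _ _ (SliceArc.left t p q g hg hq)]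
      · rw [List.getElem?_eq_none (by omega)]; rfl
    have hC : (c.mapIdx fun q x => (paint x.1 (P (t, q + (a ++ b).length)), x.2)) =
        c.mapIdx fun q x => (paint x.1 (P (t + 1, q + (a ++ b').length)), x.2) := by
      refine List.ext_getElem? fun q => ?_
      simp only [List.getElem?_mapIdx]
      have := hP _ _ (SliceArc.right t p q g hg)
      have e1 : p + g.dom + q = q + (a ++ b).length := by
        simp only [List.length_append, hloc.length_dom]; omega
      have e2 : p + g.cod + q = q + (a ++ b').length := by
        simp only [List.length_append, hloc.length_cod]; omega
      rw [e1, e2] at this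
      rw [this]
    rw [paintLevel_append, paintLevel_append, paintLevel_append, paintLevel_append, hA, hC]
    have hlen : (paintLevel P (t + 1) a).length = p := by simp [paintLevel, ha]
    rw [← hlen]
    apply act_of_loc
    rw [hlen]
    cases hloc with
    | cup i s =>
      have := hP _ _ (SliceArc.cup t p i s hg)
      simp only [List.mapIdx_nil, List.mapIdx_cons, paintPiece, ha, Nat.zero_add,
        show 0 + 1 + p = p + 1 by omega, ← this]
      exact .cup _ _
    | cap i s =>
      have := hP _ _ (SliceArc.cap t p hg)
      simp only [List.mapIdx_nil, List.mapIdx_cons, paintPiece, ha, Nat.zero_add,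
        show 0 + 1 + p = p + 1 by omega, ← this]
      exact .cap _ _
    | cross k x y =>
      have h1 := hP _ _ (SliceArc.rising t p k hg)
      have h2 := hP _ _ (SliceArc.falling t p k hg)
      simp only [List.mapIdx_nil, List.mapIdx_cons, paintPiece, ha, Nat.zero_add,
        show 0 + 1 + p = p + 1 by omega, h1, h2]
      exact .cross _ _ _

theorem compAt_paintWord {P : Point → Bool} {w : Word n} (hw : run w [] ≠ none)
    (hP : ∀ x y, SliceArc w x y → P x = P y) {x : Point} (hx : x.1 ≤ w.length) :
    compAt (paintWord P w) x = (compAt w x).map fun i => paint i (P x) := by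
  obtain ⟨k, hk⟩ := run_take_isSome hw x.1
  simp only [compAt, hk, run_paintWord hw hP x.1 hx hk, Option.bind_some, paintLevel,
    List.getElem?_mapIdx, Option.map_map]
  rfl

/-- Colour the points by whether they are connected to `x`. This gives a lift to twice as many
components, and a point `y` of the same component not connected to `x` would produce two different
labels above that component. -/
theorem isLink_of_monochrome {w : Word n} (hw : run w [] = some []) (hc : ∀ i, HasCup w i)
    (hm : Monochrome w) : IsLink w := by
  have hw' : run w [] ≠ none := by simp [hw]
  refine ⟨hw, fun i => ⟨(hc i).compAt hw', fun x y hx hy => ?_⟩⟩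
  classical
  let P : Point → Bool := fun z => decide (Relation.EqvGen (SliceArc w) x z)
  have hP : ∀ a b, SliceArc w a b → P a = P b := by
    intro a b hab
    simp only [P, decide_eq_decide]
    exact ⟨fun h => .trans _ _ _ h (.rel _ _ hab), fun h => .trans _ _ _ h (.symm _ _ (.rel _ _ hab))⟩
  have hlen : ∀ {z : Point} {j : Fin n}, compAt w z = some j → z.1 ≤ w.length := by
    intro z j hz
    by_contra hlt
    rw [compAt, List.take_of_length_le (by omega), hw] at hz
    simp at hz
  have hx' := compAt_paintWord hw' hP (hlen hx)
  have hy' := compAt_paintWord hw' hP (hlen hy)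
  rw [hx] at hx'
  rw [hy] at hy'
  have hrun : run (paintWord P w) [] = some [] := by
    have := run_paintWord hw' hP w.length le_rfl (l := []) (by simpa using hw)
    rwa [List.take_of_length_le (by simp [paintWord])] at this
  have := hm _ unpaint _ (recolor_paintWord P w) hrun _ _ (hasCup_of_compAt hx')
    (hasCup_of_compAt hy') (by simp [unpaint_paint])
  have h := paint_inj this
  simpa [P, Relation.EqvGen.refl] using h.symm

/-! ### Moves preserve links -/

/-- Every lift of `u` which fits on a level gives a lift of `v` with the same effect, and whose
components already occur. -/
def Lifts (u v : Word n) : Prop :=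
  ∀ (m : ℕ) (f : Fin m → Fin n) (l k : Level m) (U : Word m), recolor f U = u →
    run U l = some k → run v (recolorLevel f l) ≠ none →
    ∃ V, recolor f V = v ∧ run V l = some k ∧
      ∀ j, (HasCup V j → HasCup U j ∨ j ∈ l.map Prod.fst) ∧
        (HasCup U j → HasCup V j ∨ j ∈ l.map Prod.fst)

theorem recolor_append {m : ℕ} (f : Fin m → Fin n) (u v : Word m) :
    recolor f (u ++ v) = recolor f u ++ recolor f v := List.map_append

theorem recolor_id (w : Word n) : recolor id w = w := by
  have : ∀ g : Slice n, (g.1, g.2.recolor id) = g := by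
    rintro ⟨p, g⟩; cases g <;> rfl
  simp [recolor, this]

theorem recolorLevel_id (l : Level n) : recolorLevel id l = l := by simp [recolorLevel]

theorem hasCup_append {u v : Word n} {j : Fin n} :
    HasCup (u ++ v) j ↔ HasCup u j ∨ HasCup v j := by
  simp only [HasCup, List.mem_append]
  constructor
  · rintro ⟨p, s, h | h⟩
    · exact .inl ⟨p, s, h⟩
    · exact .inr ⟨p, s, h⟩
  · rintro (⟨p, s, h⟩ | ⟨p, s, h⟩)
    · exact ⟨p, s, .inl h⟩
    · exact ⟨p, s, .inr h⟩

theorem run_append_eq_some {u v : Word n} {l k : Level n} (h : run (u ++ v) l = some k) :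
    ∃ l', run u l = some l' ∧ run v l' = some k := by
  rw [run_append, Option.bind_eq_some_iff] at h
  exact h

theorem Lifts.run_eq {u v : Word n} (h : Lifts u v) {l k k' : Level n} (hu : run u l = some k)
    (hv : run v l = some k') : k = k' := by
  obtain ⟨V, hV, hr, -⟩ := h n id l k u (recolor_id u) hu (by simp [recolorLevel_id, hv])
  rw [recolor_id] at hV
  subst hV
  rw [hv] at hr
  simpa using hr.symm

/-- Connectedness by arcs is awkward to follow through a local move, as the points are renumbered.
In terms of lifts it is immediate: a lift of the new word becomes a lift of the old one with at
least the same labels on its minima, so two labels above one component would contradict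
`IsLink.monochrome` for the old word. -/
theorem IsLink.of_lifts {a u v b : Word n} (h : IsLink (a ++ u ++ b)) (hvu : Lifts v u)
    (hr : run (a ++ v ++ b) [] = some []) : IsLink (a ++ v ++ b) := by
  obtain ⟨k, hk, hb⟩ := run_append_eq_some h.1
  obtain ⟨l, ha, hu⟩ := run_append_eq_some hk
  obtain ⟨k', hk', hb'⟩ := run_append_eq_some hr
  obtain ⟨l', ha', hv⟩ := run_append_eq_some hk'
  obtain rfl : l = l' := by rw [ha] at ha'; simpa using ha'
  refine isLink_of_monochrome hr (fun i => ?_) ?_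
  · have hi := h.hasCup i
    rw [hasCup_append, hasCup_append] at hi ⊢
    rcases hi with (hi | hi) | hi
    · exact .inl (.inl hi)
    · obtain ⟨V, hV, -, hc⟩ := hvu n id l k' v (recolor_id v) hv (by simp [recolorLevel_id, hu])
      rw [recolor_id] at hV
      subst hV
      rcases (hc i).1 hi with hi | hi
      · exact .inl (.inr hi)
      · obtain ⟨x, hx, rfl⟩ := List.mem_map.1 hi
        rcases label_of_run ha hx with hi | hi
        · exact .inl (.inl hi)
        · simp at hi
    · exact .inr hi
  · intro m f W hW hrW
    rw [recolor, List.map_eq_append_iff] at hW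
    obtain ⟨AV, B, rfl, hAV, hB⟩ := hW
    rw [List.map_eq_append_iff] at hAV
    obtain ⟨A, V, rfl, hA, hV⟩ := hAV
    obtain ⟨K, hK, hB'⟩ := run_append_eq_some hrW
    obtain ⟨L, hA', hV'⟩ := run_append_eq_some hK
    have hL : recolorLevel f L = l := by
      have := run_recolor f hA'
      have e : recolor f A = a := hA
      rw [e] at this
      change run a [] = _ at this
      rw [ha] at this
      simpa using this.symm
    obtain ⟨U, hU, hU', hc⟩ := hvu m f L K V hV hV' (by rw [hL, hu]; simp)
    have hlift : recolor f (A ++ U ++ B) = a ++ u ++ b := by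
      rw [recolor_append, recolor_append, hU]
      exact congrArg₂ _ (congrArg₂ _ hA rfl) hB
    have hrun : run (A ++ U ++ B) [] = some [] := by
      rw [run_append, run_append, hA', Option.bind_some, hU', Option.bind_some, hB']
    have hcup : ∀ j, HasCup (A ++ V ++ B) j → HasCup (A ++ U ++ B) j := by
      intro j hj
      rw [hasCup_append, hasCup_append] at hj ⊢
      rcases hj with (hj | hj) | hj
      · exact .inl (.inl hj)
      · rcases (hc j).2 hj with hj | hj
        · exact .inl (.inr hj)
        · obtain ⟨x, hx, rfl⟩ := List.mem_map.1 hj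
          rcases label_of_run hA' hx with hi | hi
          · exact .inl (.inl hi)
          · simp at hi
      · exact .inr hj
    intro j j' hj hj' hf
    exact h.monochrome m f _ hlift hrun j j' (hcup j hj) (hcup j' hj') hf

end Basic

section Inversion

variable {m n : ℕ} {f : Fin m → Fin n} {U : Word m} {w : Word n} {p : ℕ}

theorem recolor_eq_nil (h : recolor f U = []) : U = [] := by simpa [recolor] using h

theorem recolor_eq_cons {g : Piece n} (h : recolor f U = (p, g) :: w) :
    ∃ g' U', U = (p, g') :: U' ∧ g'.recolor f = g ∧ recolor f U' = w := by
  cases U with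
  | nil => simp [recolor] at h
  | cons G U =>
    obtain ⟨q, G⟩ := G
    simp only [recolor, List.map_cons, List.cons.injEq, Prod.mk.injEq] at h
    exact ⟨G, U, by rw [h.1.1], h.1.2, h.2⟩

theorem recolor_eq_cup {g : Piece m} {i : Fin n} {s : Bool} (h : g.recolor f = .cup i s) :
    ∃ j, g = .cup j s ∧ f j = i := by
  cases g with
  | cup j t =>
    simp only [Piece.recolor, Piece.cup.injEq] at h
    exact ⟨j, by rw [h.2], h.1⟩
  | cap => simp [Piece.recolor] at h
  | cross k => simp [Piece.recolor] at h

theorem recolor_eq_cap {g : Piece m} (h : g.recolor f = .cap) : g = .cap := by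
  cases g <;> simp_all [Piece.recolor]

theorem recolor_eq_cross {g : Piece m} {k : Kind} (h : g.recolor f = .cross k) :
    g = .cross k := by
  cases g <;> simp_all [Piece.recolor]

end Inversion

/-! ### Lifting of labels through the individual moves -/

/-- A word made of crossings. -/
def toW {n : ℕ} (b : List (ℕ × Kind)) : Word n := b.map fun x => X x.1 x.2

section Crossings

variable {n : ℕ}

theorem toW_append (b c : List (ℕ × Kind)) : (toW (b ++ c) : Word n) = toW b ++ toW c :=
  List.map_append

theorem toW_cons (x : ℕ × Kind) (c : List (ℕ × Kind)) :
    (toW (x :: c) : Word n) = X x.1 x.2 :: toW c := rfl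

theorem run_toW_isSome {b : List (ℕ × Kind)} {l : Level n} (h : ∀ x ∈ b, x.1 + 2 ≤ l.length) :
    ∃ k, run (toW b) l = some k ∧ k.length = l.length := by
  induction b generalizing l with
  | nil => exact ⟨l, rfl, rfl⟩
  | cons x b ih =>
    obtain ⟨k, hk, hlen⟩ := act_cross_isSome x.2 (h x (by simp))
    obtain ⟨k', hk', hlen'⟩ := ih (l := k) fun y hy => by
      rw [hlen]; exact h y (by simp [hy])
    exact ⟨k', by rw [toW_cons, run_cons, hk]; exact hk', by rw [hlen', hlen]⟩

theorem of_run_toW {b : List (ℕ × Kind)} {l : Level n} (h : run (toW b) l ≠ none) :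
    ∀ x ∈ b, x.1 + 2 ≤ l.length := by
  induction b generalizing l with
  | nil => simp
  | cons x b ih =>
    rw [toW_cons, run_cons] at h
    cases hk : act (X x.1 x.2) l with
    | none => rw [hk] at h; exact absurd rfl h
    | some k =>
      rw [hk] at h
      have h1 := length_of_act (g := .cross x.2) hk
      simp only [Piece.dom, Piece.cod] at h1
      intro y hy
      rcases List.mem_cons.1 hy with rfl | hy
      · exact h1.1
      · have := ih h y hy; omega

theorem recolor_eq_toW {m : ℕ} {f : Fin m → Fin n} {U : Word m} {b : List (ℕ × Kind)}
    (h : recolor f U = toW b) : U = toW b := by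
  induction b generalizing U with
  | nil => exact recolor_eq_nil h
  | cons x b ih =>
    obtain ⟨g, U', rfl, hg, hU⟩ := recolor_eq_cons h
    rw [recolor_eq_cross hg, ih hU]
    rfl

theorem recolor_toW {m : ℕ} (f : Fin m → Fin n) (b : List (ℕ × Kind)) :
    recolor f (toW b) = toW b := by
  simp [recolor, toW, X, Piece.recolor]

theorem not_hasCup_toW {b : List (ℕ × Kind)} {j : Fin n} : ¬ HasCup (toW b) j := by
  rintro ⟨p, s, h⟩
  simp [toW, X] at h

theorem hasCup_cons {g : Slice n} {w : Word n} {j : Fin n} :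
    HasCup (g :: w) j ↔ (∃ s, g.2 = .cup j s) ∨ HasCup w j := by
  simp only [HasCup, List.mem_cons]
  constructor
  · rintro ⟨p, s, h | h⟩
    · exact .inl ⟨s, by rw [← h]⟩
    · exact .inr ⟨p, s, h⟩
  · rintro (⟨s, h⟩ | ⟨p, s, h⟩)
    · exact ⟨g.1, s, .inl (by rw [← h])⟩
    · exact ⟨p, s, .inr h⟩

theorem not_hasCup_nil {j : Fin n} : ¬ HasCup ([] : Word n) j := by
  rintro ⟨p, s, h⟩
  simp at h

/-- Two crossing words inducing the same permutation of the strands. -/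
def SamePerm (b c : List (ℕ × Kind)) : Prop :=
  ∀ (m : ℕ) (l k k' : Level m), run (toW b) l = some k → run (toW c) l = some k' → k = k'

theorem SamePerm.symm {b c : List (ℕ × Kind)} (h : SamePerm b c) : SamePerm c b :=
  fun m l k k' h1 h2 => (h m l k' k h2 h1).symm

theorem SamePerm.lifts {b c : List (ℕ × Kind)} (h : SamePerm b c) :
    Lifts (toW b : Word n) (toW c) := by
  intro m f l k U hU hr hv
  obtain rfl := recolor_eq_toW hU
  have hc := of_run_toW hv
  simp only [recolorLevel, List.length_map] at hc
  obtain ⟨k', hk', -⟩ := run_toW_isSome hc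
  refine ⟨toW c, recolor_toW f c, ?_, fun j => ⟨fun h => absurd h not_hasCup_toW,
    fun h => absurd h not_hasCup_toW⟩⟩
  rw [hk', h m l k k' hr hk']

/-- Both words lift together. -/
def BiLifts (u v : Word n) : Prop := Lifts u v ∧ Lifts v u

theorem SamePerm.biLifts {b c : List (ℕ × Kind)} (h : SamePerm b c) :
    BiLifts (toW b : Word n) (toW c) := ⟨h.lifts, h.symm.lifts⟩

/-- If both words were empty they would fit on levels with fewer than `p` strands, where nothing can
be split off on the left; `hne` excludes this. -/
theorem Lifts.shift {u v : Word n} (h : Lifts u v) (p : ℕ) (hne : u ≠ [] ∨ v ≠ []) :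
    Lifts (shift p u) (shift p v) := by
  have hp : ∀ {m : ℕ} {w : Word m} {l : Level m}, w ≠ [] → run (LinkDiag.shift p w) l ≠ none →
      p ≤ l.length := by
    intro m w l hw hr
    cases w with
    | nil => exact absurd rfl hw
    | cons g w =>
      by_contra hlt
      have e : LinkDiag.shift p (g :: w) = (p + g.1, g.2) :: LinkDiag.shift p w := rfl
      rw [e, run_cons, act_eq_none (by omega)] at hr
      exact hr rfl
  intro m f l k U hU₀ hr hv
  obtain ⟨U, rfl, hU⟩ : ∃ U', U = LinkDiag.shift p U' ∧ recolor f U' = u := by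
    clear hr hv h hne
    induction u generalizing U with
    | nil => exact ⟨[], recolor_eq_nil hU₀, rfl⟩
    | cons g u ih =>
      obtain ⟨g', U', rfl, hg, hU'⟩ := recolor_eq_cons (w := LinkDiag.shift p u) hU₀
      obtain ⟨U'', rfl, hU''⟩ := ih U' hU'
      refine ⟨(g.1, g') :: U'', rfl, ?_⟩
      simp only [recolor, List.map_cons, hg]
      exact congrArg _ hU''
  have hl : p ≤ l.length := by
    rcases hne with hne | hne
    · refine hp (w := U) ?_ (by rw [hr]; simp)
      rintro rfl
      exact hne hU.symm
    · simpa [recolorLevel] using hp hne hv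
  obtain ⟨a, c, rfl, rfl⟩ := exists_split hl
  rw [run_shift, Option.map_eq_some_iff] at hr
  obtain ⟨k, hr, rfl⟩ := hr
  have e : recolorLevel f (a ++ c) = recolorLevel f a ++ recolorLevel f c := by
    simp [recolorLevel]
  have e' : a.length = (recolorLevel f a).length := by simp [recolorLevel]
  rw [e, e', run_shift] at hv
  obtain ⟨V, hV, hVr, hc⟩ := h m f c k U hU hr (by
    intro h0; rw [h0] at hv; exact hv rfl)
  refine ⟨LinkDiag.shift a.length V, ?_, by rw [run_shift, hVr]; rfl, fun j => ?_⟩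
  · rw [← hV]
    simp [recolor, LinkDiag.shift]
  · have hs : ∀ W : Word m, HasCup (LinkDiag.shift a.length W) j ↔ HasCup W j := by
      intro W
      induction W with
      | nil => simp [LinkDiag.shift]
      | cons g W ih =>
        have : LinkDiag.shift a.length (g :: W) = (a.length + g.1, g.2) ::
          LinkDiag.shift a.length W := rfl
        rw [this, hasCup_cons, hasCup_cons, ih]
    rw [hs, hs]
    have := hc j
    simp only [List.map_append, List.mem_append]
    tauto

theorem BiLifts.shift {u v : Word n} (h : BiLifts u v) (p : ℕ) (hne : u ≠ []) :
    BiLifts (shift p u) (shift p v) :=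
  ⟨h.1.shift p (.inl hne), h.2.shift p (.inr hne)⟩

theorem samePerm_tri (k₁ k₂ k₃ : Kind) :
    SamePerm [(0, k₁), (1, k₂), (0, k₃)] [(1, k₃), (0, k₂), (1, k₁)] := by
  intro m l k k' h h'
  rcases l with _ | ⟨x, _ | ⟨y, _ | ⟨z, l⟩⟩⟩
  iterate 3 exact nomatch (show none = some k from h)
  exact Option.some.inj (h.symm.trans h')

theorem samePerm_square (k₁ k₂ : Kind) : SamePerm [(0, k₁), (0, k₂)] [] := by
  intro m l k k' h h'
  rcases l with _ | ⟨x, _ | ⟨y, l⟩⟩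
  iterate 2 exact nomatch (show none = some k from h)
  exact Option.some.inj (h.symm.trans h')

theorem samePerm_cube (k₁ k₂ k₃ k₄ : Kind) :
    SamePerm [(0, k₁), (0, k₂), (0, k₃)] [(0, k₄)] := by
  intro m l k k' h h'
  rcases l with _ | ⟨x, _ | ⟨y, l⟩⟩
  iterate 2 exact nomatch (show none = some k from h)
  exact Option.some.inj (h.symm.trans h')

theorem biLifts_tri (p : ℕ) (k₁ k₂ k₃ : Kind) :
    BiLifts (triUp p k₁ k₂ k₃ : Word n) (triDown p k₁ k₂ k₃) :=
  (samePerm_tri k₁ k₂ k₃).biLifts.shift p (by simp [toW])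

/-- In a lift, the maximum forces the label of the minimum to be that of the strand which is
straightened. The label of the minimum is thus determined and is already present on the level. -/
theorem biLifts_zigzag (p : ℕ) (i : Fin n) (s : Bool) :
    BiLifts [(p + 1, .cup i s), (p, .cap)] ([] : Word n) := by
  suffices h : BiLifts [(1, .cup i s), (0, .cap)] ([] : Word n) from h.shift p (by simp)
  constructor
  · intro m f l k U hU hr _
    obtain ⟨g, U1, rfl, hg, hU1⟩ := recolor_eq_cons hU
    obtain ⟨j, rfl, rfl⟩ := recolor_eq_cup hg
    obtain ⟨g, U2, rfl, hg, hU2⟩ := recolor_eq_cons hU1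
    obtain rfl := recolor_eq_cap hg
    obtain rfl := recolor_eq_nil hU2
    rcases l with _ | ⟨x, l⟩ <;> simp [run, act] at hr
    obtain ⟨⟨h1, h2⟩, h3⟩ := hr
    refine ⟨[], rfl, ?_, fun j' => ⟨fun h => absurd h not_hasCup_nil, fun h => .inr ?_⟩⟩
    · rw [← h3, h2, ← h1]; simp [run]
    · simp only [hasCup_cons, not_hasCup_nil, or_false, reduceCtorEq, exists_false,
        Piece.cup.injEq] at h
      obtain ⟨_, h, -⟩ := h
      simp [h1, h]
  · intro m f l k U hU hr hv
    obtain rfl := recolor_eq_nil hU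
    simp only [run, Option.some.injEq] at hr
    subst hr
    rcases l with _ | ⟨x, l⟩ <;> simp [run, act, recolorLevel] at hv
    obtain ⟨h1, h2⟩ := hv
    refine ⟨[(1, .cup x.1 s), (0, .cap)], by simp [recolor, Piece.recolor, h1],
      by obtain ⟨j, t⟩ := x; cases s <;> cases t <;> simp_all [run, act], fun j' => ⟨fun h => .inr ?_, fun h => absurd h not_hasCup_nil⟩⟩
    simp only [hasCup_cons, not_hasCup_nil, or_false, reduceCtorEq, exists_false,
      Piece.cup.injEq] at h
    obtain ⟨_, h, -⟩ := h
    simp [h]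

theorem biLifts_zagzig (p : ℕ) (i : Fin n) (s : Bool) :
    BiLifts [(p, .cup i s), (p + 1, .cap)] ([] : Word n) := by
  suffices h : BiLifts [(0, .cup i s), (1, .cap)] ([] : Word n) from h.shift p (by simp)
  constructor
  · intro m f l k U hU hr _
    obtain ⟨g, U1, rfl, hg, hU1⟩ := recolor_eq_cons hU
    obtain ⟨j, rfl, rfl⟩ := recolor_eq_cup hg
    obtain ⟨g, U2, rfl, hg, hU2⟩ := recolor_eq_cons hU1
    obtain rfl := recolor_eq_cap hg
    obtain rfl := recolor_eq_nil hU2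
    rcases l with _ | ⟨x, l⟩ <;> simp [run, act] at hr
    obtain ⟨⟨h1, h2⟩, h3⟩ := hr
    refine ⟨[], rfl, ?_, fun j' => ⟨fun h => absurd h not_hasCup_nil, fun h => .inr ?_⟩⟩
    · rw [← h3, ← h2, h1]; simp [run]
    · simp only [hasCup_cons, not_hasCup_nil, or_false, reduceCtorEq, exists_false,
        Piece.cup.injEq] at h
      obtain ⟨_, h, -⟩ := h
      simp [← h1, h]
  · intro m f l k U hU hr hv
    obtain rfl := recolor_eq_nil hU
    simp only [run, Option.some.injEq] at hr
    subst hr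
    rcases l with _ | ⟨x, l⟩ <;> simp [run, act, recolorLevel] at hv
    obtain ⟨h1, h2⟩ := hv
    refine ⟨[(0, .cup x.1 s), (1, .cap)], by simp [recolor, Piece.recolor, h1],
      by obtain ⟨j, t⟩ := x; cases s <;> cases t <;> simp_all [run, act], fun j' => ⟨fun h => .inr ?_, fun h => absurd h not_hasCup_nil⟩⟩
    simp only [hasCup_cons, not_hasCup_nil, or_false, reduceCtorEq, exists_false,
      Piece.cup.injEq] at h
    obtain ⟨_, h, -⟩ := h
    simp [h]

theorem biLifts_kink {p : ℕ} {k : Kind} {u : Word n} (h : Kink p k u) : BiLifts u [] := by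
  cases h with
  | right i s =>
    suffices h : BiLifts [(1, .cup i s), X 0 k, (1, .cap)] ([] : Word n) from h.shift p (by simp)
    constructor
    · intro m f l c U hU hr _
      obtain ⟨g, U1, rfl, hg, hU1⟩ := recolor_eq_cons hU
      obtain ⟨j, rfl, rfl⟩ := recolor_eq_cup hg
      obtain ⟨g, U2, rfl, hg, hU2⟩ := recolor_eq_cons hU1
      obtain rfl := recolor_eq_cross hg
      obtain ⟨g, U3, rfl, hg, hU3⟩ := recolor_eq_cons hU2
      obtain rfl := recolor_eq_cap hg
      obtain rfl := recolor_eq_nil hU3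
      rcases l with _ | ⟨x, l⟩ <;> simp [run, act] at hr
      obtain ⟨⟨h1, h2⟩, h3⟩ := hr
      refine ⟨[], rfl, ?_, fun j' => ⟨fun h => absurd h not_hasCup_nil, fun h => .inr ?_⟩⟩
      · rw [← h3, h2, ← h1]; simp [run]
      · simp only [hasCup_cons, not_hasCup_nil, or_false, reduceCtorEq, exists_false,
          Piece.cup.injEq] at h
        obtain ⟨_, h, -⟩ := h
        simp [h1, h]
    · intro m f l c U hU hr hv
      obtain rfl := recolor_eq_nil hU
      simp only [run, Option.some.injEq] at hr
      subst hr
      rcases l with _ | ⟨x, l⟩ <;> simp [run, act, recolorLevel, X] at hv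
      obtain ⟨h1, h2⟩ := hv
      refine ⟨[(1, .cup x.1 s), X 0 k, (1, .cap)], by simp [recolor, Piece.recolor, h1, X],
        by obtain ⟨j, t⟩ := x; cases s <;> cases t <;> simp_all [run, act, X],
        fun j' => ⟨fun h => .inr ?_, fun h => absurd h not_hasCup_nil⟩⟩
      simp only [hasCup_cons, not_hasCup_nil, or_false, reduceCtorEq, exists_false,
        Piece.cup.injEq, X] at h
      obtain ⟨_, h, -⟩ := h
      simp [h]
  | left i s =>
    suffices h : BiLifts [(0, .cup i s), X 1 k, (0, .cap)] ([] : Word n) from h.shift p (by simp)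
    constructor
    · intro m f l c U hU hr _
      obtain ⟨g, U1, rfl, hg, hU1⟩ := recolor_eq_cons hU
      obtain ⟨j, rfl, rfl⟩ := recolor_eq_cup hg
      obtain ⟨g, U2, rfl, hg, hU2⟩ := recolor_eq_cons hU1
      obtain rfl := recolor_eq_cross hg
      obtain ⟨g, U3, rfl, hg, hU3⟩ := recolor_eq_cons hU2
      obtain rfl := recolor_eq_cap hg
      obtain rfl := recolor_eq_nil hU3
      rcases l with _ | ⟨x, l⟩ <;> simp [run, act] at hr
      obtain ⟨⟨h1, h2⟩, h3⟩ := hr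
      refine ⟨[], rfl, ?_, fun j' => ⟨fun h => absurd h not_hasCup_nil, fun h => .inr ?_⟩⟩
      · rw [← h3, ← h2, h1]; simp [run]
      · simp only [hasCup_cons, not_hasCup_nil, or_false, reduceCtorEq, exists_false,
          Piece.cup.injEq] at h
        obtain ⟨_, h, -⟩ := h
        simp [← h1, h]
    · intro m f l c U hU hr hv
      obtain rfl := recolor_eq_nil hU
      simp only [run, Option.some.injEq] at hr
      subst hr
      rcases l with _ | ⟨x, l⟩ <;> simp [run, act, recolorLevel, X] at hv
      obtain ⟨h1, h2⟩ := hv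
      refine ⟨[(0, .cup x.1 s), X 1 k, (0, .cap)], by simp [recolor, Piece.recolor, h1, X],
        by obtain ⟨j, t⟩ := x; cases s <;> cases t <;> simp_all [run, act, X],
        fun j' => ⟨fun h => .inr ?_, fun h => absurd h not_hasCup_nil⟩⟩
      simp only [hasCup_cons, not_hasCup_nil, or_false, reduceCtorEq, exists_false,
        Piece.cup.injEq, X] at h
      obtain ⟨_, h, -⟩ := h
      simp [h]

/-! ### Moves with the same effect on all levels -/

theorem run_shift_eq {u v : Word n} {p : ℕ} (hu : u ≠ []) (hv : v ≠ [])
    (h : ∀ l, run u l = run v l) (l : Level n) : run (shift p u) l = run (shift p v) l := by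
  by_cases hl : p ≤ l.length
  · obtain ⟨a, c, rfl, rfl⟩ := exists_split hl
    rw [run_shift, run_shift, h]
  · have : ∀ w : Word n, w ≠ [] → run (shift p w) l = none := by
      intro w hw
      cases w with
      | nil => exact absurd rfl hw
      | cons g w =>
        have e : shift p (g :: w) = (p + g.1, g.2) :: shift p w := rfl
        rw [e, run_cons, act_eq_none (by omega)]
        rfl
    rw [this u hu, this v hv]

theorem run_slideCup (p : ℕ) (i : Fin n) (s : Bool) (k k' : Kind) (l : Level n) :
    run [(p, .cup i s), X (p + 1) k] l = run [(p + 1, .cup i s), X p k'] l := by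
  refine run_shift_eq (u := [(0, .cup i s), X 1 k]) (v := [(1, .cup i s), X 0 k'])
    (by simp) (by simp) (fun l => ?_) l
  rcases l with _ | ⟨x, l⟩ <;> rfl

theorem run_slideCap (p : ℕ) (k k' : Kind) (l : Level n) :
    run [X p k, (p + 1, .cap)] l = run [X (p + 1) k', (p, .cap)] l := by
  refine run_shift_eq (u := [X 0 k, (1, .cap)]) (v := [X 1 k', (0, .cap)])
    (by simp) (by simp) (fun l => ?_) l
  rcases l with _ | ⟨x, _ | ⟨y, _ | ⟨z, l⟩⟩⟩ <;> rfl

theorem run_tri (p : ℕ) (k₁ k₂ k₃ : Kind) (l : Level n) :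
    run (triUp p k₁ k₂ k₃) l = run (triDown p k₁ k₂ k₃) l := by
  refine run_shift_eq (u := triUp 0 k₁ k₂ k₃) (v := triDown 0 k₁ k₂ k₃)
    (by simp [triUp]) (by simp [triDown]) (fun l => ?_) l
  rcases l with _ | ⟨x, _ | ⟨y, _ | ⟨z, l⟩⟩⟩ <;> rfl

/-- The condition under which a maximum may join two strands is symmetric in them. -/
theorem run_capKink (p : ℕ) (k : Kind) (l : Level n) :
    run [X p k, (p, .cap)] l = run [(p, .cap)] l := by
  refine run_shift_eq (u := [X 0 k, (0, .cap)]) (v := [(0, .cap)])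
    (by simp) (by simp) (fun l => ?_) l
  rcases l with _ | ⟨⟨i, s⟩, _ | ⟨⟨j, t⟩, l⟩⟩ <;> simp [run, act, X]
  by_cases h : i = j
  · subst h; cases s <;> cases t <;> simp
  · simp [h, Ne.symm h]

theorem biLifts_isotopy {u v : Word n} (h : Isotopy u v) : BiLifts u v := by
  cases h with
  | far g h p d =>
    constructor
    · intro m f l k U hU hr _
      obtain ⟨g', U1, rfl, rfl, hU1⟩ := recolor_eq_cons hU
      obtain ⟨h', U2, rfl, rfl, hU2⟩ := recolor_eq_cons hU1
      obtain rfl := recolor_eq_nil hU2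
      refine ⟨[(p + g'.dom + d, h'), (p, g')], by simp [recolor, Piece.dom_recolor], ?_, ?_⟩
      · rw [Piece.cod_recolor, far_run] at hr
        exact hr
      · intro j
        simp only [hasCup_cons, not_hasCup_nil]
        tauto
    · intro m f l k U hU hr _
      obtain ⟨h', U1, rfl, rfl, hU1⟩ := recolor_eq_cons hU
      obtain ⟨g', U2, rfl, rfl, hU2⟩ := recolor_eq_cons hU1
      obtain rfl := recolor_eq_nil hU2
      refine ⟨[(p, g'), (p + g'.cod + d, h')], by simp [recolor, Piece.cod_recolor], ?_, ?_⟩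
      · rw [Piece.dom_recolor, ← far_run] at hr
        exact hr
      · intro j
        simp only [hasCup_cons, not_hasCup_nil]
        tauto
  | zigzag p i s => exact biLifts_zigzag p i s
  | zagzig p i s => exact biLifts_zagzig p i s
  | slideCup p i s k =>
    constructor
    · intro m f l c U hU hr _
      obtain ⟨g, U1, rfl, hg, hU1⟩ := recolor_eq_cons hU
      obtain ⟨j, rfl, rfl⟩ := recolor_eq_cup hg
      obtain ⟨g, U2, rfl, hg, hU2⟩ := recolor_eq_cons hU1
      obtain rfl := recolor_eq_cross hg
      obtain rfl := recolor_eq_nil hU2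
      refine ⟨[(p + 1, .cup j s), X p k.flip], rfl, ?_, fun j' => ?_⟩
      · rw [← hr]; exact (run_slideCup p j s k k.flip l).symm
      · simp [hasCup_cons, not_hasCup_nil, X]
        exact .inl
    · intro m f l c U hU hr _
      obtain ⟨g, U1, rfl, hg, hU1⟩ := recolor_eq_cons hU
      obtain ⟨j, rfl, rfl⟩ := recolor_eq_cup hg
      obtain ⟨g, U2, rfl, hg, hU2⟩ := recolor_eq_cons hU1
      obtain rfl := recolor_eq_cross hg
      obtain rfl := recolor_eq_nil hU2
      refine ⟨[(p, .cup j s), X (p + 1) k], rfl, ?_, fun j' => ?_⟩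
      · rw [← hr]; exact run_slideCup p j s k k.flip l
      · simp [hasCup_cons, not_hasCup_nil, X]
        exact .inl
  | slideCap p k =>
    constructor
    · intro m f l c U hU hr _
      obtain ⟨g, U1, rfl, hg, hU1⟩ := recolor_eq_cons hU
      obtain rfl := recolor_eq_cross hg
      obtain ⟨g, U2, rfl, hg, hU2⟩ := recolor_eq_cons hU1
      obtain rfl := recolor_eq_cap hg
      obtain rfl := recolor_eq_nil hU2
      refine ⟨[X (p + 1) k.flip, (p, .cap)], rfl, ?_, fun j' => ?_⟩
      · rw [← hr]; exact (run_slideCap p k k.flip l).symm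
      · simp [hasCup_cons, not_hasCup_nil, X]
    · intro m f l c U hU hr _
      obtain ⟨g, U1, rfl, hg, hU1⟩ := recolor_eq_cons hU
      obtain rfl := recolor_eq_cross hg
      obtain ⟨g, U2, rfl, hg, hU2⟩ := recolor_eq_cons hU1
      obtain rfl := recolor_eq_cap hg
      obtain rfl := recolor_eq_nil hU2
      refine ⟨[X p k, (p + 1, .cap)], rfl, ?_, fun j' => ?_⟩
      · rw [← hr]; exact run_slideCap p k k.flip l
      · simp [hasCup_cons, not_hasCup_nil, X]

theorem biLifts_square (p : ℕ) (k k' : Kind) : BiLifts ([X p k, X p k'] : Word n) [] :=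
  (samePerm_square k k').biLifts.shift p (by simp [toW])

theorem biLifts_reidemeister {u v : Word n} (h : Reidemeister u v) : BiLifts u v := by
  cases h with
  | R1 p a u h => exact biLifts_kink h
  | R2 p a => exact biLifts_square p _ _
  | R3 p a b c h => exact biLifts_tri p _ _ _

theorem biLifts_virtualMoves {u v : Word n} (h : VirtualMoves u v) : BiLifts u v := by
  cases h with
  | vR1 p u h => exact biLifts_kink h
  | vR2 p => exact biLifts_square p _ _
  | _ => exact biLifts_tri _ _ _ _

theorem biLifts_delta {u v : Word n} (h : Delta u v) : BiLifts u v := by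
  cases h
  exact biLifts_tri _ _ _ _

theorem biLifts_fused {u v : Word n} (h : Fused u v) : BiLifts u v := by
  cases h <;> exact biLifts_tri _ _ _ _

theorem biLifts_virtualConj {u v : Word n} (h : VirtualConj u v) : BiLifts u v := by
  cases h with
  | VC p a =>
    exact (samePerm_cube .virt (.cl a) .virt (.cl a)).biLifts.shift p (by simp [toW])

theorem run_grid_of_four {m : ℕ} {k₁ k₂ k₃ k₄ : Kind} {l k : Level m}
    (h : run (toW [(1, k₁), (0, k₂), (2, k₃), (1, k₄)]) l = some k) :
    ∃ x y z w r, l = x :: y :: z :: w :: r ∧ k = z :: w :: x :: y :: r := by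
  rcases l with _ | ⟨x, _ | ⟨y, _ | ⟨z, _ | ⟨w, l⟩⟩⟩⟩
  iterate 4 exact nomatch (show none = some k from h)
  exact ⟨x, y, z, w, l, rfl, (Option.some.inj h).symm⟩

theorem biLifts_bandPass {u v : Word n} (h : BandPass u v) : BiLifts u v := by
  cases h with
  | BP p =>
    refine SamePerm.biLifts (b := [(1, .cl true), (0, .cl true), (2, .cl true), (1, .cl true)])
      (c := [(1, .cl false), (0, .cl false), (2, .cl false), (1, .cl false)]) ?_ |>.shift p
      (by simp [toW])
    intro m l k k' h h'
    obtain ⟨x, y, z, w, r, rfl, rfl⟩ := run_grid_of_four h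
    obtain ⟨x', y', z', w', r', h, rfl⟩ := run_grid_of_four h'
    simp_all

theorem biLifts_weldedBandPass {u v : Word n} (h : WeldedBandPass u v) : BiLifts u v := by
  have key : ∀ (a : Bool) (c : List (ℕ × Kind)) (p : ℕ), (∀ (m : ℕ) (x y z w : Fin m × Bool)
      (r : Level m), run (toW c) (x :: y :: z :: w :: r) = some (z :: w :: x :: y :: r)) →
      BiLifts (grid p a : Word n) (shift p (toW c)) := by
    intro a c p hc
    refine SamePerm.biLifts (b := [(1, .cl a), (0, .cl a), (2, .cl a), (1, .cl a)])
      (c := c) ?_ |>.shift p (by simp [toW])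
    intro m l k k' h h'
    obtain ⟨x, y, z, w, r, rfl, rfl⟩ := run_grid_of_four h
    rw [hc] at h'
    simpa using h'
  cases h with
  | bottom p a =>
    exact key a [(1, .virt), (1, .cl a), (1, .virt), (0, .cl !a), (2, .cl !a), (1, .cl !a)] p
      (by intros; rfl)
  | left p a =>
    exact key a [(1, .cl !a), (0, .virt), (0, .cl a), (0, .virt), (2, .cl !a), (1, .cl !a)] p
      (by intros; rfl)
  | right p a =>
    exact key a [(1, .cl !a), (0, .cl !a), (2, .virt), (2, .cl a), (2, .virt), (1, .cl !a)] p
      (by intros; rfl)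
  | top p a =>
    exact key a [(1, .cl !a), (0, .cl !a), (2, .cl !a), (1, .virt), (1, .cl a), (1, .virt)] p
      (by intros; rfl)

end Crossings

/-! ### Equivalent words give equal links -/

/-- The moves on classical diagrams. -/
def Cls {n : ℕ} (M : Move n) : Move n := fun u v => Isotopy u v ∨ Reidemeister u v ∨ M u v

/-- The moves on virtual diagrams. -/
def Wld {n : ℕ} (M : Move n) : Move n :=
  fun u v => Isotopy u v ∨ Reidemeister u v ∨ VirtualMoves u v ∨ M u v

/-- The word contains a virtual crossing. -/
def HasVirt {n : ℕ} (w : Word n) : Prop := ∃ p, (p, Piece.cross Kind.virt) ∈ w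

section Quot

variable {n : ℕ} {M : Move n}

theorem hasVirt_append {u v : Word n} : HasVirt (u ++ v) ↔ HasVirt u ∨ HasVirt v := by
  simp only [HasVirt, List.mem_append]
  exact exists_or

theorem hasVirt_cons {g : Slice n} {w : Word n} :
    HasVirt (g :: w) ↔ g.2 = .cross .virt ∨ HasVirt w := by
  simp only [HasVirt, List.mem_cons]
  constructor
  · rintro ⟨p, h | h⟩
    · exact .inl (by rw [← h])
    · exact .inr ⟨p, h⟩
  · rintro (h | ⟨p, h⟩)
    · exact ⟨g.1, .inl (by rw [← h])⟩
    · exact ⟨p, .inr h⟩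

theorem not_hasVirt_nil : ¬ HasVirt ([] : Word n) := by simp [HasVirt]

theorem Kind.flip_eq_virt {k : Kind} : k.flip = .virt ↔ k = .virt := by
  cases k <;> simp [Kind.flip]

theorem hasVirt_isotopy {u v : Word n} (h : Isotopy u v) : HasVirt u ↔ HasVirt v := by
  cases h <;> simp [hasVirt_cons, not_hasVirt_nil, X, Kind.flip_eq_virt, or_comm]

theorem hasVirt_reidemeister {u v : Word n} (h : Reidemeister u v) : HasVirt u ↔ HasVirt v := by
  cases h with
  | R1 p a u h => cases h <;> simp [hasVirt_cons, not_hasVirt_nil, X]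
  | R2 p a => simp [hasVirt_cons, not_hasVirt_nil, X]
  | R3 p a b c h => simp [hasVirt_cons, not_hasVirt_nil, X, triUp, triDown]

theorem hasVirt_delta {u v : Word n} (h : Delta u v) : HasVirt u ↔ HasVirt v := by
  cases h
  simp [hasVirt_cons, not_hasVirt_nil, X, triUp, triDown]

theorem hasVirt_bandPass {u v : Word n} (h : BandPass u v) : HasVirt u ↔ HasVirt v := by
  cases h
  simp [hasVirt_cons, not_hasVirt_nil, X, grid]

theorem isLink_iff_of_performs {R : Move n} (hR : ∀ u v, R u v → BiLifts u v) {w w' : Word n}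
    (h : Step R [] w w') : IsLink w ↔ IsLink w' := by
  obtain ⟨⟨a, u, v, b, h, rfl, rfl⟩, hr⟩ := h
  constructor
  · intro hw
    exact hw.of_lifts (hR u v h).2 (hr ▸ hw.1)
  · intro hw
    exact hw.of_lifts (hR u v h).1 (hr ▸ hw.1)

theorem biLifts_wld (hM : ∀ u v, M u v → BiLifts u v) (u v : Word n) (h : Wld M u v) :
    BiLifts u v := by
  rcases h with h | h | h | h
  · exact biLifts_isotopy h
  · exact biLifts_reidemeister h
  · exact biLifts_virtualMoves h
  · exact hM u v h

theorem biLifts_cls (hM : ∀ u v, M u v → BiLifts u v) (u v : Word n) (h : Cls M u v) :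
    BiLifts u v := by
  rcases h with h | h | h
  · exact biLifts_isotopy h
  · exact biLifts_reidemeister h
  · exact hM u v h

/-- The words of the connecting chain are not given as links; they are links because each move lifts
in both directions. This allows arguments with words and levels to be carried out without mentioning
diagrams. -/
theorem WeldedLinks.mk_eq (hM : ∀ u v, M u v → BiLifts u v) {D D' : Diagram n}
    (h : Eqv (Wld M) [] D.1 D'.1) : WeldedLinks.mk M D = WeldedLinks.mk M D' := by
  have key : ∀ w w', Relation.EqvGen (Step (Wld M) []) w w' → (IsLink w ↔ IsLink w') ∧
      ∀ hw hw', WeldedLinks.mk M ⟨w, hw⟩ = WeldedLinks.mk M ⟨w', hw'⟩ := by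
    intro w w' h
    induction h with
    | rel x y h =>
      refine ⟨isLink_iff_of_performs (biLifts_wld hM) h, fun hw hw' => Quot.sound ?_⟩
      obtain ⟨⟨a, u, v, b, h, rfl, rfl⟩, -⟩ := h
      rcases h with h | h | h | h
      · exact .inl ⟨a, u, v, b, h, rfl, rfl⟩
      · exact .inr (.inl ⟨a, u, v, b, h, rfl, rfl⟩)
      · exact .inr (.inr (.inl ⟨a, u, v, b, h, rfl, rfl⟩))
      · exact .inr (.inr (.inr ⟨a, u, v, b, h, rfl, rfl⟩))
    | refl x => exact ⟨.rfl, fun _ _ => rfl⟩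
    | symm x y _ ih => exact ⟨ih.1.symm, fun h h' => (ih.2 h' h).symm⟩
    | trans x y z _ _ ih ih' =>
      exact ⟨ih.1.trans ih'.1, fun h h' => (ih.2 h (ih.1.1 h)).trans (ih'.2 _ h')⟩
  exact (key _ _ (h.2 (by rw [D.2.1]; simp))).2 D.2 D'.2

/-- Here the intermediate words must be classical as well, which is guaranteed by `hV`. -/
theorem ClassicalLinks.mk_eq (hM : ∀ u v, M u v → BiLifts u v)
    (hV : ∀ u v, M u v → (HasVirt u ↔ HasVirt v)) {D D' : ClassicalDiagram n}
    (h : Eqv (Cls M) [] D.1.1 D'.1.1) : ClassicalLinks.mk M D = ClassicalLinks.mk M D' := by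
  have hcl : ∀ D : Diagram n, D.IsClassical ↔ ¬ HasVirt D.1 := fun D => by
    simp [Diagram.IsClassical, HasVirt]
  have key : ∀ w w', Relation.EqvGen (Step (Cls M) []) w w' → (IsLink w ↔ IsLink w') ∧
      (HasVirt w ↔ HasVirt w') ∧ ∀ hw hw' hv hv', ClassicalLinks.mk M ⟨⟨w, hw⟩, hv⟩ =
        ClassicalLinks.mk M ⟨⟨w', hw'⟩, hv'⟩ := by
    intro w w' h
    induction h with
    | rel x y h =>
      refine ⟨isLink_iff_of_performs (biLifts_cls hM) h, ?_, fun hw hw' _ _ => Quot.sound ?_⟩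
      · obtain ⟨⟨a, u, v, b, h, rfl, rfl⟩, -⟩ := h
        have : HasVirt u ↔ HasVirt v := by
          rcases h with h | h | h
          · exact hasVirt_isotopy h
          · exact hasVirt_reidemeister h
          · exact hV u v h
        rw [hasVirt_append, hasVirt_append, hasVirt_append, hasVirt_append, this]
      · obtain ⟨⟨a, u, v, b, h, rfl, rfl⟩, -⟩ := h
        rcases h with h | h | h
        · exact .inl ⟨a, u, v, b, h, rfl, rfl⟩
        · exact .inr (.inl ⟨a, u, v, b, h, rfl, rfl⟩)
        · exact .inr (.inr ⟨a, u, v, b, h, rfl, rfl⟩)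
    | refl x => exact ⟨.rfl, .rfl, fun _ _ _ _ => rfl⟩
    | symm x y _ ih => exact ⟨ih.1.symm, ih.2.1.symm, fun h h' hv hv' => (ih.2.2 h' h hv' hv).symm⟩
    | trans x y z _ _ ih ih' =>
      refine ⟨ih.1.trans ih'.1, ih.2.1.trans ih'.2.1, fun h h' hv hv' => ?_⟩
      have hy : Diagram.IsClassical ⟨y, ih.1.1 h⟩ :=
        (hcl ⟨y, ih.1.1 h⟩).2 fun h0 => (hcl ⟨x, h⟩).1 hv (ih.2.1.2 h0)
      exact (ih.2.2 h (ih.1.1 h) hv hy).trans (ih'.2.2 _ h' hy hv')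
  exact (key _ _ (h.2 (by rw [D.1.2.1]; simp))).2.2 D.1.2 D'.1.2 D.2 D'.2

end Quot

/-! ### Weighted counts of crossings -/

section Weight

variable {n : ℕ} {A : Type*} [AddCommGroup A]

/-- The weight of a slice: `φ a x y` for a classical crossing with label `a`, where `x` and `y` are
the strands on its lower left and lower right. -/
def weight (φ : Bool → Fin n × Bool → Fin n × Bool → A) : Slice n → Level n → A
  | (p, .cross (.cl a)), l =>
      match l.drop p with
      | x :: y :: _ => φ a x y
      | _ => 0
  | _, _ => 0

/-- The sum of the weights of the slices of a word. -/
def total (φ : Bool → Fin n × Bool → Fin n × Bool → A) : Word n → Level n → A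
  | [], _ => 0
  | g :: w, l => weight φ g l + (act g l).elim 0 (total φ w)

variable (φ : Bool → Fin n × Bool → Fin n × Bool → A)

theorem total_append {u : Word n} {l k : Level n} (h : run u l = some k) (v : Word n) :
    total φ (u ++ v) l = total φ u l + total φ v k := by
  induction u generalizing l with
  | nil =>
    simp only [run, Option.some.injEq] at h
    subst h
    simp [total]
  | cons g u ih =>
    rw [run_cons, Option.bind_eq_some_iff] at h
    obtain ⟨l', h1, h2⟩ := h
    simp only [List.cons_append, total, h1, Option.elim_some, ih h2]
    abel

theorem weight_shift (q : ℕ) (g : Piece n) (a l : Level n) :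
    weight φ (a.length + q, g) (a ++ l) = weight φ (q, g) l := by
  cases g with
  | cross k => cases k <;> simp only [weight, List.drop_length_add_append]
  | _ => rfl

theorem total_shift (w : Word n) (a l : Level n) :
    total φ (shift a.length w) (a ++ l) = total φ w l := by
  induction w generalizing l with
  | nil => rfl
  | cons g w ih =>
    have : shift a.length (g :: w) = (a.length + g.1, g.2) :: shift a.length w := rfl
    rw [this, total, total, weight_shift, act_shift]
    cases act (g.1, g.2) l with
    | none => rfl
    | some m => simp [ih]

/-- The weight only depends on the crossing up to isotopy, and vanishes on self-crossings. -/
structure IsWeight : Prop where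
  turn : ∀ a i s z, φ a (i, !s) z = φ (!a) z (i, s)
  inv : ∀ a x y, φ a x y + φ (!a) y x = 0
  self : ∀ a i s t, φ a (i, s) (i, t) = 0

/-- Both words have the same total weight wherever they have the same effect. -/
def SameTotal (u v : Word n) : Prop :=
  ∀ l k, run u l = some k → run v l = some k → total φ u l = total φ v l

variable {φ}

theorem SameTotal.shift {u v : Word n} (h : SameTotal φ u v) (p : ℕ) (hne : u ≠ []) :
    SameTotal φ (shift p u) (shift p v) := by
  intro l k hu hv
  have hl : p ≤ l.length := by
    cases u with
    | nil => exact absurd rfl hne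
    | cons g u =>
      by_contra hlt
      have e : LinkDiag.shift p (g :: u) = (p + g.1, g.2) :: LinkDiag.shift p u := rfl
      rw [e, run_cons, act_eq_none (by omega)] at hu
      exact nomatch hu
  obtain ⟨a, c, rfl, rfl⟩ := exists_split hl
  rw [run_shift, Option.map_eq_some_iff] at hu hv
  obtain ⟨k, hu, rfl⟩ := hu
  obtain ⟨k', hv, hk⟩ := hv
  obtain rfl : k' = k := by simpa using hk
  rw [total_shift, total_shift]
  exact h c _ hu hv

/-- The same pairs of strands cross in both positions, with the same labels and the same left and
right strands. No property of the weight is needed, so R3, the mixed and over-commute moves, Δ and F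
are all covered. -/
theorem sameTotal_tri (p : ℕ) (k₁ k₂ k₃ : Kind) :
    SameTotal φ (triUp p k₁ k₂ k₃) (triDown p k₁ k₂ k₃) := by
  suffices h : SameTotal φ (triUp 0 k₁ k₂ k₃) (triDown 0 k₁ k₂ k₃) from h.shift p (by simp [triUp])
  intro l k hu _
  rcases l with _ | ⟨x, _ | ⟨y, _ | ⟨z, l⟩⟩⟩
  iterate 3 exact nomatch (show none = some k from hu)
  change weight φ (X 0 k₁) (x :: y :: z :: l) + (weight φ (X 1 k₂) (y :: x :: z :: l) +
    (weight φ (X 0 k₃) (y :: z :: x :: l) + 0)) = weight φ (X 1 k₃) (x :: y :: z :: l) +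
    (weight φ (X 0 k₂) (x :: z :: y :: l) + (weight φ (X 1 k₁) (z :: x :: y :: l) + 0))
  have h1 : weight φ (X 0 k₁) (x :: y :: z :: l) = weight φ (X 1 k₁) (z :: x :: y :: l) := by
    cases k₁ <;> rfl
  have h2 : weight φ (X 1 k₂) (y :: x :: z :: l) = weight φ (X 0 k₂) (x :: z :: y :: l) := by
    cases k₂ <;> rfl
  have h3 : weight φ (X 0 k₃) (y :: z :: x :: l) = weight φ (X 1 k₃) (x :: y :: z :: l) := by
    cases k₃ <;> rfl
  rw [h1, h2, h3]
  abel

theorem sameTotal_square (hφ : IsWeight φ) (p : ℕ) (k : Kind) :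
    SameTotal φ ([X p k, X p k.flip] : Word n) [] := by
  suffices h : SameTotal φ ([X 0 k, X 0 k.flip] : Word n) [] from h.shift p (by simp)
  intro l m hu _
  rcases l with _ | ⟨x, _ | ⟨y, l⟩⟩
  iterate 2 exact nomatch (show none = some m from hu)
  cases k with
  | virt => simp [total, weight, X, Kind.flip, act]
  | cl a =>
    change φ a x y + (φ (!a) y x + 0) = 0
    rw [add_zero, hφ.inv]

theorem sameTotal_kink (hφ : IsWeight φ) {p : ℕ} {k : Kind} {u : Word n} (h : Kink p k u) :
    SameTotal φ u [] := by
  cases h with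
  | right i s =>
    suffices h : SameTotal φ ([(1, .cup i s), X 0 k, (1, .cap)] : Word n) [] from
      h.shift p (by simp)
    intro l m hu hv
    have e : m = l := by simpa [run] using hv.symm
    subst e
    rcases m with _ | ⟨⟨j, t⟩, l⟩
    · exact nomatch (show none = some [] from hu)
    cases k with
    | virt =>
      simp [total, weight, X, act]
      split_ifs <;> rfl
    | cl a =>
      simp [run, act, X] at hu
      obtain ⟨h1, h2⟩ := hu
      obtain ⟨rfl, rfl⟩ := h1
      simp [total, weight, act, X, hφ.self]
  | left i s =>
    suffices h : SameTotal φ ([(0, .cup i s), X 1 k, (0, .cap)] : Word n) [] from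
      h.shift p (by simp)
    intro l m hu hv
    have e : m = l := by simpa [run] using hv.symm
    subst e
    rcases m with _ | ⟨⟨j, t⟩, l⟩
    · exact nomatch (show none = some [] from hu)
    cases k with
    | virt =>
      simp [total, weight, X, act]
      split_ifs <;> rfl
    | cl a =>
      simp [run, act, X] at hu
      obtain ⟨h1, h2⟩ := hu
      obtain ⟨rfl, rfl⟩ := h1
      simp [total, weight, act, X, hφ.self]

theorem Loc.weight_eq {g : Piece n} {b b' : Level n} (h : Loc g b b') (a c : Level n) :
    weight φ (a.length, g) (a ++ b ++ c) = weight φ (0, g) b := by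
  have := weight_shift φ 0 g a (b ++ c)
  rw [List.append_assoc]
  rw [Nat.add_zero] at this
  rw [this]
  cases h with
  | cross k x y => cases k <;> rfl
  | _ => rfl

theorem sameTotal_far (g h : Piece n) (p d : ℕ) :
    SameTotal φ [(p, g), (p + g.cod + d, h)] [(p + g.dom + d, h), (p, g)] := by
  intro l k hu hv
  rw [run_cons, Option.bind_eq_some_iff] at hu hv
  obtain ⟨l₁, h₁, h₂⟩ := hu
  obtain ⟨l₂, h₃, h₄⟩ := hv
  rw [run_singleton] at h₂ h₄
  have key : ∀ (g h : Slice n) (l l' : Level n), act g l = some l' →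
      total φ [g, h] l = weight φ g l + weight φ h l' := by
    intro g h l l' hl
    simp only [total, hl, Option.elim_some]
    cases act h l' <;> simp
  rw [key _ _ _ _ h₁, key _ _ _ _ h₃]
  obtain ⟨a, b, b', c, rfl, rfl, rfl, hl⟩ := exists_loc_of_act h₁
  have e : a.length + g.cod + d = (a ++ b').length + d := by simp [hl.length_cod]
  have e' : a.length + g.dom + d = (a ++ b).length + d := by simp [hl.length_dom]
  rw [e] at h₂ ⊢
  rw [e'] at h₃ ⊢
  rw [act_shift, Option.map_eq_some_iff] at h₂ h₃
  obtain ⟨c', hc, rfl⟩ := h₂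
  obtain ⟨c'', hc', rfl⟩ := h₃
  rw [hl.weight_eq, hl.weight_eq, weight_shift, weight_shift, add_comm]

theorem sameTotal_isotopy (hφ : IsWeight φ) {u v : Word n} (h : Isotopy u v) :
    SameTotal φ u v := by
  cases h with
  | far g h p d => exact sameTotal_far g h p d
  | zigzag p i s =>
    intro l k hu hv
    simp [total, weight]
    cases act (p + 1, Piece.cup i s) l <;> simp
    cases act (p, Piece.cap) _ <;> simp
  | zagzig p i s =>
    intro l k hu hv
    simp [total, weight]
    cases act (p, Piece.cup i s) l <;> simp
    cases act (p + 1, Piece.cap) _ <;> simp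
  | slideCup p i s k =>
    suffices h : SameTotal φ ([(0, .cup i s), X 1 k] : Word n) [(1, .cup i s), X 0 k.flip] from
      h.shift p (by simp)
    intro l m hu _
    rcases l with _ | ⟨x, l⟩
    · exact nomatch (show none = some m from hu)
    cases k with
    | virt => simp [total, weight, X, Kind.flip, act]
    | cl a => simp [total, weight, X, Kind.flip, act, hφ.turn]
  | slideCap p k =>
    suffices h : SameTotal φ ([X 0 k, (1, .cap)] : Word n) [X 1 k.flip, (0, .cap)] from
      h.shift p (by simp)
    intro l m hu _
    rcases l with _ | ⟨⟨i, s⟩, _ | ⟨y, _ | ⟨⟨j, t⟩, l⟩⟩⟩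
    iterate 3 exact nomatch (show none = some m from hu)
    simp [run, act, X] at hu
    obtain ⟨h1, -⟩ := hu
    obtain ⟨rfl, rfl⟩ := h1
    cases k with
    | virt => simp [total, weight, X, Kind.flip, act]
    | cl a =>
      have := hφ.turn a i (!s) y
      rw [Bool.not_not] at this
      simp [total, weight, X, Kind.flip, act, this]

theorem sameTotal_reidemeister (hφ : IsWeight φ) {u v : Word n} (h : Reidemeister u v) :
    SameTotal φ u v := by
  cases h with
  | R1 p a u h => exact sameTotal_kink hφ h
  | R2 p a => exact sameTotal_square hφ p (.cl a)
  | R3 p a b c h => exact sameTotal_tri p _ _ _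

theorem sameTotal_virtualMoves (hφ : IsWeight φ) {u v : Word n} (h : VirtualMoves u v) :
    SameTotal φ u v := by
  cases h with
  | vR1 p u h => exact sameTotal_kink hφ h
  | vR2 p => exact sameTotal_square hφ p .virt
  | _ => exact sameTotal_tri _ _ _ _

theorem sameTotal_fused {u v : Word n} (h : Fused u v) : SameTotal φ u v := by
  cases h <;> exact sameTotal_tri _ _ _ _

/-- The first virtual crossing exchanges the strands which enter the classical one, while the label
stays. A symmetric weight does not notice this, whereas `overWeight` does; hence the use of
`crossWeight` for VC. -/
theorem sameTotal_virtualConj (hs : ∀ a x y, φ a x y = φ a y x) {u v : Word n}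
    (h : VirtualConj u v) : SameTotal φ u v := by
  cases h with
  | VC p a =>
    suffices h : SameTotal φ (conj 0 a : Word n) [X 0 (.cl a)] from h.shift p (by simp [conj])
    intro l m hu _
    rcases l with _ | ⟨x, _ | ⟨y, l⟩⟩
    iterate 2 exact nomatch (show none = some m from hu)
    simp [total, weight, X, conj, act, hs a x y]

theorem total_eq_of_step {R : Move n} (hL : ∀ u v, R u v → BiLifts u v)
    (hT : ∀ u v, R u v → SameTotal φ u v) {w w' : Word n} (hp : Performs R w w')
    (hw : run w [] ≠ none) (hw' : run w' [] ≠ none) : total φ w [] = total φ w' [] := by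
  obtain ⟨a, u, v, b, h, rfl, rfl⟩ := hp
  obtain ⟨r, hr⟩ := Option.ne_none_iff_exists'.1 hw
  obtain ⟨r', hr'⟩ := Option.ne_none_iff_exists'.1 hw'
  obtain ⟨k, hk, hb⟩ := run_append_eq_some hr
  obtain ⟨l, ha, hu⟩ := run_append_eq_some hk
  obtain ⟨k', hk', hb'⟩ := run_append_eq_some hr'
  obtain ⟨l', ha', hv⟩ := run_append_eq_some hk'
  obtain rfl : l = l' := by rw [ha] at ha'; simpa using ha'
  obtain rfl := (hL u v h).1.run_eq hu hv
  rw [total_append φ hk, total_append φ hk', total_append φ ha, total_append φ ha,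
    hT u v h l k hu hv]

theorem total_eq_of_mk_eq {M : Move n} (hφ : IsWeight φ) (hL : ∀ u v, M u v → BiLifts u v)
    (hT : ∀ u v, M u v → SameTotal φ u v) {D D' : Diagram n}
    (h : WeldedLinks.mk M D = WeldedLinks.mk M D') : total φ D.1 [] = total φ D'.1 [] := by
  have hT' : ∀ u v, Wld M u v → SameTotal φ u v := by
    rintro u v (h | h | h | h)
    · exact sameTotal_isotopy hφ h
    · exact sameTotal_reidemeister hφ h
    · exact sameTotal_virtualMoves hφ h
    · exact hT u v h
  let f : WeldedLinks n M → A := Quot.lift (fun D => total φ D.1 []) (by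
    intro D D' h
    refine total_eq_of_step (biLifts_wld hL) hT' ?_ (by rw [D.2.1]; simp) (by rw [D'.2.1]; simp)
    rcases h with ⟨a, u, v, b, h, e⟩ | ⟨a, u, v, b, h, e⟩ | ⟨a, u, v, b, h, e⟩ | ⟨a, u, v, b, h, e⟩
    · exact ⟨a, u, v, b, .inl h, e⟩
    · exact ⟨a, u, v, b, .inr (.inl h), e⟩
    · exact ⟨a, u, v, b, .inr (.inr (.inl h)), e⟩
    · exact ⟨a, u, v, b, .inr (.inr (.inr h)), e⟩)
  exact congrArg f h

theorem total_eq_of_eqv {M : Move n} (hφ : IsWeight φ) (hL : ∀ u v, M u v → BiLifts u v)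
    (hT : ∀ u v, M u v → SameTotal φ u v) {w w' : Word n} (h : Eqv (Cls M) [] w w')
    (hw : run w [] ≠ none) : total φ w [] = total φ w' [] := by
  have hT' : ∀ u v, Cls M u v → SameTotal φ u v := by
    rintro u v (h | h | h)
    · exact sameTotal_isotopy hφ h
    · exact sameTotal_reidemeister hφ h
    · exact hT u v h
  have key : ∀ w w', Relation.EqvGen (Step (Cls M) []) w w' → run w [] = run w' [] ∧
      (run w [] ≠ none → total φ w [] = total φ w' []) := by
    intro w w' h
    induction h with
    | rel x y h =>
      exact ⟨h.2, fun hx => total_eq_of_step (biLifts_cls hL) hT' h.1 hx (h.2 ▸ hx)⟩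
    | refl x => exact ⟨rfl, fun _ => rfl⟩
    | symm x y _ ih => exact ⟨ih.1.symm, fun hy => (ih.2 (ih.1 ▸ hy)).symm⟩
    | trans x y z _ _ ih ih' =>
      exact ⟨ih.1.trans ih'.1, fun hx => (ih.2 hx).trans (ih'.2 (ih.1 ▸ hx))⟩
  exact (key _ _ (h.2 hw)).2 hw

end Weight

/-! ### Linking numbers -/

/-- `1` for a strand oriented upwards and `-1` for a strand oriented downwards. -/
def sgn (s : Bool) : ℤ := if s then 1 else -1

theorem sgn_not (s : Bool) : sgn (!s) = -sgn s := by cases s <;> rfl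

/-- The sign of a crossing in which `i` passes over `j`. -/
def overWeight {n : ℕ} (i j : Fin n) (a : Bool) (x y : Fin n × Bool) : ℤ :=
  if a then if x.1 = i ∧ y.1 = j then sgn x.2 * sgn y.2 else 0
  else if y.1 = i ∧ x.1 = j then -(sgn x.2 * sgn y.2) else 0

/-- The hypothesis `i ≠ j` makes self-crossings, and with them curls, weightless. -/
theorem isWeight_overWeight {n : ℕ} {i j : Fin n} (hij : i ≠ j) : IsWeight (overWeight i j) where
  turn a k s z := by
    cases a <;> simp only [overWeight, sgn_not, Bool.not_true, Bool.not_false] <;>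
      split_ifs <;> simp_all [mul_comm]
  inv a x y := by
    cases a <;> simp only [overWeight, Bool.not_true, Bool.not_false] <;>
      split_ifs <;> simp_all [mul_comm]
  self a k s t := by
    have : ¬ (k = i ∧ k = j) := fun h => hij (h.1.symm.trans h.2)
    cases a <;> simp [overWeight, this]

/-- The sign of a crossing between `i` and `j`. -/
def crossWeight {n : ℕ} (i j : Fin n) (a : Bool) (x y : Fin n × Bool) : ℤ :=
  overWeight i j a x y + overWeight j i a x y

theorem isWeight_crossWeight {n : ℕ} {i j : Fin n} (hij : i ≠ j) :
    IsWeight (crossWeight i j) where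
  turn a k s z := by
    simp only [crossWeight, (isWeight_overWeight hij).turn, (isWeight_overWeight hij.symm).turn]
  inv a x y := by
    have h1 := (isWeight_overWeight hij).inv a x y
    have h2 := (isWeight_overWeight hij.symm).inv a x y
    simp only [crossWeight]
    linarith
  self a k s t := by
    simp only [crossWeight, (isWeight_overWeight hij).self, (isWeight_overWeight hij.symm).self,
      add_zero]

theorem crossWeight_comm {n : ℕ} (i j : Fin n) (a : Bool) (x y : Fin n × Bool) :
    crossWeight i j a x y = crossWeight i j a y x := by
  simp only [crossWeight, overWeight, mul_comm (sgn y.2), and_comm (a := y.1 = _)]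
  cases a <;> simp [add_comm]

/-- The parity of the crossings in which `i` passes over another component. -/
def parityWeight {n : ℕ} (i : Fin n) (a : Bool) (x y : Fin n × Bool) : ZMod 2 :=
  if x.1 ≠ y.1 ∧ (if a then x.1 else y.1) = i then 1 else 0

theorem isWeight_parityWeight {n : ℕ} (i : Fin n) : IsWeight (parityWeight i) where
  turn a k s z := by
    cases a <;> simp [parityWeight, ne_comm]
  inv a x y := by
    cases a <;> simp only [parityWeight, Bool.not_true, Bool.not_false, ne_comm] <;>
      split_ifs <;> simp_all <;> decide
  self a k s t := by simp [parityWeight]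

theorem parityWeight_swap {n : ℕ} (i : Fin n) (a : Bool) (x y : Fin n × Bool) :
    parityWeight i a y x = parityWeight i (!a) x y := by
  cases a <;> simp [parityWeight, ne_comm]

/-- A crossing change alters the count for `i` exactly when one strand belongs to `i` and the other
does not. Modulo 2 this is a sum of one term for each strand, which is why changing an even number
of crossings on every strand has no effect. -/
theorem parityWeight_add {n : ℕ} (i : Fin n) (a : Bool) (x y : Fin n × Bool) :
    parityWeight i (!a) x y = parityWeight i a x y +
      ((if x.1 = i then 1 else 0) + (if y.1 = i then 1 else 0)) := by
  have h2 : (1 : ZMod 2) + 1 = 0 := by decide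
  cases a <;> simp only [parityWeight, Bool.not_true, Bool.not_false] <;>
    by_cases h1 : x.1 = i <;> by_cases h3 : y.1 = i <;> by_cases h4 : x.1 = y.1 <;>
    simp_all

/-- Modulo 2 the sign is lost, and virtual conjugation has the effect of a crossing change
(`parityWeight_swap`). So all four crossings of the grid count as changed, and every strand takes
part in two of them. -/
theorem sameTotal_weldedBandPass {n : ℕ} (i : Fin n) {u v : Word n} (h : WeldedBandPass u v) :
    SameTotal (parityWeight i) u v := by
  have key : ∀ (a : Bool) (c : List (ℕ × Kind)) (p : ℕ),
      (∀ (x y z w : Fin n × Bool) (r : Level n),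
        total (parityWeight i) (toW c) (x :: y :: z :: w :: r) =
        parityWeight i (!a) y z + parityWeight i (!a) x z + parityWeight i (!a) y w +
        parityWeight i (!a) x w) → SameTotal (parityWeight i) (grid p a) (shift p (toW c)) := by
    intro a c p hc
    suffices h : SameTotal (parityWeight i) (grid 0 a) (toW c) from h.shift p (by simp [grid])
    intro l k hu _
    obtain ⟨x, y, z, w, r, rfl, rfl⟩ := run_grid_of_four (k₁ := .cl a) (k₂ := .cl a)
      (k₃ := .cl a) (k₄ := .cl a) hu
    rw [hc]
    change parityWeight i a y z + (parityWeight i a x z + (parityWeight i a y w +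
      (parityWeight i a x w + 0))) = _
    have h2 : ∀ t : ZMod 2, t + t = 0 := by decide
    simp only [parityWeight_add]
    generalize (if x.1 = i then (1 : ZMod 2) else 0) = X
    generalize (if y.1 = i then (1 : ZMod 2) else 0) = Y
    generalize (if z.1 = i then (1 : ZMod 2) else 0) = Z
    generalize (if w.1 = i then (1 : ZMod 2) else 0) = W
    linear_combination -(h2 X) - (h2 Y) - (h2 Z) - (h2 W)
  cases h with
  | bottom p a =>
    refine key a [(1, .virt), (1, .cl a), (1, .virt), (0, .cl !a), (2, .cl !a), (1, .cl !a)] p ?_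
    intro x y z w r
    change 0 + (parityWeight i a z y + (0 + (parityWeight i (!a) x z + (parityWeight i (!a) y w +
      (parityWeight i (!a) x w + 0))))) = _
    rw [parityWeight_swap i a y z]; ring
  | left p a =>
    refine key a [(1, .cl !a), (0, .virt), (0, .cl a), (0, .virt), (2, .cl !a), (1, .cl !a)] p ?_
    intro x y z w r
    change parityWeight i (!a) y z + (0 + (parityWeight i a z x + (0 + (parityWeight i (!a) y w +
      (parityWeight i (!a) x w + 0))))) = _
    rw [parityWeight_swap i a x z]; ring
  | right p a =>
    refine key a [(1, .cl !a), (0, .cl !a), (2, .virt), (2, .cl a), (2, .virt), (1, .cl !a)] p ?_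
    intro x y z w r
    change parityWeight i (!a) y z + (parityWeight i (!a) x z + (0 + (parityWeight i a w y + (0 +
      (parityWeight i (!a) x w + 0))))) = _
    rw [parityWeight_swap i a y w]; ring
  | top p a =>
    refine key a [(1, .cl !a), (0, .cl !a), (2, .cl !a), (1, .virt), (1, .cl a), (1, .virt)] p ?_
    intro x y z w r
    change parityWeight i (!a) y z + (parityWeight i (!a) x z + (parityWeight i (!a) y w + (0 +
      (parityWeight i a w x + (0 + 0))))) = _
    rw [parityWeight_swap i a x w]; ring

/-! ### Elementary equivalences -/

/-- The moves include planar isotopy and the classical Reidemeister moves. -/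
def Base {n : ℕ} (R : Move n) : Prop := ∀ u v, Isotopy u v ∨ Reidemeister u v → R u v

theorem base_cls {n : ℕ} (M : Move n) : Base (Cls M) := by
  rintro u v (h | h)
  · exact .inl h
  · exact .inr (.inl h)

theorem base_wld {n : ℕ} (M : Move n) : Base (Wld M) := by
  rintro u v (h | h)
  · exact .inl h
  · exact .inr (.inl h)

section Elementary

variable {n : ℕ} {R : Move n} (hR : Base R)
include hR

theorem far_eqv (g h : Piece n) (p d : ℕ) :
    UEqv R [(p, g), (p + g.cod + d, h)] [(p + g.dom + d, h), (p, g)] :=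
  .of_move (hR _ _ (.inl (.far g h p d))) (far_run g h p d)

theorem cross_cross {p q : ℕ} (h : p + 2 ≤ q) (k k' : Kind) :
    UEqv R [X p k, X q k'] [X q k', X p k] := by
  obtain ⟨d, rfl⟩ := Nat.exists_eq_add_of_le h
  exact far_eqv hR (.cross k) (.cross k') p d

theorem cross_cup_of_le {p q : ℕ} (h : q ≤ p) (k : Kind) (i : Fin n) (s : Bool) :
    UEqv R [X p k, (q, .cup i s)] [(q, .cup i s), X (p + 2) k] := by
  obtain ⟨d, rfl⟩ := Nat.exists_eq_add_of_le h
  have := (far_eqv hR (.cup i s) (.cross k) q d).symm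
  simp only [Piece.dom, Piece.cod, Nat.add_zero] at this
  rwa [show q + 2 + d = q + d + 2 by omega] at this

theorem cross_cup_of_add_le {p q : ℕ} (h : p + 2 ≤ q) (k : Kind) (i : Fin n) (s : Bool) :
    UEqv R [X p k, (q, .cup i s)] [(q, .cup i s), X p k] := by
  obtain ⟨d, rfl⟩ := Nat.exists_eq_add_of_le h
  exact far_eqv hR (.cross k) (.cup i s) p d

theorem cap_cross_of_le {p q : ℕ} (h : q ≤ p) (k : Kind) :
    UEqv R [(q, .cap), X p k] [X (p + 2) k, (q, .cap)] := by
  obtain ⟨d, rfl⟩ := Nat.exists_eq_add_of_le h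
  have := far_eqv hR .cap (.cross k) q d
  simp only [Piece.dom, Piece.cod, Nat.add_zero] at this
  rwa [show q + 2 + d = q + d + 2 by omega] at this

theorem cap_cross_of_add_le {p q : ℕ} (h : p + 2 ≤ q) (k : Kind) :
    UEqv R [(q, .cap), X p k] [X p k, (q, .cap)] := by
  obtain ⟨d, rfl⟩ := Nat.exists_eq_add_of_le h
  exact (far_eqv hR (.cross k) .cap p d).symm

theorem cap_cup_of_le {p q : ℕ} (h : q ≤ p) (i : Fin n) (s : Bool) :
    UEqv R [(q, .cap), (p, .cup i s)] [(p + 2, .cup i s), (q, .cap)] := by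
  obtain ⟨d, rfl⟩ := Nat.exists_eq_add_of_le h
  have := far_eqv hR .cap (.cup i s) q d
  simp only [Piece.dom, Piece.cod, Nat.add_zero] at this
  rwa [show q + 2 + d = q + d + 2 by omega] at this

theorem cup_cup_of_le {p q : ℕ} (h : p ≤ q) (i j : Fin n) (s t : Bool) :
    UEqv R [(p, .cup i s), (q + 2, .cup j t)] [(q, .cup j t), (p, .cup i s)] := by
  obtain ⟨d, rfl⟩ := Nat.exists_eq_add_of_le h
  have := far_eqv hR (.cup i s) (.cup j t) p d
  simp only [Piece.dom, Piece.cod, Nat.add_zero] at this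
  rwa [show p + 2 + d = p + d + 2 by omega] at this

theorem cap_cap_of_le {p q : ℕ} (h : p ≤ q) :
    UEqv R [(p, .cap), (q, .cap)] ([(q + 2, .cap), (p, .cap)] : Word n) := by
  obtain ⟨d, rfl⟩ := Nat.exists_eq_add_of_le h
  have := far_eqv hR .cap .cap p d
  simp only [Piece.dom, Piece.cod, Nat.add_zero] at this
  rwa [show p + 2 + d = p + d + 2 by omega] at this

theorem slideCup_eqv (p : ℕ) (i : Fin n) (s : Bool) (k : Kind) :
    UEqv R [(p, .cup i s), X (p + 1) k] [(p + 1, .cup i s), X p k.flip] :=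
  .of_move (hR _ _ (.inl (.slideCup p i s k))) (run_slideCup p i s k _)

theorem slideCap_eqv (p : ℕ) (k : Kind) :
    UEqv R [X p k, (p + 1, .cap)] [X (p + 1) k.flip, (p, .cap)] :=
  .of_move (hR _ _ (.inl (.slideCap p k))) (run_slideCap p k _)

omit hR in
theorem Eqv.of_biLifts {l : Level n} {u v : Word n} (h : R u v) (hb : BiLifts u v)
    (hu : run u l ≠ none) (hv : run v l ≠ none) : Eqv R l u v := by
  obtain ⟨k, hk⟩ := Option.ne_none_iff_exists'.1 hu
  obtain ⟨k', hk'⟩ := Option.ne_none_iff_exists'.1 hv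
  exact .of_move h (by rw [hk, hk', hb.1.run_eq hk hk'])

theorem cancel_eqv {l : Level n} {p : ℕ} (h : p + 2 ≤ l.length) (a : Bool) :
    Eqv R l [X p (.cl a), X p (.cl !a)] [] := by
  have hb := biLifts_reidemeister (n := n) (.R2 p a)
  refine .of_biLifts (hR _ _ (.inr (.R2 p a))) hb ?_ (by simp [run])
  obtain ⟨k, hk, -⟩ := run_toW_isSome (b := [(p, .cl a), (p, .cl !a)]) (l := l) (by simpa using h)
  exact ne_of_eq_of_ne hk (by simp)

theorem kink_eqv {l : Level n} {p : ℕ} {a : Bool} {u : Word n} (h : Kink p (.cl a) u)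
    (hu : run u l ≠ none) : Eqv R l u [] :=
  .of_biLifts (hR _ _ (.inr (.R1 p a u h))) (biLifts_kink h) hu (by simp [run])

theorem zigzag_eqv {l : Level n} {p : ℕ} {i : Fin n} {s : Bool}
    (hu : run [(p + 1, .cup i s), (p, .cap)] l ≠ none) :
    Eqv R l [(p + 1, .cup i s), (p, .cap)] [] :=
  .of_biLifts (hR _ _ (.inl (.zigzag p i s))) (biLifts_zigzag p i s) hu (by simp [run])

theorem zagzig_eqv {l : Level n} {p : ℕ} {i : Fin n} {s : Bool}
    (hu : run [(p, .cup i s), (p + 1, .cap)] l ≠ none) :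
    Eqv R l [(p, .cup i s), (p + 1, .cap)] [] :=
  .of_biLifts (hR _ _ (.inl (.zagzig p i s))) (biLifts_zagzig p i s) hu (by simp [run])

/-- Move a crossing word to the right. -/
def up (d : ℕ) (b : List (ℕ × Kind)) : List (ℕ × Kind) := b.map fun x => (x.1 + d, x.2)

theorem toW_cup_of_le {q : ℕ} {b : List (ℕ × Kind)} (h : ∀ x ∈ b, q ≤ x.1) (i : Fin n) (s : Bool) :
    UEqv R (toW b ++ [(q, .cup i s)]) ([(q, .cup i s)] ++ toW (up 2 b)) := by
  induction b with
  | nil => exact .refl _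
  | cons x b ih =>
    have h1 := (ih fun y hy => h y (by simp [hy])).append_left [X x.1 x.2]
    have h2 := (cross_cup_of_le hR (h x (by simp)) x.2 i s).append_right (toW (up 2 b))
    exact h1.trans h2

theorem toW_cup_of_add_le {q : ℕ} {b : List (ℕ × Kind)} (h : ∀ x ∈ b, x.1 + 2 ≤ q) (i : Fin n)
    (s : Bool) : UEqv R (toW b ++ [(q, .cup i s)]) ([(q, .cup i s)] ++ toW b) := by
  induction b with
  | nil => exact .refl _
  | cons x b ih =>
    have h1 := (ih fun y hy => h y (by simp [hy])).append_left [X x.1 x.2]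
    have h2 := (cross_cup_of_add_le hR (h x (by simp)) x.2 i s).append_right (toW b)
    exact h1.trans h2

theorem cap_toW_of_add_le {q : ℕ} {b : List (ℕ × Kind)} (h : ∀ x ∈ b, x.1 + 2 ≤ q) :
    UEqv R (toW b ++ [(q, .cap)]) ([(q, .cap)] ++ toW b : Word n) := by
  induction b with
  | nil => exact .refl _
  | cons x b ih =>
    have h1 := (ih fun y hy => h y (by simp [hy])).append_left [X x.1 x.2]
    have h2 := (cap_cross_of_add_le hR (h x (by simp)) x.2).symm.append_right (toW b)
    exact h1.trans h2

/-! ### The group of crossing words -/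

/-- Two crossing words are equivalent on all sufficiently large levels. -/
def crossCon {n : ℕ} (R : Move n) : Con (FreeMonoid (ℕ × Kind)) where
  r b c := ∃ N, ∀ l : Level n, N ≤ l.length → Eqv R l (toW b.toList) (toW c.toList)
  iseqv :=
    { refl := fun _ => ⟨0, fun _ _ => .refl _⟩
      symm := fun ⟨N, h⟩ => ⟨N, fun l hl => (h l hl).symm⟩
      trans := fun ⟨N, h⟩ ⟨N', h'⟩ => ⟨max N N', fun l hl =>
        (h l (le_trans (le_max_left _ _) hl)).trans (h' l (le_trans (le_max_right _ _) hl))⟩ }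
  mul' := by
    rintro b b' c c' ⟨N, h⟩ ⟨N', h'⟩
    obtain ⟨K, hK⟩ : ∃ K, ∀ x ∈ b'.toList, x.1 + 2 ≤ K := by
      generalize b'.toList = l
      induction l with
      | nil => exact ⟨0, by simp⟩
      | cons x l ih =>
        obtain ⟨K, hK⟩ := ih
        refine ⟨max (x.1 + 2) K, fun y hy => ?_⟩
        rcases List.mem_cons.1 hy with rfl | hy
        · exact le_max_left _ _
        · exact (hK y hy).trans (le_max_right _ _)
    refine ⟨max (max N N') K, fun l hl => ?_⟩
    rw [max_le_iff, max_le_iff] at hl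
    rw [FreeMonoid.toList_mul, FreeMonoid.toList_mul, toW_append, toW_append]
    refine ((h l hl.1.1).append_right _).trans (.append_left fun m hm => h' m ?_)
    obtain ⟨k, hk, hlen⟩ := run_toW_isSome (b := b'.toList) (l := l)
      fun x hx => (hK x hx).trans hl.2
    rw [hk, Option.some.injEq] at hm
    rw [← hm, hlen]
    exact hl.1.2

/-- A zigzag on the last strand of the level produces two additional strands between its minimum and
its maximum. Crossing words on the original strands slide past the minimum, so the problem moves to
a level with two more strands; repeat until the level is large enough. -/
theorem narrow {b c : List (ℕ × Kind)}
    (h : crossCon R (FreeMonoid.ofList b) (FreeMonoid.ofList c)) {l : Level n}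
    (hb : ∀ x ∈ b, x.1 + 2 ≤ l.length) (hc : ∀ x ∈ c, x.1 + 2 ≤ l.length) :
    Eqv R l (toW b) (toW c) := by
  -- The empty level has no strand to bend, but only the empty crossing word fits there.
  by_cases hl : l = []
  · subst hl
    have : ∀ {d : List (ℕ × Kind)}, (∀ x ∈ d, x.1 + 2 ≤ ([] : Level n).length) → d = [] := by
      intro d hd
      cases d with
      | nil => rfl
      | cons x d => have := hd x (by simp); simp at this
    rw [this hb, this hc]
    exact .refl _
  obtain ⟨N, h⟩ := h
  obtain ⟨K, hK⟩ : ∃ K, N ≤ l.length + 2 * K := ⟨N, by omega⟩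
  induction K generalizing l with
  | zero => exact h l (by omega)
  | succ K ih =>
    set q := l.length with hq
    obtain ⟨p, hp⟩ : ∃ p, q = p + 1 := Nat.exists_eq_succ_of_ne_zero (by
      rw [hq]; exact fun h0 => hl (List.length_eq_zero_iff.1 h0))
    obtain ⟨m, hm, hmlen⟩ := run_toW_isSome (b := b) (l := l) hb
    have hm0 : m ≠ [] := by
      intro h0; rw [h0] at hmlen; simp at hmlen; omega
    obtain ⟨m', y, rfl⟩ := (List.eq_nil_or_concat m).resolve_left hm0
    rw [List.concat_eq_append] at hm hmlen hm0
    have hm'len : m'.length = p := by simp at hmlen; omega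
    have hzz : run [(p + 1, .cup y.1 !y.2), (p, .cap)] (m' ++ [y]) ≠ none := by
      have := run_shift [(1, .cup y.1 !y.2), (0, .cap)] m' [y]
      rw [hm'len] at this
      change run [(p + 1, .cup y.1 !y.2), (p, .cap)] (m' ++ [y]) = _ at this
      rw [this]
      simp [run, act]
    have e1 : Eqv R l (toW b) (toW b ++ [(p + 1, .cup y.1 !y.2), (p, .cap)]) := by
      have : Eqv R l (toW b ++ [(p + 1, .cup y.1 !y.2), (p, .cap)]) (toW b ++ []) :=
        .append_left fun k hk => by
          rw [hm, Option.some.injEq] at hk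
          subst hk
          exact zigzag_eqv hR hzz
      simpa using this.symm
    have hrun : run (toW b ++ [(p + 1, .cup y.1 !y.2), (p, .cap)]) l = some (m' ++ [y]) := by
      rw [← e1.1, hm]
    have comm : ∀ d : List (ℕ × Kind), (∀ x ∈ d, x.1 + 2 ≤ q) →
        UEqv R (toW d ++ [(p + 1, .cup y.1 !y.2), (p, .cap)])
          ([(p + 1, .cup y.1 !y.2)] ++ toW d ++ [(p, .cap)]) := by
      intro d hd
      have := (toW_cup_of_add_le hR (q := p + 1) (b := d) (fun x hx => hp ▸ hd x hx) y.1
        (!y.2)).append_right [(p, .cap)]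
      simpa using this
    have e2 : Eqv R l ([(p + 1, .cup y.1 !y.2)] ++ toW b) ([(p + 1, .cup y.1 !y.2)] ++ toW c) := by
      refine .append_left fun k hk => ?_
      rw [run_singleton] at hk
      have hlen := (length_of_act hk).2
      simp only [Piece.dom, Piece.cod] at hlen
      refine ih (fun x hx => (hb x hx).trans (by omega)) (fun x hx => (hc x hx).trans (by omega))
        ?_ (by omega)
      rintro rfl
      simp at hlen
    have e3 : Eqv R l (toW b) (toW c ++ [(p + 1, .cup y.1 !y.2), (p, .cap)]) :=
      e1.trans (((comm b hb l).trans (e2.append_right _)).trans (comm c hc l).symm)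
    obtain ⟨k, hk, -⟩ := run_toW_isSome (b := c) (l := l) hc
    have e4 : Eqv R l (toW c ++ [(p + 1, .cup y.1 !y.2), (p, .cap)]) (toW c ++ []) := by
      refine .append_left fun k' hk' => zigzag_eqv hR ?_
      have h3 := e3.1
      rw [hm, run_append, hk'] at h3
      intro h0
      rw [Option.bind_some, h0] at h3
      simp at h3
    simpa using e3.trans e4

/-- The monoid of crossing words. -/
abbrev CrossMonoid {n : ℕ} (R : Move n) := (crossCon R).Quotient

omit hR in
/-- The class of a crossing word. -/
def cls {n : ℕ} (R : Move n) (b : List (ℕ × Kind)) : CrossMonoid R :=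
  (FreeMonoid.ofList b : FreeMonoid (ℕ × Kind))

omit hR in
theorem cls_append (b c : List (ℕ × Kind)) : cls R (b ++ c) = cls R b * cls R c := rfl

omit hR in
theorem cls_nil : cls R [] = 1 := rfl

omit hR in
theorem cls_eq_of_eqv {b c : List (ℕ × Kind)} (N : ℕ)
    (h : ∀ l : Level n, N ≤ l.length → Eqv R l (toW b) (toW c)) : cls R b = cls R c :=
  (Con.eq _).2 ⟨N, h⟩

theorem eqv_of_cls_eq {b c : List (ℕ × Kind)} (h : cls R b = cls R c) {l : Level n}
    (hb : ∀ x ∈ b, x.1 + 2 ≤ l.length) (hc : ∀ x ∈ c, x.1 + 2 ≤ l.length) :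
    Eqv R l (toW b) (toW c) :=
  narrow hR ((Con.eq _).1 h) hb hc

end Elementary

/-! ### Delta families -/

/-- A sequence of elements of a group which satisfies the braid relations and the relation given
by the move `Δ`. -/
structure IsDeltaFamily {G : Type*} [Group G] (s : ℕ → G) : Prop where
  far : ∀ {p q}, p + 2 ≤ q → Commute (s p) (s q)
  braid : ∀ p, s p * s (p + 1) * s p = s (p + 1) * s p * s (p + 1)
  sq : ∀ p, Commute (s p * s p) (s (p + 1) * s (p + 1))

section Braid

variable {G : Type*} [Group G] {a b : G}

theorem conj_of_braid (h : a * b * a = b * a * b) : b * a * b⁻¹ = a⁻¹ * b * a := by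
  rw [mul_inv_eq_iff_eq_mul, mul_assoc, mul_assoc, eq_inv_mul_iff_mul_eq]
  simpa [mul_assoc] using h

theorem conj_sq_of_braid (h : a * b * a = b * a * b) :
    b * (a * a) * b⁻¹ = a⁻¹ * (b * b) * a := by
  have h1 := conj_of_braid h
  calc b * (a * a) * b⁻¹ = (b * a * b⁻¹) * (b * a * b⁻¹) := by group
    _ = _ := by rw [h1]; group

/-- Left multiplication by the half twist `a * b * a = b * a * b` turns the two sides of the
relation into `(b * b) * (a * a)` and `(a * a) * (b * b)`. -/
theorem delta_iff_commute_sq (h : a * b * a = b * a * b) :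
    a * b⁻¹ * a = b * a⁻¹ * b ↔ Commute (a * a) (b * b) := by
  have h4 : (a * b * a) * (a * b⁻¹ * a) = (b * b) * (a * a) := by
    calc (a * b * a) * (a * b⁻¹ * a) = a * (b * (a * a) * b⁻¹) * a := by group
      _ = _ := by rw [conj_sq_of_braid h]; group
  have h5 : (b * a * b) * (b * a⁻¹ * b) = (a * a) * (b * b) := by
    calc (b * a * b) * (b * a⁻¹ * b) = b * (a * (b * b) * a⁻¹) * b := by group
      _ = _ := by rw [conj_sq_of_braid h.symm]; group
  rw [← mul_right_inj (a * b * a), h4]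
  nth_rewrite 1 [h]
  rw [h5, eq_comm, commute_iff_eq]

end Braid

/-! ### Clasps and chords -/

section Chord

variable {G : Type*} [Group G] (s : ℕ → G)

/-- The pure braid in which the strands `z` and `z + d + 1` are clasped. -/
def clasp (z : ℕ) : ℕ → G
  | 0 => s z * s z
  | d + 1 => (s (z + d + 1))⁻¹ * clasp z d * s (z + d + 1)

/-- The pure braid in which the strands `z` and `t` are clasped. -/
def chord (z t : ℕ) : G := clasp s (min z t) (max z t - min z t - 1)

theorem chord_comm (z t : ℕ) : chord s z t = chord s t z := by
  simp only [chord, min_comm, max_comm]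

theorem chord_add (z d : ℕ) : chord s z (z + d + 1) = clasp s z d := by
  have h1 : min z (z + d + 1) = z := by omega
  have h2 : max z (z + d + 1) - z - 1 = d := by omega
  rw [chord, h1, h2]

theorem chord_succ (z : ℕ) : chord s z (z + 1) = s z * s z := chord_add s z 0

variable {s} (hs : IsDeltaFamily s)
include hs

theorem IsDeltaFamily.commute_clasp {i z d : ℕ} (h : i + 2 ≤ z ∨ z + d + 2 ≤ i) :
    Commute (s i) (clasp s z d) := by
  induction d with
  | zero =>
    refine (fun h => Commute.mul_right h h) ?_
    rcases h with h | h
    · exact hs.far h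
    · exact (hs.far (by omega)).symm
  | succ d ih =>
    have h1 : Commute (s i) (s (z + d + 1)) := by
      rcases h with h | h
      · exact hs.far (by omega)
      · exact (hs.far (by omega)).symm
    exact (h1.inv_right.mul_right (ih (by omega))).mul_right h1

theorem IsDeltaFamily.conj_sq (p : ℕ) :
    (s (p + 1))⁻¹ * (s p * s p) * s (p + 1) = s p * (s (p + 1) * s (p + 1)) * (s p)⁻¹ :=
  (conj_sq_of_braid (hs.braid p).symm).symm

/-- Conjugation by the generator to the right of a clasp. -/
theorem IsDeltaFamily.sq_commute_clasp (z d : ℕ) : Commute (s (z + d + 1) * s (z + d + 1)) (clasp s z d) := by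
  induction d with
  | zero => exact (hs.sq z).symm
  | succ d ih =>
    have h1 : Commute (s (z + d + 2)) (clasp s z d) := hs.commute_clasp (by omega)
    have h2 : Commute (s (z + d + 1) * (s (z + d + 2) * s (z + d + 2)) * (s (z + d + 1))⁻¹) (clasp s z d) := by
      rw [← hs.conj_sq (z + d + 1)]
      exact (h1.inv_left.mul_left ih).mul_left h1
    have h3 : (s (z + d + 2) * s (z + d + 2)) = (s (z + d + 1))⁻¹ *
        (s (z + d + 1) * (s (z + d + 2) * s (z + d + 2)) * (s (z + d + 1))⁻¹) * s (z + d + 1) := by group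
    change (s (z + d + 2) * s (z + d + 2)) * ((s (z + d + 1))⁻¹ * clasp s z d * s (z + d + 1)) = 
      (s (z + d + 1))⁻¹ * clasp s z d * s (z + d + 1) * (s (z + d + 2) * s (z + d + 2))
    rw [h3]
    have h4 := h2.eq
    set x := s (z + d + 1) * (s (z + d + 2) * s (z + d + 2)) * (s (z + d + 1))⁻¹
    calc _ = (s (z + d + 1))⁻¹ * (x * clasp s z d) * s (z + d + 1) := by group
      _ = _ := by rw [h4]; group

/-- Together with `IsDeltaFamily.sq_commute_clasp`, this is where the relation `sq` enters. The
other commutation rules for clasps need only the braid relations. -/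
theorem IsDeltaFamily.left_sq_commute_clasp (z d : ℕ) :
    Commute (s z * s z) (clasp s (z + 1) d) := by
  induction d with
  | zero => exact hs.sq z
  | succ d ih =>
    have h1 : Commute (s z * s z) (s (z + 1 + d + 1)) := (fun h => Commute.mul_left h h) (hs.far (by omega))
    exact (h1.inv_right.mul_right ih).mul_right h1

theorem IsDeltaFamily.clasp_mul_left (z d : ℕ) :
    clasp s z (d + 1) * s z = s z * clasp s (z + 1) d := by
  induction d with
  | zero =>
    change (s (z + 1))⁻¹ * (s z * s z) * s (z + 1) * s z = s z * (s (z + 1) * s (z + 1))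
    rw [hs.conj_sq z, inv_mul_cancel_right]
  | succ d ih =>
    have h1 : Commute (s z) (s (z + d + 2)) := hs.far (by omega)
    have e : z + 1 + d + 1 = z + d + 2 := by omega
    change (s (z + d + 2))⁻¹ * clasp s z (d + 1) * s (z + d + 2) * s z =
      s z * ((s (z + 1 + d + 1))⁻¹ * clasp s (z + 1) d * s (z + 1 + d + 1))
    rw [e]
    calc _ = (s (z + d + 2))⁻¹ * clasp s z (d + 1) * (s (z + d + 2) * s z) := by group
      _ = (s (z + d + 2))⁻¹ * (clasp s z (d + 1) * s z) * s (z + d + 2) := by rw [← h1.eq]; group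
      _ = ((s (z + d + 2))⁻¹ * s z) * clasp s (z + 1) d * s (z + d + 2) := by rw [ih]; group
      _ = _ := by rw [← h1.inv_right.eq]; group

/-- The clasp passes on one side of the strands between its ends, and a crossing of two of these
strands slides through it by one braid relation. -/
theorem IsDeltaFamily.clasp_mul_mid {z d i : ℕ} (h : z < i) (h' : i + 1 < z + d + 1) :
    Commute (s i) (clasp s z d) := by
  induction d with
  | zero => omega
  | succ d ih =>
    rcases Nat.lt_or_ge (i + 1) (z + d + 1) with h1 | h1
    · have h2 : Commute (s i) (s (z + d + 1)) := hs.far (by omega)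
      exact (h2.inv_right.mul_right (ih h1)).mul_right h2
    · obtain ⟨e, rfl⟩ : ∃ e, d = e + 1 := ⟨d - 1, by omega⟩
      obtain rfl : i = z + e + 1 := by omega
      have hb := hs.braid (z + e + 1)
      have h2 : Commute (s (z + e + 2)) (clasp s z e) := hs.commute_clasp (by omega)
      change s (z + e + 1) * ((s (z + e + 2))⁻¹ * ((s (z + e + 1))⁻¹ * clasp s z e *
        s (z + e + 1)) * s (z + e + 2)) = (s (z + e + 2))⁻¹ * ((s (z + e + 1))⁻¹ * clasp s z e *
        s (z + e + 1)) * s (z + e + 2) * s (z + e + 1)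
      change s (z + e + 1) * s (z + e + 2) * s (z + e + 1) =
        s (z + e + 2) * s (z + e + 1) * s (z + e + 2) at hb
      generalize s (z + e + 1) = a at *
      generalize s (z + e + 2) = b at *
      generalize clasp s z e = x at *
      have e1 : a * b⁻¹ * a⁻¹ = b⁻¹ * a⁻¹ * b := by
        have := congrArg (·⁻¹) (conj_of_braid hb.symm)
        simpa [mul_assoc] using this
      have e2 : b * a * b = a * b * a := hb.symm
      calc a * (b⁻¹ * (a⁻¹ * x * a) * b) = (a * b⁻¹ * a⁻¹) * x * a * b := by group
        _ = b⁻¹ * a⁻¹ * (b * x) * a * b := by rw [e1]; group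
        _ = b⁻¹ * a⁻¹ * x * (b * a * b) := by rw [h2.eq]; group
        _ = _ := by rw [e2]; group

/-- Generators permute the ends of chords. -/
theorem IsDeltaFamily.chord_mul {z t : ℕ} (h : z ≠ t) (i : ℕ) :
    chord s z t * s i = s i * chord s (Equiv.swap i (i + 1) z) (Equiv.swap i (i + 1) t) := by
  wlog hzt : z < t generalizing z t
  · rw [chord_comm, this h.symm (by omega), chord_comm]
  obtain ⟨d, rfl⟩ : ∃ d, t = z + d + 1 := ⟨t - z - 1, by omega⟩
  have hsw : ∀ x, x ≠ i → x ≠ i + 1 → Equiv.swap i (i + 1) x = x := fun x h h' =>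
    Equiv.swap_apply_of_ne_of_ne h h'
  rw [chord_add]
  by_cases h1 : i + 2 ≤ z ∨ z + d + 2 ≤ i
  · rw [hsw _ (by omega) (by omega), hsw _ (by omega) (by omega), chord_add]
    exact (hs.commute_clasp h1).eq.symm
  by_cases h2 : z < i ∧ i + 1 < z + d + 1
  · rw [hsw _ (by omega) (by omega), hsw _ (by omega) (by omega), chord_add]
    exact (hs.clasp_mul_mid h2.1 h2.2).eq.symm
  -- From here on the generator moves an end of the chord. Lengthening on the right is the
  -- definition of `clasp`, and shortening on the left follows from braid relations. In the opposite
  -- directions the generator appears on the wrong side, and its square has to commute with the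
  -- clasp.
  by_cases h3 : i = z + d + 1
  · subst h3
    rw [hsw _ (by omega) (by omega), Equiv.swap_apply_left]
    rw [show z + d + 1 + 1 = z + (d + 1) + 1 by omega, chord_add]
    simp [clasp, mul_assoc]
  by_cases h4 : i + 1 = z
  · subst h4
    rw [Equiv.swap_apply_right, hsw _ (by omega) (by omega)]
    rw [show i + 1 + d + 1 = i + (d + 1) + 1 by omega, chord_add]
    have e1 := hs.clasp_mul_left i d
    have e2 := (hs.left_sq_commute_clasp i d).eq
    have e3 : clasp s i (d + 1) = s i * clasp s (i + 1) d * (s i)⁻¹ := by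
      rw [eq_mul_inv_iff_mul_eq, e1]
    rw [e3]
    calc clasp s (i + 1) d * s i = (clasp s (i + 1) d * (s i * s i)) * (s i)⁻¹ := by group
      _ = _ := by rw [← e2]; group
  by_cases h5 : i = z
  · subst h5
    rw [Equiv.swap_apply_left]
    rcases Nat.eq_zero_or_pos d with rfl | hd
    · rw [Equiv.swap_apply_right, chord_comm, chord_succ]
      simp [clasp, mul_assoc]
    · obtain ⟨e, rfl⟩ : ∃ e, d = e + 1 := ⟨d - 1, by omega⟩
      rw [hsw _ (by omega) (by omega), hs.clasp_mul_left,
        show i + (e + 1) + 1 = i + 1 + e + 1 by omega, chord_add]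
  · obtain ⟨e, rfl⟩ : ∃ e, d = e + 1 := ⟨d - 1, by omega⟩
    obtain rfl : i = z + e + 1 := by omega
    rw [hsw _ (by omega) (by omega), show z + (e + 1) + 1 = z + e + 1 + 1 by omega,
      Equiv.swap_apply_right, chord_add]
    have e2 := (hs.sq_commute_clasp z e).eq
    calc (s (z + e + 1))⁻¹ * clasp s z e * s (z + e + 1) * s (z + e + 1)
        = (s (z + e + 1))⁻¹ * (clasp s z e * (s (z + e + 1) * s (z + e + 1))) := by group
      _ = _ := by rw [← e2]; group

theorem IsDeltaFamily.chord_mul_inv {z t : ℕ} (h : z ≠ t) (i : ℕ) :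
    chord s z t * (s i)⁻¹ =
      (s i)⁻¹ * chord s (Equiv.swap i (i + 1) z) (Equiv.swap i (i + 1) t) := by
  rw [mul_inv_eq_iff_eq_mul, mul_assoc, hs.chord_mul (by simpa using h)]
  simp

/-- The square of a generator moves the ends of a chord twice by the same transposition, hence
commutes with every chord. The remaining chords are conjugates of such squares, and conjugation only
permutes the chords it is tested against. -/
theorem IsDeltaFamily.chord_commute {z t x y : ℕ} (h : z ≠ t) (h' : x ≠ y) :
    Commute (chord s z t) (chord s x y) := by
  wlog hxy : x < y generalizing x y
  · rw [chord_comm s x]; exact this h'.symm (by omega)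
  obtain ⟨d, rfl⟩ : ∃ d, y = x + d + 1 := ⟨y - x - 1, by omega⟩
  rw [chord_add]
  clear hxy h'
  induction d generalizing z t with
  | zero =>
    change _ * (s x * s x) = s x * s x * _
    rw [← mul_assoc, hs.chord_mul h, mul_assoc, hs.chord_mul (by simpa using h)]
    simp [mul_assoc]
  | succ d ih =>
    change _ * ((s (x + d + 1))⁻¹ * clasp s x d * s (x + d + 1)) =
      (s (x + d + 1))⁻¹ * clasp s x d * s (x + d + 1) * _
    rw [← mul_assoc, ← mul_assoc, hs.chord_mul_inv h, mul_assoc (s (x + d + 1))⁻¹,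
      (ih (by simpa using h)).eq, ← mul_assoc, mul_assoc, hs.chord_mul (by simpa using h)]
    simp [mul_assoc]

end Chord

/-! ### Subgroups of braids and of chords -/

section Chord

variable {G : Type*} [Group G] (s : ℕ → G)

/-- The braids on the strands `q, …, N - 1`. -/
def braidGrp (q N : ℕ) : Subgroup G := Subgroup.closure {g | ∃ i, q ≤ i ∧ i + 2 ≤ N ∧ g = s i}

/-- The subgroup generated by the chords joining strands in `S`. -/
def chordGrp (S : Set ℕ) : Subgroup G :=
  Subgroup.closure {g | ∃ z t, z ∈ S ∧ t ∈ S ∧ z ≠ t ∧ g = chord s z t}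

variable {s}

theorem gen_mem {i q N : ℕ} (h : q ≤ i) (h' : i + 2 ≤ N) : s i ∈ braidGrp s q N :=
  Subgroup.subset_closure ⟨i, h, h', rfl⟩

theorem chord_mem {S : Set ℕ} {z t : ℕ} (hz : z ∈ S) (ht : t ∈ S) (h : z ≠ t) :
    chord s z t ∈ chordGrp s S :=
  Subgroup.subset_closure ⟨z, t, hz, ht, h, rfl⟩

theorem braidGrp_mono {q q' N N' : ℕ} (h : q' ≤ q) (h' : N ≤ N') :
    braidGrp s q N ≤ braidGrp s q' N' := by
  refine Subgroup.closure_mono ?_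
  rintro _ ⟨i, h1, h2, rfl⟩
  exact ⟨i, by omega, by omega, rfl⟩

theorem chordGrp_mono {S T : Set ℕ} (h : S ⊆ T) : chordGrp s S ≤ chordGrp s T := by
  refine Subgroup.closure_mono ?_
  rintro _ ⟨z, t, hz, ht, h1, rfl⟩
  exact ⟨z, t, h hz, h ht, h1, rfl⟩

theorem braidGrp_eq_bot {q N : ℕ} (h : N ≤ q + 1) : braidGrp s q N = ⊥ := by
  rw [braidGrp, Subgroup.closure_eq_bot_iff]
  rintro _ ⟨i, h1, h2, rfl⟩
  omega

theorem clasp_mem {z d N : ℕ} (h : z + d + 2 ≤ N) : clasp s z d ∈ braidGrp s z N := by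
  induction d with
  | zero => exact mul_mem (gen_mem le_rfl h) (gen_mem le_rfl h)
  | succ d ih =>
    have h1 : s (z + d + 1) ∈ braidGrp s z N := gen_mem (by omega) (by omega)
    exact mul_mem (mul_mem (inv_mem h1) (ih (by omega))) h1

theorem chord_mem_braidGrp {z t N : ℕ} (h : z ≠ t) (hz : z < N) (ht : t < N) :
    chord s z t ∈ braidGrp s 0 N :=
  braidGrp_mono (Nat.zero_le _) le_rfl (clasp_mem (by omega))

theorem chordGrp_le_braidGrp (N : ℕ) : chordGrp s (Set.Iio N) ≤ braidGrp s 0 N := by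
  rw [chordGrp, Subgroup.closure_le]
  rintro _ ⟨z, t, hz, ht, h, rfl⟩
  exact chord_mem_braidGrp h hz ht

/-- The strand `q + k` is moved to the position `q`. -/
def desc (s : ℕ → G) (q : ℕ) : ℕ → G
  | 0 => 1
  | k + 1 => s (q + k) * desc s q k

/-- Two adjacent pairs of strands are exchanged. -/
def twist (s : ℕ → G) (p : ℕ) : G := s (p + 1) * s p * (s (p + 2) * s (p + 1))

variable (hs : IsDeltaFamily s)
include hs

theorem IsDeltaFamily.chordGrp_comm {S : Set ℕ} {x y : G} (hx : x ∈ chordGrp s S)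
    (hy : y ∈ chordGrp s S) : Commute x y := by
  refine Subgroup.closure_induction₂ (p := fun x y _ _ => Commute x y) ?_ ?_ ?_ ?_ ?_ ?_ ?_ hx hy
  · rintro _ _ ⟨z, t, -, -, h, rfl⟩ ⟨z', t', -, -, h', rfl⟩
    exact hs.chord_commute h h'
  · exact fun x _ => .one_left x
  · exact fun x _ => .one_right x
  · exact fun x y z _ _ _ h h' => h.mul_left h'
  · exact fun y z x _ _ _ h h' => h.mul_right h'
  · exact fun x y _ _ h => h.inv_left
  · exact fun x y _ _ h => h.inv_right

theorem IsDeltaFamily.exists_perm {q N : ℕ} {g : G} (hg : g ∈ braidGrp s q N) :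
    ∃ π : Equiv.Perm ℕ, (∀ z < q, π z = z) ∧ (∀ z, N ≤ z → π z = z) ∧
      ∀ z t, z ≠ t → chord s z t * g = g * chord s (π z) (π t) := by
  induction hg using Subgroup.closure_induction with
  | mem x hx =>
    obtain ⟨i, h1, h2, rfl⟩ := hx
    exact ⟨Equiv.swap i (i + 1), fun z hz => Equiv.swap_apply_of_ne_of_ne (by omega) (by omega),
      fun z hz => Equiv.swap_apply_of_ne_of_ne (by omega) (by omega),
      fun z t h => hs.chord_mul h i⟩
  | one => exact ⟨1, by simp, by simp, by simp⟩
  | mul x y _ _ hx hy =>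
    obtain ⟨π, h1, h2, h3⟩ := hx
    obtain ⟨ρ, k1, k2, k3⟩ := hy
    refine ⟨ρ * π, fun z hz => ?_, fun z hz => ?_, fun z t h => ?_⟩
    · rw [Equiv.Perm.mul_apply, h1 z hz, k1 z hz]
    · rw [Equiv.Perm.mul_apply, h2 z hz, k2 z hz]
    · rw [← mul_assoc, h3 z t h, mul_assoc, k3 _ _ (by simpa using h)]
      simp [mul_assoc]
  | inv x _ hx =>
    obtain ⟨π, h1, h2, h3⟩ := hx
    refine ⟨π⁻¹, fun z hz => ?_, fun z hz => ?_, fun z t h => ?_⟩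
    · rw [Equiv.Perm.inv_eq_iff_eq, h1 z hz]
    · rw [Equiv.Perm.inv_eq_iff_eq, h2 z hz]
    · rw [mul_inv_eq_iff_eq_mul, mul_assoc, h3 _ _ (by simpa using h)]
      simp

/-- The permutation attached to `g` fixes everything from `N` on, so it preserves the strands below
`N`; chords go to chords. -/
theorem IsDeltaFamily.conj_mem {N : ℕ} {g x : G} (hg : g ∈ braidGrp s 0 N)
    (hx : x ∈ chordGrp s (Set.Iio N)) : g⁻¹ * x * g ∈ chordGrp s (Set.Iio N) := by
  obtain ⟨π, -, h2, h3⟩ := hs.exists_perm hg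
  have hπ : ∀ z < N, π z < N := by
    intro z hz
    by_contra h
    have := π.injective (h2 (π z) (by omega))
    omega
  induction hx using Subgroup.closure_induction with
  | mem x hx =>
    obtain ⟨z, t, hz, ht, h, rfl⟩ := hx
    rw [mul_assoc, h3 z t h, inv_mul_cancel_left]
    exact chord_mem (hπ z hz) (hπ t ht) (by simpa using h)
  | one => simp
  | mul x y _ _ hx hy =>
    have : g⁻¹ * (x * y) * g = (g⁻¹ * x * g) * (g⁻¹ * y * g) := by group
    rw [this]
    exact mul_mem hx hy
  | inv x _ hx =>
    have : g⁻¹ * x⁻¹ * g = (g⁻¹ * x * g)⁻¹ := by group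
    rw [this]
    exact inv_mem hx

theorem IsDeltaFamily.conj_mem' {N : ℕ} {g x : G} (hg : g ∈ braidGrp s 0 N)
    (hx : x ∈ chordGrp s (Set.Iio N)) : g * x * g⁻¹ ∈ chordGrp s (Set.Iio N) := by
  simpa using hs.conj_mem (inv_mem hg) hx

theorem IsDeltaFamily.commute_desc {i q k : ℕ} (h : q + k + 1 ≤ i) : Commute (s i) (desc s q k) := by
  induction k with
  | zero => exact .one_right _
  | succ k ih => exact (hs.far (by omega)).symm.mul_right (ih (by omega))

theorem IsDeltaFamily.mul_desc {i q k : ℕ} (h : q ≤ i) (h' : i + 2 ≤ q + k) :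
    s i * desc s q k = desc s q k * s (i + 1) := by
  induction k with
  | zero => omega
  | succ k ih =>
    change s i * (s (q + k) * desc s q k) = s (q + k) * desc s q k * s (i + 1)
    rcases Nat.lt_or_ge (i + 1) (q + k) with h1 | h1
    · rw [← mul_assoc, (hs.far (p := i) (q := q + k) (by omega)).eq, mul_assoc, ih (by omega),
        mul_assoc]
    · obtain ⟨k, rfl⟩ : ∃ e, k = e + 1 := ⟨k - 1, by omega⟩
      obtain rfl : i = q + k := by omega
      have h2 := (hs.commute_desc (i := q + k + 1) (q := q) (k := k) le_rfl).eq
      have h3 := hs.braid (q + k)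
      change s (q + k) * (s (q + k + 1) * (s (q + k) * desc s q k)) =
        s (q + k + 1) * (s (q + k) * desc s q k) * s (q + k + 1)
      rw [mul_assoc, mul_assoc, ← h2, ← mul_assoc, ← mul_assoc, h3, mul_assoc, mul_assoc]

omit hs in
theorem desc_mem {q k N : ℕ} (h : q + k < N) : desc s q k ∈ braidGrp s q N := by
  induction k with
  | zero => exact one_mem _
  | succ k ih => exact mul_mem (gen_mem (by omega) (by omega)) (ih (by omega))

/-- The braids `desc s q k` represent the cosets of the braids which leave the strand `q` alone, as
the corresponding cycles do for symmetric groups. A chord arises only for `i + 1 = q + k`, where the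
square of a generator appears and is conjugated to the right. -/
theorem IsDeltaFamily.gen_mul_desc {i q k N : ℕ} (h : q ≤ i) (h' : i + 2 ≤ N) (hk : q + k < N) :
    ∃ k', q + k' < N ∧ ∃ g ∈ braidGrp s (q + 1) N, ∃ x ∈ chordGrp s (Set.Iio N),
      s i * desc s q k = desc s q k' * g * x := by
  by_cases h1 : q + k + 1 ≤ i
  · exact ⟨k, hk, s i, gen_mem (by omega) h', 1, one_mem _, by
      rw [mul_one, (hs.commute_desc h1).eq]⟩
  by_cases h2 : i = q + k
  · exact ⟨k + 1, by omega, 1, one_mem _, 1, one_mem _, by simp [desc, h2]⟩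
  by_cases h3 : i + 2 ≤ q + k
  · exact ⟨k, hk, s (i + 1), gen_mem (by omega) (by omega), 1, one_mem _, by
      rw [mul_one, hs.mul_desc h h3]⟩
  · obtain ⟨k, rfl⟩ : ∃ e, k = e + 1 := ⟨k - 1, by omega⟩
    obtain rfl : i = q + k := by omega
    refine ⟨k, by omega, 1, one_mem _, _, hs.conj_mem
      (braidGrp_mono (Nat.zero_le q) le_rfl (desc_mem (q := q) (k := k) (N := N) (by omega)))
      (chord_mem (z := q + k) (t := q + k + 1) (Set.mem_Iio.2 (by omega)) (Set.mem_Iio.2 (by omega))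
      (by omega)), ?_⟩
    rw [chord_succ]
    simp [desc, mul_assoc]

/-- Modulo chords, a braid first moves a strand to the leftmost position. -/
theorem IsDeltaFamily.decomp {q N : ℕ} (hq : q < N) {g : G} (hg : g ∈ braidGrp s q N) :
    ∃ k, q + k < N ∧ ∃ g' ∈ braidGrp s (q + 1) N, ∃ x ∈ chordGrp s (Set.Iio N),
      g = desc s q k * g' * x := by
  have key : ∀ i, q ≤ i → i + 2 ≤ N → ∀ y, (∃ k, q + k < N ∧ ∃ g' ∈ braidGrp s (q + 1) N,
      ∃ x ∈ chordGrp s (Set.Iio N), y = desc s q k * g' * x) →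
      ∃ k, q + k < N ∧ ∃ g' ∈ braidGrp s (q + 1) N,
      ∃ x ∈ chordGrp s (Set.Iio N), s i * y = desc s q k * g' * x := by
    rintro i h1 h2 _ ⟨k, hk, g', hg', x, hx, rfl⟩
    obtain ⟨k', hk', g'', hg'', x', hx', h⟩ := hs.gen_mul_desc h1 h2 hk
    refine ⟨k', hk', g'' * g', mul_mem hg'' hg', g'⁻¹ * x' * g' * x,
      mul_mem (hs.conj_mem (braidGrp_mono (Nat.zero_le _) le_rfl hg') hx') hx, ?_⟩
    rw [← mul_assoc, ← mul_assoc, h]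
    group
  induction hg using Subgroup.closure_induction_left with
  | one => exact ⟨0, hq, 1, one_mem _, 1, one_mem _, by simp [desc]⟩
  | mul_left x hx y _ hy =>
    obtain ⟨i, h1, h2, rfl⟩ := hx
    exact key i h1 h2 y hy
  | inv_mul_cancel x hx y hyb hy =>
    obtain ⟨i, h1, h2, rfl⟩ := hx
    obtain ⟨k, hk, g', hg', x, hx, h⟩ := key i h1 h2 y hy
    -- The inverse of a generator is the generator times the inverse of its square, and that square
    -- is a chord which can be moved past `y`.
    refine ⟨k, hk, g', hg', x * (y⁻¹ * (chord s i (i + 1))⁻¹ * y), mul_mem hx (hs.conj_mem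
      (braidGrp_mono (Nat.zero_le _) le_rfl hyb) (inv_mem (chord_mem (Set.mem_Iio.2 (by omega))
      (Set.mem_Iio.2 (by omega)) (by omega)))), ?_⟩
    rw [← mul_assoc, ← h, chord_succ]
    group

/-- Separating the exchange of two pairs makes it possible to let the row of minima below absorb the
factor `twist`. The two remaining letters lie to the right and are harmless. -/
theorem IsDeltaFamily.desc_add_two (q k : ℕ) : desc s q (k + 2) =
    twist s (q + k) * desc s q k * ((s (q + k + 1))⁻¹ * (s (q + k + 2))⁻¹) := by
  have h1 := hs.commute_desc (i := q + k + 1) (q := q) (k := k) (by omega)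
  have h2 := hs.commute_desc (i := q + k + 2) (q := q) (k := k) (by omega)
  have h3 := (h1.inv_left.mul_left h2.inv_left).eq
  rw [mul_assoc, ← h3]
  change s (q + k + 1) * (s (q + k) * desc s q k) = _
  simp [twist, mul_assoc]

end Chord

/-! ### The group of classical braids -/

section Classical

variable {n : ℕ} {R : Move n}

theorem cls_mul_cancel (hR : Base R) (p : ℕ) (a : Bool) :
    cls R [(p, .cl a)] * cls R [(p, .cl !a)] = 1 := by
  rw [← cls_append, ← cls_nil]
  exact cls_eq_of_eqv (p + 2) fun l hl => cancel_eqv hR hl a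

/-- The class of a positive crossing. -/
def gen (hR : Base R) (p : ℕ) : (CrossMonoid R)ˣ where
  val := cls R [(p, .cl true)]
  inv := cls R [(p, .cl false)]
  val_inv := cls_mul_cancel hR p true
  inv_val := cls_mul_cancel hR p false

/-- The sequence of crossings given by a braid word. -/
def bw (b : List (ℕ × Bool)) : Word n := toW (b.map fun x => (x.1, .cl x.2))

theorem bw_append (b c : List (ℕ × Bool)) : (bw (b ++ c) : Word n) = bw b ++ bw c := by
  simp [bw, toW_append]

/-- The class of a braid word. -/
def val (hR : Base R) (b : List (ℕ × Bool)) : (CrossMonoid R)ˣ :=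
  (b.map fun x => if x.2 then gen hR x.1 else (gen hR x.1)⁻¹).prod

variable (hR : Base R)
include hR

theorem val_append (b c : List (ℕ × Bool)) : val hR (b ++ c) = val hR b * val hR c := by
  simp [val]

theorem val_cons (x : ℕ × Bool) (b : List (ℕ × Bool)) : val hR (x :: b) =
    (if x.2 then gen hR x.1 else (gen hR x.1)⁻¹) * val hR b := by
  simp [val]

theorem coe_val (b : List (ℕ × Bool)) :
    ((val hR b : (CrossMonoid R)ˣ) : CrossMonoid R) = cls R (b.map fun x => (x.1, .cl x.2)) := by
  induction b with
  | nil => rfl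
  | cons x b ih =>
    rw [val_cons, Units.val_mul, ih, List.map_cons,
      show ∀ (y : ℕ × Kind) c, y :: c = [y] ++ c from fun _ _ => rfl, cls_append]
    congr 1
    obtain ⟨p, _ | _⟩ := x <;> rfl

/-- The braid word `b` fits on `N` strands. -/
def Wide (b : List (ℕ × Bool)) (N : ℕ) : Prop := ∀ x ∈ b, x.1 + 2 ≤ N

omit hR in
theorem Wide.append {b c : List (ℕ × Bool)} {N : ℕ} (hb : Wide b N) (hc : Wide c N) :
    Wide (b ++ c) N := by
  intro x hx
  rcases List.mem_append.1 hx with h | h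
  · exact hb x h
  · exact hc x h

omit hR in
theorem Wide.run {b : List (ℕ × Bool)} {N : ℕ} (h : Wide b N) {l : Level n} (hl : l.length = N) :
    ∃ k, run (bw b) l = some k ∧ k.length = N := by
  obtain ⟨k, hk, h2⟩ := run_toW_isSome (b := b.map fun x => (x.1, .cl x.2)) (l := l) (by
    intro x hx
    obtain ⟨y, hy, rfl⟩ := List.mem_map.1 hx
    exact hl ▸ h y hy)
  exact ⟨k, hk, h2.trans hl⟩

theorem bw_eqv {b c : List (ℕ × Bool)} (h : val hR b = val hR c) {l : Level n}
    (hb : Wide b l.length) (hc : Wide c l.length) : Eqv R l (bw b) (bw c) := by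
  refine eqv_of_cls_eq hR ?_ ?_ ?_
  · rw [← coe_val hR, ← coe_val hR, h]
  · intro x hx
    obtain ⟨y, hy, rfl⟩ := List.mem_map.1 hx
    exact hb y hy
  · intro x hx
    obtain ⟨y, hy, rfl⟩ := List.mem_map.1 hx
    exact hc y hy

/-- The inverse braid word. -/
def binv (b : List (ℕ × Bool)) : List (ℕ × Bool) := (b.map fun x => (x.1, !x.2)).reverse

theorem val_binv (b : List (ℕ × Bool)) : val hR (binv b) = (val hR b)⁻¹ := by
  induction b with
  | nil => simp [val, binv]
  | cons x b ih =>
    have : binv (x :: b) = binv b ++ [(x.1, !x.2)] := by simp [binv]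
    rw [this, val_append, ih, val_cons hR x b, mul_inv_rev]
    obtain ⟨p, _ | _⟩ := x <;> simp [val]

theorem mem_braidGrp_iff {q N : ℕ} {g : (CrossMonoid R)ˣ} : g ∈ braidGrp (gen hR) q N ↔
    ∃ b, (∀ x ∈ b, q ≤ x.1 ∧ x.1 + 2 ≤ N) ∧ val hR b = g := by
  constructor
  · intro hg
    induction hg using Subgroup.closure_induction with
    | mem x hx =>
      obtain ⟨i, h1, h2, rfl⟩ := hx
      exact ⟨[(i, true)], by simpa using ⟨h1, h2⟩, by simp [val]⟩
    | one => exact ⟨[], by simp, by simp [val]⟩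
    | mul x y _ _ hx hy =>
      obtain ⟨b, hb, rfl⟩ := hx
      obtain ⟨c, hc, rfl⟩ := hy
      refine ⟨b ++ c, fun x hx => ?_, val_append hR b c⟩
      rcases List.mem_append.1 hx with h | h
      · exact hb x h
      · exact hc x h
    | inv x _ hx =>
      obtain ⟨b, hb, rfl⟩ := hx
      refine ⟨binv b, fun x hx => ?_, val_binv hR b⟩
      simp only [binv, List.mem_reverse, List.mem_map] at hx
      obtain ⟨y, hy, rfl⟩ := hx
      exact hb y hy
  · rintro ⟨b, hb, rfl⟩
    induction b with
    | nil => exact one_mem _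
    | cons x b ih =>
      rw [val_cons]
      have h1 := hb x (by simp)
      have h2 : gen hR x.1 ∈ braidGrp (gen hR) q N := gen_mem h1.1 h1.2
      refine mul_mem ?_ (ih fun y hy => hb y (by simp [hy]))
      split_ifs
      · exact h2
      · exact inv_mem h2

theorem mem_braidGrp_zero {N : ℕ} {g : (CrossMonoid R)ˣ} : g ∈ braidGrp (gen hR) 0 N ↔
    ∃ b, Wide b N ∧ val hR b = g := by
  rw [mem_braidGrp_iff]
  simp [Wide]

omit hR in
theorem Wide.binv {b : List (ℕ × Bool)} {N : ℕ} (h : Wide b N) : Wide (binv b) N := by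
  intro x hx
  simp only [LinkDiag.binv, List.mem_reverse, List.mem_map] at hx
  obtain ⟨y, hy, rfl⟩ := hx
  exact h y hy

/-! ### Braids passing through a word -/

/-- The word `u` leads from levels with `N` strands to levels with `M` strands. -/
def Maps (u : Word n) (N M : ℕ) : Prop :=
  ∀ l k : Level n, l.length = N → run u l = some k → k.length = M

/-- The braids `x.1` below and `x.2` above the word `u` have the same effect. -/
def Passes (u : Word n) (N M : ℕ) (x : (CrossMonoid R)ˣ × (CrossMonoid R)ˣ) : Prop :=
  ∃ b c, Wide b N ∧ Wide c M ∧ val hR b = x.1 ∧ val hR c = x.2 ∧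
    ∀ l : Level n, l.length = N → Eqv R l (bw b ++ u) (u ++ bw c)

/-- The passage is a property of the two group elements: any other fitting words for them serve as
well, provided that `u` leads to the expected number of strands. -/
theorem Passes.eqv {u : Word n} {N M : ℕ} (hu : Maps u N M)
    {x : (CrossMonoid R)ˣ × (CrossMonoid R)ˣ} (h : Passes hR u N M x) {b c : List (ℕ × Bool)}
    (hb : Wide b N) (hc : Wide c M) (hbx : val hR b = x.1) (hcx : val hR c = x.2)
    {l : Level n} (hl : l.length = N) : Eqv R l (bw b ++ u) (u ++ bw c) := by
  obtain ⟨b', c', hb', hc', hbx', hcx', h⟩ := h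
  have e1 : Eqv R l (bw b) (bw b') :=
    bw_eqv hR (hbx.trans hbx'.symm) (hl ▸ hb) (hl ▸ hb')
  refine ((e1.append_right u).trans (h l hl)).trans (.append_left fun m hm => ?_)
  have := hu l m hl hm
  exact bw_eqv hR (hcx'.trans hcx.symm) (this ▸ hc') (this ▸ hc)

/-- The pairs of braids passing through a word form a group. -/
def passGrp (u : Word n) (N M : ℕ) (hu : Maps u N M) :
    Subgroup ((CrossMonoid R)ˣ × (CrossMonoid R)ˣ) where
  carrier := {x | Passes hR u N M x}
  one_mem' := ⟨[], [], by simp [Wide], by simp [Wide], rfl, rfl, fun l _ => by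
    simpa [bw, toW] using Eqv.refl u⟩
  mul_mem' := by
    rintro x y ⟨b, c, hb, hc, hbx, hcx, h⟩ ⟨b', c', hb', hc', hbx', hcx', h'⟩
    refine ⟨b ++ b', c ++ c', hb.append hb', hc.append hc', ?_, ?_, fun l hl => ?_⟩
    · rw [val_append, hbx, hbx']; rfl
    · rw [val_append, hcx, hcx']; rfl
    · rw [bw_append, bw_append]
      have e1 : Eqv R l (bw b ++ (bw b' ++ u)) (bw b ++ (u ++ bw c')) := by
        refine .append_left fun m hm => h' m ?_
        obtain ⟨k, hk, hk'⟩ := hb.run hl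
        rw [hk, Option.some.injEq] at hm
        exact hm ▸ hk'
      have e2 := (h l hl).append_right (bw c')
      simpa using e1.trans (by simpa using e2)
  inv_mem' := by
    rintro x ⟨b, c, hb, hc, hbx, hcx, h⟩
    refine ⟨binv b, binv c, hb.binv, hc.binv, ?_, ?_, fun l hl => ?_⟩
    · rw [val_binv, hbx]; rfl
    · rw [val_binv, hcx]; rfl
    · have e1 : Eqv R l ((bw (binv b) ++ u) ++ []) ((bw (binv b) ++ u) ++ bw (c ++ binv c)) := by
        refine .append_left fun m hm => ?_
        have hm' : m.length = M := by
          rw [run_append, Option.bind_eq_some_iff] at hm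
          obtain ⟨k, hk, hm⟩ := hm
          obtain ⟨k', hk1, hk2⟩ := hb.binv.run hl
          rw [hk1, Option.some.injEq] at hk
          exact hu k m (hk ▸ hk2) hm
        refine bw_eqv hR (b := []) ?_ (by simp [Wide]) (hm' ▸ hc.append hc.binv)
        rw [val_append, val_binv, mul_inv_cancel]
        rfl
      have e2 : Eqv R l (bw (binv b) ++ (u ++ bw c)) (bw (binv b) ++ (bw b ++ u)) := by
        refine .append_left fun m hm => (h m ?_).symm
        obtain ⟨k', hk1, hk2⟩ := hb.binv.run hl
        rw [hk1, Option.some.injEq] at hm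
        exact hm ▸ hk2
      have e3 : Eqv R l (bw (binv b ++ b)) (bw []) := by
        refine bw_eqv hR ?_ (hl ▸ hb.binv.append hb) (by simp [Wide])
        rw [val_append, val_binv, inv_mul_cancel]
        rfl
      have e4 := e3.append_right (u ++ bw (binv c))
      have e5 := e2.append_right (bw (binv c))
      rw [bw_append] at e1 e4
      simp only [List.append_assoc, List.append_nil] at e1 e4 e5
      exact e1.trans (e5.trans (by simpa [bw, toW] using e4))

variable {u v : Word n} {N M K : ℕ} {x y z : (CrossMonoid R)ˣ}

omit hR in
theorem Maps.append (hu : Maps u N M) (hv : Maps v M K) : Maps (u ++ v) N K := by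
  intro l k hl hk
  rw [run_append, Option.bind_eq_some_iff] at hk
  obtain ⟨m, hm, hk⟩ := hk
  exact hv m k (hu l m hl hm) hk

theorem passGrp_append (hu : Maps u N M) (hv : Maps v M K) (h : (x, y) ∈ passGrp hR u N M hu)
    (h' : (y, z) ∈ passGrp hR v M K hv) : (x, z) ∈ passGrp hR (u ++ v) N K (hu.append hv) := by
  obtain ⟨b, c, hb, hc, hbx, hcx, e⟩ := h
  obtain ⟨c', d, hc', hd, hcx', hdx, e'⟩ := id h'
  refine ⟨b, d, hb, hd, hbx, hdx, fun l hl => ?_⟩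
  have e1 := (e l hl).append_right v
  have e2 : Eqv R l (u ++ (bw c ++ v)) (u ++ (v ++ bw d)) :=
    .append_left fun m hm => Passes.eqv hR hv h' hc hd hcx hdx (hu l m hl hm)
  simp only [List.append_assoc] at e1 e2 ⊢
  exact e1.trans e2

theorem passGrp_congr (hu : Maps u N M) (hv : Maps v N M)
    (huv : ∀ l : Level n, l.length = N → Eqv R l u v) (h : (x, y) ∈ passGrp hR u N M hu) :
    (x, y) ∈ passGrp hR v N M hv := by
  obtain ⟨b, c, hb, hc, hbx, hcx, e⟩ := h
  refine ⟨b, c, hb, hc, hbx, hcx, fun l hl => ?_⟩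
  refine (Eqv.append_left fun m hm => (huv m ?_).symm).trans
    ((e l hl).trans ((huv l hl).append_right _))
  obtain ⟨k', hk1, hk2⟩ := hb.run hl
  rw [hk1, Option.some.injEq] at hm
  exact hm ▸ hk2

omit hR in
theorem Wide.maps {b : List (ℕ × Bool)} (hb : Wide b N) : Maps (n := n) (bw b) N N := by
  intro l k hl hk
  obtain ⟨k', hk1, hk2⟩ := hb.run hl
  rw [hk1, Option.some.injEq] at hk
  exact hk ▸ hk2

theorem passGrp_bw {b : List (ℕ × Bool)} (hb : Wide b N) (hx : x ∈ braidGrp (gen hR) 0 N) :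
    (x, (val hR b)⁻¹ * x * val hR b) ∈ passGrp hR (bw b) N N hb.maps := by
  obtain ⟨d, hd, rfl⟩ := (mem_braidGrp_zero hR).1 hx
  refine ⟨d, binv b ++ d ++ b, hd, (hb.binv.append hd).append hb, rfl, ?_, fun l hl => ?_⟩
  · rw [val_append, val_append, val_binv]
  · rw [← bw_append, ← bw_append]
    refine bw_eqv hR ?_ (hl ▸ hd.append hb) (hl ▸ hb.append ((hb.binv.append hd).append hb))
    rw [val_append, val_append, val_append, val_append, val_binv]
    group

omit hR in
theorem maps_cup (p : ℕ) (i : Fin n) (s : Bool) (N : ℕ) : Maps [(p, .cup i s)] N (N + 2) := by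
  intro l k hl hk
  rw [run_singleton] at hk
  have := (length_of_act hk).2
  simpa [Piece.dom, Piece.cod, hl] using this

omit hR in
theorem maps_cap (p N : ℕ) : Maps (n := n) [(p, .cap)] (N + 2) N := by
  intro l k hl hk
  rw [run_singleton] at hk
  have := (length_of_act hk).2
  simpa [Piece.dom, Piece.cod, hl] using this

end Classical

section Turns

variable {n : ℕ} {R : Move n} (hR : Base R)
include hR

/-- A minimum moves to the left through a strand. -/
theorem cup_drag {l : Level n} {p : ℕ} (hl : p + 1 ≤ l.length) (i : Fin n) (s a : Bool) :
    Eqv R l [(p + 1, .cup i s), X p (.cl a), X (p + 1) (.cl a)] [(p, .cup i s)] := by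
  have e1 := ((slideCup_eqv hR p i s (.cl !a)).symm.append_right [X (p + 1) (.cl a)]) l
  simp only [Kind.flip, Bool.not_not] at e1
  refine e1.trans ?_
  have e2 : Eqv R l ([(p, .cup i s)] ++ [X (p + 1) (.cl !a), X (p + 1) (.cl a)])
      ([(p, .cup i s)] ++ []) := by
    refine .append_left fun m hm => ?_
    have := maps_cup p i s l.length l m rfl hm
    simpa using cancel_eqv hR (l := m) (p := p + 1) (by omega) (!a)
  exact e2

/-- A minimum moves to the right through a strand. -/
theorem cup_drag' {l : Level n} {p : ℕ} (hl : p + 1 ≤ l.length) (i : Fin n) (s a : Bool) :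
    Eqv R l [(p, .cup i s), X (p + 1) (.cl a), X p (.cl a)] [(p + 1, .cup i s)] := by
  have e1 := ((slideCup_eqv hR p i s (.cl a)).append_right [X p (.cl a)]) l
  refine e1.trans ?_
  have e2 : Eqv R l ([(p + 1, .cup i s)] ++ [X p (.cl !a), X p (.cl a)])
      ([(p + 1, .cup i s)] ++ []) := by
    refine .append_left fun m hm => ?_
    have := maps_cup (p + 1) i s l.length l m rfl hm
    simpa using cancel_eqv hR (l := m) (p := p) (by omega) (!a)
  exact e2

/-- A maximum moves to the left through a strand. -/
theorem cap_drag {l : Level n} {p : ℕ} (hl : p + 3 ≤ l.length) (a : Bool) :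
    Eqv R l [X p (.cl a), X (p + 1) (.cl a), (p, .cap)] [(p + 1, .cap)] := by
  have e1 := ((slideCap_eqv hR p (.cl !a)).symm.append_left [X p (.cl a)]) l
  simp only [Kind.flip, Bool.not_not] at e1
  exact e1.trans ((cancel_eqv hR (l := l) (p := p) (by omega) a).append_right [(p + 1, .cap)])

theorem cap_drag' {l : Level n} {p : ℕ} (hl : p + 3 ≤ l.length) (a : Bool) :
    Eqv R l [X (p + 1) (.cl a), X p (.cl a), (p + 1, .cap)] [(p, .cap)] := by
  have e1 := ((slideCap_eqv hR p (.cl a)).append_left [X (p + 1) (.cl a)]) l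
  exact e1.trans ((cancel_eqv hR (l := l) (p := p + 1) (by omega) a).append_right [(p, .cap)])

omit hR in
/-- A replacement which only has to be valid if the result fits. -/
theorem Eqv.replace {l : Level n} {a u v b : Word n} (h : run (a ++ u ++ b) l ≠ none)
    (huv : ∀ m, run a l = some m → run u m ≠ none → Eqv R m u v) :
    Eqv R l (a ++ u ++ b) (a ++ v ++ b) := by
  refine Eqv.append_right (.append_left fun m hm => huv m hm fun h0 => h ?_) b
  rw [run_append, run_append, hm, Option.bind_some, h0]
  rfl

/-- A crossing just above a minimum is not literally a curl on a strand. After adding a zigzag on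
one leg, sliding the crossing upwards and through the new maximum, it becomes one. The legs are
exchanged by the crossing, hence the reversed orientation. The label `k` is arbitrary so that
virtual curls are covered too. -/
theorem cup_kink_of {k : Kind} (hk : ∀ p u, Kink p k.flip u → R u []) {l : Level n} {p : ℕ}
    (hl : p ≤ l.length) (i : Fin n) (s : Bool) :
    Eqv R l [(p, .cup i s), X p k] [(p, .cup i !s)] := by
  obtain ⟨x, y, rfl, rfl⟩ := exists_split hl
  have hrun : run [(x.length, .cup i s), X x.length k, (x.length, .cup i !s),
      (x.length + 1, .cap)] (x ++ y) = some (x ++ [(i, !s), (i, s)] ++ y) := by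
    have := run_shift [(0, .cup i s), X 0 k, (0, .cup i !s), (1, .cap)] x y
    simp only [shift, List.map, X, Nat.add_zero] at this
    rw [X, this]
    simp [run, act]
  have e1 : Eqv R (x ++ y) [(x.length, .cup i s), X x.length k, (x.length, .cup i !s),
      (x.length + 1, .cap)] [(x.length, .cup i s), X x.length k] := by
    refine Eqv.replace (a := [(x.length, .cup i s), X x.length k])
      (v := []) (b := []) (by rw [List.append_nil]; exact ne_of_eq_of_ne hrun (by simp)) ?_
    exact fun m _ h => zagzig_eqv hR h
  have e2 := ((cross_cup_of_le hR (le_refl x.length) k i (!s)).mid [(x.length, .cup i s)]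
    [(x.length + 1, .cap)])
  have e3 := (cup_cup_of_le hR (le_refl x.length) i i (!s) s).symm.append_right
    [X (x.length + 2) k, (x.length + 1, .cap)]
  have e4 := (slideCap_eqv hR (x.length + 1) k.flip).symm.append_left
    [(x.length, .cup i !s), (x.length + 2, .cup i s)]
  rw [show k.flip.flip = k by cases k <;> simp [Kind.flip]] at e4
  have e5 := ((e2.trans e3).trans e4) (x ++ y)
  have hrun' := e5.1
  rw [show [(x.length, Piece.cup i s)] ++ [X x.length k, (x.length, .cup i !s)] ++
    [(x.length + 1, .cap)] = [(x.length, Piece.cup i s), X x.length k,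
    (x.length, .cup i !s), (x.length + 1, .cap)] from rfl, hrun] at hrun'
  have e6 : Eqv R (x ++ y) ([(x.length, .cup i !s)] ++ [(x.length + 1 + 1, .cup i s),
      X (x.length + 1) k.flip, (x.length + 1 + 1, .cap)] ++ []) ([(x.length, .cup i !s)] ++ [] ++ [])
      := by
    refine Eqv.replace (by rw [List.append_nil]; exact ne_of_eq_of_ne hrun'.symm (by simp)) ?_
    exact fun m _ h => .of_biLifts (hk _ _ (.right i s)) (biLifts_kink (.right i s)) h (by simp [run])
  exact e1.symm.trans (e5.trans e6)

theorem cup_kink {l : Level n} {p : ℕ} (hl : p ≤ l.length) (i : Fin n) (s a : Bool) :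
    Eqv R l [(p, .cup i s), X p (.cl a)] [(p, .cup i !s)] :=
  cup_kink_of hR (k := .cl a) (fun p u h => hR _ _ (.inr (.R1 p (!a) u h))) hl i s

/-- The counterpart for a maximum, with the zigzag below its left strand. The label and orientation
of the new minimum are read off from the level; where the maximum does not fit, neither word does.
-/
theorem cap_kink (p : ℕ) (a : Bool) : UEqv R [X p (.cl a), (p, .cap)] [(p, .cap)] := by
  intro l
  have hrunEq : run [X p (.cl a), (p, .cap)] l = run [(p, .cap)] l := run_capKink _ _ _
  cases hk : run [(p, .cap)] l with
  | none => exact ⟨hrunEq, fun h => absurd (hrunEq.trans hk) h⟩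
  | some k =>
  rw [run_singleton] at hk
  obtain ⟨x, w, w', y, rfl, rfl, rfl, h⟩ := exists_loc_of_act hk
  cases h with
  | cap i s =>
  have hrun : run [(x.length + 1, .cup i !s), (x.length, .cap), X x.length (.cl a),
      (x.length, .cap)] (x ++ [(i, s), (i, !s)] ++ y) = some (x ++ [] ++ y) := by
    have := run_shift [(1, .cup i !s), (0, .cap), X 0 (.cl a), (0, .cap)] x ([(i, s), (i, !s)] ++ y)
    simp only [shift, List.map, X, Nat.add_zero] at this
    rw [X, List.append_assoc, this]
    simp [run, act]
  have e1 : Eqv R (x ++ [(i, s), (i, !s)] ++ y) ([] ++ [(x.length + 1, .cup i !s), (x.length, .cap)]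
      ++ [X x.length (.cl a), (x.length, .cap)]) ([] ++ [] ++ [X x.length (.cl a), (x.length, .cap)]) :=
    Eqv.replace (ne_of_eq_of_ne hrun (by simp)) fun m _ h => zigzag_eqv hR h
  have e2 := ((cap_cross_of_le hR (le_refl x.length) (.cl a)).mid [(x.length + 1, .cup i !s)]
    [(x.length, .cap)])
  have e3 := (cap_cap_of_le hR (le_refl x.length)).append_left
    [(x.length + 1, .cup i !s), X (x.length + 2) (.cl a)]
  have e4 := (slideCup_eqv hR (x.length + 1) i (!s) (.cl a)).append_right
    [(x.length + 2, .cap), (x.length, .cap)]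
  have e5 := ((e2.trans e3).trans e4) (x ++ [(i, s), (i, !s)] ++ y)
  have hrun' := e5.1
  rw [show [(x.length + 1, Piece.cup i !s)] ++ [(x.length, .cap), X x.length (.cl a)] ++
    [(x.length, .cap)] = [(x.length + 1, Piece.cup i !s), (x.length, .cap), X x.length (.cl a),
    (x.length, .cap)] from rfl, hrun] at hrun'
  have e6 : Eqv R (x ++ [(i, s), (i, !s)] ++ y) ([] ++ [(x.length + 1 + 1, .cup i !s),
      X (x.length + 1) (.cl !a), (x.length + 1 + 1, .cap)] ++ [(x.length, .cap)])
      ([] ++ [] ++ [(x.length, .cap)]) :=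
    Eqv.replace (ne_of_eq_of_ne hrun'.symm (by simp)) fun m _ h => kink_eqv hR (.right i !s) h
  exact e1.symm.trans (e5.trans e6)

/-! ### Braids passing through a minimum -/

variable {N p : ℕ} (i : Fin n) (s : Bool)

theorem passGrp_cup_of_le {j : ℕ} (h : p ≤ j) (hj : j + 2 ≤ N) :
    (gen hR j, gen hR (j + 2)) ∈ passGrp hR [(p, .cup i s)] N (N + 2) (maps_cup p i s N) :=
  ⟨[(j, true)], [(j + 2, true)], by simpa [Wide], by simpa [Wide], by simp [val], by simp [val],
    fun l _ => cross_cup_of_le hR h (.cl true) i s l⟩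

/-- Dragging the minimum to the right through one strand conjugates what lies above it. By induction
all statements about minima are thus reduced to the leftmost position. -/
theorem passGrp_cup_succ {x y : (CrossMonoid R)ˣ} (h : p + 1 ≤ N)
    (hxy : (x, y) ∈ passGrp hR [(p, .cup i s)] N (N + 2) (maps_cup p i s N)) :
    (x, (gen hR (p + 1) * gen hR p)⁻¹ * y * (gen hR (p + 1) * gen hR p)) ∈
      passGrp hR [(p + 1, .cup i s)] N (N + 2) (maps_cup (p + 1) i s N) := by
  have hw : Wide [(p + 1, true), (p, true)] (N + 2) := by simp [Wide]; omega
  have hy : y ∈ braidGrp (gen hR) 0 (N + 2) := by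
    obtain ⟨b, c, -, hc, -, rfl, -⟩ := hxy
    exact (mem_braidGrp_zero hR).2 ⟨c, hc, rfl⟩
  have e := passGrp_append hR _ _ hxy (passGrp_bw hR hw hy)
  have hv : val hR [(p + 1, true), (p, true)] = gen hR (p + 1) * gen hR p := by simp [val]
  rw [hv] at e
  exact passGrp_congr hR _ _ (fun l hl => cup_drag' hR (hl ▸ h) i s true) e

omit hR in
/-- The strand above a minimum at the position `p` which continues the strand `z`. -/
def lift (p z : ℕ) : ℕ := if z < p then z else z + 2

omit hR in
theorem swap_swap_lift (p z : ℕ) :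
    Equiv.swap p (p + 1) (Equiv.swap (p + 1) (p + 2) (lift p z)) = lift (p + 1) z := by
  unfold lift
  simp only [Equiv.swap_apply_def]
  split_ifs <;> omega

theorem chord_conj (hs : IsDeltaFamily (gen hR)) {z t : ℕ} (h : z ≠ t) (p : ℕ) :
    (gen hR (p + 1) * gen hR p)⁻¹ * chord (gen hR) z t * (gen hR (p + 1) * gen hR p) =
      chord (gen hR) (Equiv.swap p (p + 1) (Equiv.swap (p + 1) (p + 2) z))
        (Equiv.swap p (p + 1) (Equiv.swap (p + 1) (p + 2) t)) := by
  rw [mul_assoc, inv_mul_eq_iff_eq_mul, ← mul_assoc, hs.chord_mul h, mul_assoc,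
    hs.chord_mul (by simpa using h), mul_assoc]

/-- At the leftmost position all strands move by two and the letters of the clasp pass one by one.
In general the two conjugating generators transport the ends of the chord as `swap_swap_lift`
describes. -/
theorem passGrp_cup_chord (hs : IsDeltaFamily (gen hR)) {z t : ℕ} (h : z ≠ t) (hz : z < N)
    (ht : t < N) (hp : p ≤ N) : (chord (gen hR) z t, chord (gen hR) (lift p z) (lift p t)) ∈
      passGrp hR [(p, .cup i s)] N (N + 2) (maps_cup p i s N) := by
  induction p with
  | zero =>
    wlog hzt : z < t generalizing z t
    · rw [chord_comm, chord_comm _ (lift 0 z)]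
      exact this h.symm ht hz (by omega)
    obtain ⟨d, rfl⟩ : ∃ d, t = z + d + 1 := ⟨t - z - 1, by omega⟩
    have e1 : lift 0 z = z + 2 := by simp [lift]
    have e2 : lift 0 (z + d + 1) = z + 2 + d + 1 := by simp [lift]; omega
    rw [e1, e2, chord_add, chord_add]
    clear e1 e2 hzt h
    induction d with
    | zero =>
      exact mul_mem (passGrp_cup_of_le hR i s (Nat.zero_le z) (by omega))
        (passGrp_cup_of_le hR i s (Nat.zero_le z) (by omega))
    | succ d ih =>
      have h1 := passGrp_cup_of_le hR (N := N) i s (Nat.zero_le (z + d + 1)) (by omega)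
      have h2 := mul_mem (mul_mem (inv_mem h1) (ih (by omega))) h1
      rwa [show z + d + 1 + 2 = z + 2 + d + 1 by omega] at h2
  | succ p ih =>
    have h1 := passGrp_cup_succ hR i s (by omega) (ih (by omega))
    rwa [chord_conj hR hs (by unfold lift; split_ifs <;> omega), swap_swap_lift,
      swap_swap_lift] at h1

/-- The full twist of the two legs consists of two curls, each of which turns the minimum over. -/
theorem passGrp_cup_self (hp : p ≤ N) : (1, chord (gen hR) p (p + 1)) ∈
    passGrp hR [(p, .cup i s)] N (N + 2) (maps_cup p i s N) := by
  refine ⟨[], [(p, true), (p, true)], by simp [Wide], by simpa [Wide], rfl,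
    by simp [val, chord_succ], fun l hl => ?_⟩
  have e1 := (cup_kink hR (l := l) (p := p) (by omega) i s true).append_right [X p (.cl true)]
  have e2 := cup_kink hR (l := l) (p := p) (by omega) i (!s) true
  rw [Bool.not_not] at e2
  exact (e1.trans e2).symm

/-- A strand encircling both legs of a minimum can be removed. -/
theorem passGrp_cup_both (hs : IsDeltaFamily (gen hR)) {y : ℕ} (hy : y < N + 2) (hyp : y ≠ p)
    (hyp' : y ≠ p + 1) (hp : p ≤ N) :
    (1, chord (gen hR) p y * chord (gen hR) (p + 1) y) ∈
      passGrp hR [(p, .cup i s)] N (N + 2) (maps_cup p i s N) := by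
  induction p generalizing y with
  | zero =>
    obtain ⟨d, rfl⟩ : ∃ d, y = d + 2 := ⟨y - 2, by omega⟩
    clear hyp hyp'
    induction d with
    | zero =>
      -- The strand next to the minimum runs around both legs: this is the trace of dragging the
      -- minimum through that strand and back.
      refine ⟨[], [(1, true), (0, true), (0, true), (1, true)], by simp [Wide],
        by simp [Wide]; omega, rfl, ?_, fun l hl => ?_⟩
      · have h1 := chord_add (gen hR) 0 1
        have h2 := chord_succ (gen hR) 1
        have h3 := (hs.chord_commute (z := 0) (t := 2) (x := 1) (y := 2) (by omega) (by omega)).eq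
        simp only [Nat.reduceAdd] at h1 h2 ⊢
        rw [h3, h1, h2]
        simp [val, clasp, mul_assoc]
      · have e1 := (cup_drag' hR (l := l) (p := 0) (by omega) i s true).append_right
          [X 0 (.cl true), X 1 (.cl true)]
        exact (e1.trans (cup_drag hR (l := l) (p := 0) (by omega) i s true)).symm
    | succ d ih =>
      have h1 := passGrp_cup_of_le hR (N := N) i s (Nat.zero_le d) (by omega)
      have h2 := mul_mem (mul_mem (inv_mem h1) (ih (by omega))) h1
      have h3 : chord (gen hR) 0 (d + 1 + 2) * chord (gen hR) (0 + 1) (d + 1 + 2) =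
          (gen hR (d + 2))⁻¹ * (chord (gen hR) 0 (d + 2) * chord (gen hR) (0 + 1) (d + 2)) *
            gen hR (d + 2) := by
        have sw : ∀ x < 2, Equiv.swap (d + 2) (d + 2 + 1) x = x := fun x hx =>
          Equiv.swap_apply_of_ne_of_ne (by omega) (by omega)
        have := hs.chord_mul (z := 1) (t := d + 2) (by omega) (d + 2)
        rw [sw 1 (by omega), Equiv.swap_apply_left] at this
        have this' := hs.chord_mul (z := 0) (t := d + 2) (by omega) (d + 2)
        rw [sw 0 (by omega), Equiv.swap_apply_left] at this'
        rw [eq_comm, mul_assoc, inv_mul_eq_iff_eq_mul, mul_assoc, Nat.zero_add, this, ← mul_assoc,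
          this', mul_assoc]
      rw [h3]
      convert h2 using 1
      ext <;> simp
  | succ p ih =>
    -- The strand `y'` is the one which the conjugation by the two generators carries to `y`.
    obtain ⟨y', rfl⟩ : ∃ y', y = Equiv.swap p (p + 1) (Equiv.swap (p + 1) (p + 2) y') :=
      ⟨Equiv.swap (p + 1) (p + 2) (Equiv.swap p (p + 1) y), by simp⟩
    simp only [Equiv.swap_apply_def] at hy hyp hyp'
    have hy1 : y' ≠ p := by rintro rfl; simp at hyp
    have hy2 : y' ≠ p + 1 := by rintro rfl; simp at hyp'
    have h1 := passGrp_cup_succ hR i s (by omega)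
      (ih (y := y') (by split_ifs at hy <;> omega) hy1 hy2 (by omega))
    have h2 : (gen hR (p + 1) * gen hR p)⁻¹ * (chord (gen hR) p y' * chord (gen hR) (p + 1) y') *
        (gen hR (p + 1) * gen hR p) = ((gen hR (p + 1) * gen hR p)⁻¹ * chord (gen hR) p y' *
        (gen hR (p + 1) * gen hR p)) * ((gen hR (p + 1) * gen hR p)⁻¹ * chord (gen hR) (p + 1) y' *
        (gen hR (p + 1) * gen hR p)) := by group
    rw [h2, chord_conj hR hs hy1.symm, chord_conj hR hs hy2.symm,
      Equiv.swap_apply_left (p + 1) (p + 2),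
      Equiv.swap_apply_of_ne_of_ne (a := p + 1) (b := p + 2) (x := p) (by omega) (by omega),
      Equiv.swap_apply_left, Equiv.swap_apply_of_ne_of_ne (a := p) (b := p + 1) (x := p + 2)
      (by omega) (by omega)] at h1
    exact h1

/-! ### Braids passing through a maximum -/

omit i s

theorem passGrp_cap_of_le {j : ℕ} (h : p ≤ j) (hj : j + 2 ≤ N) :
    (gen hR (j + 2), gen hR j) ∈ passGrp hR [(p, .cap)] (N + 2) N (maps_cap p N) :=
  ⟨[(j + 2, true)], [(j, true)], by simpa [Wide], by simpa [Wide], by simp [val], by simp [val],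
    fun l _ => (cap_cross_of_le hR h (.cl true)).symm l⟩

theorem passGrp_cap_succ {x y : (CrossMonoid R)ˣ} (h : p + 1 ≤ N)
    (hxy : (x, y) ∈ passGrp hR [(p, .cap)] (N + 2) N (maps_cap p N)) :
    ((gen hR p * gen hR (p + 1)) * x * (gen hR p * gen hR (p + 1))⁻¹, y) ∈
      passGrp hR [(p + 1, .cap)] (N + 2) N (maps_cap (p + 1) N) := by
  have hw : Wide [(p, true), (p + 1, true)] (N + 2) := by simp [Wide]; omega
  have hg : gen hR p * gen hR (p + 1) ∈ braidGrp (gen hR) 0 (N + 2) :=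
    mul_mem (gen_mem (by omega) (by omega)) (gen_mem (by omega) (by omega))
  have hx : x ∈ braidGrp (gen hR) 0 (N + 2) := by
    obtain ⟨b, c, hb, -, rfl, -, -⟩ := hxy
    exact (mem_braidGrp_zero hR).2 ⟨b, hb, rfl⟩
  have e := passGrp_bw hR hw (mul_mem (mul_mem hg hx) (inv_mem hg))
  have hv : val hR [(p, true), (p + 1, true)] = gen hR p * gen hR (p + 1) := by simp [val]
  have he : (gen hR p * gen hR (p + 1))⁻¹ * (gen hR p * gen hR (p + 1) * x *
      (gen hR p * gen hR (p + 1))⁻¹) * (gen hR p * gen hR (p + 1)) = x := by group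
  rw [hv, he] at e
  exact passGrp_congr hR _ _ (fun l hl => cap_drag hR (by omega) true) (passGrp_append hR _ _ e hxy)

theorem chord_conj' (hs : IsDeltaFamily (gen hR)) {z t : ℕ} (h : z ≠ t) (p : ℕ) :
    (gen hR p * gen hR (p + 1)) * chord (gen hR) z t * (gen hR p * gen hR (p + 1))⁻¹ =
      chord (gen hR) (Equiv.swap p (p + 1) (Equiv.swap (p + 1) (p + 2) z))
        (Equiv.swap p (p + 1) (Equiv.swap (p + 1) (p + 2) t)) := by
  rw [mul_inv_eq_iff_eq_mul, ← mul_assoc, hs.chord_mul (by simpa using h), mul_assoc, mul_assoc,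
    hs.chord_mul (by simpa using h)]
  simp

theorem passGrp_cap_self (hp : p ≤ N) : (chord (gen hR) p (p + 1), 1) ∈
    passGrp hR [(p, .cap)] (N + 2) N (maps_cap p N) := by
  refine ⟨[(p, true), (p, true)], [], by simpa [Wide], by simp [Wide], 
    by simp [val, chord_succ], rfl, fun l hl => ?_⟩
  exact (((cap_kink hR p true).append_left [X p (.cl true)]).trans (cap_kink hR p true)) l

theorem passGrp_cap_both (hs : IsDeltaFamily (gen hR)) {y : ℕ} (hy : y < N + 2) (hyp : y ≠ p)
    (hyp' : y ≠ p + 1) (hp : p ≤ N) :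
    (chord (gen hR) p y * chord (gen hR) (p + 1) y, 1) ∈
      passGrp hR [(p, .cap)] (N + 2) N (maps_cap p N) := by
  induction p generalizing y with
  | zero =>
    obtain ⟨d, rfl⟩ : ∃ d, y = d + 2 := ⟨y - 2, by omega⟩
    clear hyp hyp'
    induction d with
    | zero =>
      refine ⟨[(1, true), (0, true), (0, true), (1, true)], [], 
        by simp [Wide]; omega, by simp [Wide], ?_, rfl, fun l hl => ?_⟩
      · have h1 := chord_add (gen hR) 0 1
        have h2 := chord_succ (gen hR) 1
        have h3 := (hs.chord_commute (z := 0) (t := 2) (x := 1) (y := 2) (by omega) (by omega)).eq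
        simp only [Nat.reduceAdd] at h1 h2 ⊢
        rw [h3, h1, h2]
        simp [val, clasp, mul_assoc]
      · have e1 : Eqv R l ([X 1 (.cl true), X 0 (.cl true)] ++ [X 0 (.cl true), X 1 (.cl true),
            (0, .cap)]) ([X 1 (.cl true), X 0 (.cl true)] ++ [(1, .cap)]) := by
          refine .append_left fun m hm => cap_drag hR (p := 0) ?_ true
          have hw : Wide [(1, true), (0, true)] (N + 2) := by simp [Wide]; omega
          have := hw.maps l m hl hm
          omega
        exact e1.trans (cap_drag' hR (l := l) (p := 0) (by omega) true)
    | succ d ih =>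
      have h1 := passGrp_cap_of_le hR (N := N) (Nat.zero_le d) (by omega)
      have h2 := mul_mem (mul_mem (inv_mem h1) (ih (by omega))) h1
      have h3 : chord (gen hR) 0 (d + 1 + 2) * chord (gen hR) (0 + 1) (d + 1 + 2) =
          (gen hR (d + 2))⁻¹ * (chord (gen hR) 0 (d + 2) * chord (gen hR) (0 + 1) (d + 2)) *
            gen hR (d + 2) := by
        have sw : ∀ x < 2, Equiv.swap (d + 2) (d + 2 + 1) x = x := fun x hx =>
          Equiv.swap_apply_of_ne_of_ne (by omega) (by omega)
        have := hs.chord_mul (z := 1) (t := d + 2) (by omega) (d + 2)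
        rw [sw 1 (by omega), Equiv.swap_apply_left] at this
        have this' := hs.chord_mul (z := 0) (t := d + 2) (by omega) (d + 2)
        rw [sw 0 (by omega), Equiv.swap_apply_left] at this'
        rw [eq_comm, mul_assoc, inv_mul_eq_iff_eq_mul, mul_assoc, Nat.zero_add, this, ← mul_assoc,
          this', mul_assoc]
      rw [h3]
      convert h2 using 1
      ext <;> simp
  | succ p ih =>
    obtain ⟨y', rfl⟩ : ∃ y', y = Equiv.swap p (p + 1) (Equiv.swap (p + 1) (p + 2) y') :=
      ⟨Equiv.swap (p + 1) (p + 2) (Equiv.swap p (p + 1) y), by simp⟩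
    simp only [Equiv.swap_apply_def] at hy hyp hyp'
    have hy1 : y' ≠ p := by rintro rfl; simp at hyp
    have hy2 : y' ≠ p + 1 := by rintro rfl; simp at hyp'
    have h1 := passGrp_cap_succ hR (by omega)
      (ih (y := y') (by split_ifs at hy <;> omega) hy1 hy2 (by omega))
    have h2 : (gen hR p * gen hR (p + 1)) * (chord (gen hR) p y' * chord (gen hR) (p + 1) y') *
        (gen hR p * gen hR (p + 1))⁻¹ = ((gen hR p * gen hR (p + 1)) * chord (gen hR) p y' *
        (gen hR p * gen hR (p + 1))⁻¹) * ((gen hR p * gen hR (p + 1)) * chord (gen hR) (p + 1) y' *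
        (gen hR p * gen hR (p + 1))⁻¹) := by group
    rw [h2, chord_conj' hR hs hy1.symm, chord_conj' hR hs hy2.symm,
      Equiv.swap_apply_left (p + 1) (p + 2),
      Equiv.swap_apply_of_ne_of_ne (a := p + 1) (b := p + 2) (x := p) (by omega) (by omega),
      Equiv.swap_apply_left, Equiv.swap_apply_of_ne_of_ne (a := p) (b := p + 1) (x := p + 2)
      (by omega) (by omega)] at h1
    exact h1

end Turns

/-! ### Plats -/

/-- A row of minima. -/
def cups {n : ℕ} : List (Fin n × Bool) → Word n
  | [] => []
  | x :: c => cups c ++ [(0, .cup x.1 x.2)]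

/-- A row of maxima. -/
def caps {n : ℕ} (m : ℕ) : Word n := List.replicate m (0, .cap)

section Plat

variable {n : ℕ} {R : Move n} (hR : Base R)

theorem caps_succ (m : ℕ) : (caps (m + 1) : Word n) = [(0, .cap)] ++ caps m := rfl

theorem length_of_run_caps {m : ℕ} {l k : Level n} (h : run (caps m) l = some k) :
    l.length = k.length + 2 * m := by
  induction m generalizing l with
  | zero => simp only [caps, List.replicate_zero, run, Option.some.injEq] at h; simp [h]
  | succ m ih =>
    rw [caps_succ, run_append, run_singleton, Option.bind_eq_some_iff] at h
    obtain ⟨l', h1, h2⟩ := h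
    have h3 := (length_of_act h1).2
    simp only [Piece.dom, Piece.cod] at h3
    have := ih h2
    omega

theorem maps_caps {m N : ℕ} (h : N = 2 * m) : Maps (n := n) (caps m) N 0 := by
  intro l k hl hk
  have := length_of_run_caps hk
  omega

/-- The level above a row of minima. -/
def cupLevel (c : List (Fin n × Bool)) : Level n := c.flatMap fun x => [(x.1, x.2), (x.1, !x.2)]

theorem run_cups (c : List (Fin n × Bool)) : run (cups c) [] = some (cupLevel c) := by
  induction c with
  | nil => rfl
  | cons x c ih => simp [cups, run_append, ih, run_singleton, act, cupLevel]

theorem length_cupLevel (c : List (Fin n × Bool)) : (cupLevel c).length = 2 * c.length := by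
  induction c with
  | nil => rfl
  | cons x c ih => simp only [cupLevel, List.flatMap_cons, List.length_append] at ih ⊢; simp [ih]; omega

theorem maps_cups {c : List (Fin n × Bool)} {N : ℕ} (h : N = 2 * c.length) :
    Maps (cups c) 0 N := by
  intro l k hl hk
  rw [List.length_eq_zero_iff.1 hl, run_cups, Option.some.injEq] at hk
  rw [← hk, length_cupLevel, h]

include hR

/-- Minima of a row are far apart, so any one of them may be regarded as the last to be created.
Facts about a single minimum then apply to every minimum of the row. -/
theorem cups_insert (c₁ c₂ : List (Fin n × Bool)) (x : Fin n × Bool) :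
    UEqv R (cups (c₁ ++ x :: c₂)) (cups (c₁ ++ c₂) ++ [(2 * c₁.length, .cup x.1 x.2)]) := by
  induction c₁ with
  | nil => exact .refl _
  | cons y c₁ ih =>
    have e1 := ih.append_right [(0, .cup y.1 y.2)]
    have e2 := (cup_cup_of_le hR (Nat.zero_le (2 * c₁.length)) y.1 x.1 y.2 x.2).symm.append_left
      (cups (c₁ ++ c₂))
    simp only [List.append_assoc, List.singleton_append] at e1
    have e3 := e1.trans e2
    rw [show 2 * c₁.length + 2 = 2 * (y :: c₁).length by simp; omega] at e3
    simpa [cups] using e3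

theorem caps_insert {t m : ℕ} (h : t ≤ m) :
    UEqv R (caps (m + 1)) ([(2 * t, .cap)] ++ caps m : Word n) := by
  induction t generalizing m with
  | zero => exact .refl _
  | succ t ih =>
    obtain ⟨m, rfl⟩ : ∃ k, m = k + 1 := ⟨m - 1, by omega⟩
    have e1 := (ih (m := m) (by omega)).append_left [(0, .cap)]
    have e2 := (cap_cap_of_le hR (n := n) (Nat.zero_le (2 * t))).append_right (caps m)
    have e3 := e1.trans e2
    rwa [show 2 * t + 2 = 2 * (t + 1) by omega] at e3

theorem cup_to_zero {q : ℕ} (i : Fin n) (s : Bool) : ∃ b : List (ℕ × Bool),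
    ∀ l : Level n, q ≤ l.length → Eqv R l [(q, .cup i s)] ([(0, .cup i s)] ++ bw b) := by
  induction q with
  | zero => exact ⟨[], fun l _ => .refl _⟩
  | succ q ih =>
    obtain ⟨b, hb⟩ := ih
    refine ⟨b ++ [(q + 1, true), (q, true)], fun l hl => ?_⟩
    have e1 := (hb l (by omega)).append_right (bw [(q + 1, true), (q, true)])
    have e2 := (cup_drag' hR (p := q) hl i s true).symm
    rw [bw_append, ← List.append_assoc]
    exact e2.trans e1

theorem cap_to_zero {q : ℕ} : ∃ b : List (ℕ × Bool),
    ∀ l : Level n, q + 2 ≤ l.length → Eqv R l [(q, .cap)] (bw b ++ [(0, .cap)]) := by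
  induction q with
  | zero => exact ⟨[], fun l _ => .refl _⟩
  | succ q ih =>
    obtain ⟨b, hb⟩ := ih
    refine ⟨[(q, true), (q + 1, true)] ++ b, fun l hl => ?_⟩
    have e2 := (cap_drag hR (p := q) hl true).symm
    have e1 : Eqv R l (bw [(q, true), (q + 1, true)] ++ [(q, .cap)])
        (bw [(q, true), (q + 1, true)] ++ (bw b ++ [(0, .cap)])) := by
      refine .append_left fun m hm => hb m ?_
      have hw : Wide [(q, true), (q + 1, true)] l.length := by simp [Wide]; omega
      have := hw.maps l m rfl hm
      omega
    rw [bw_append, List.append_assoc]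
    exact e2.trans e1

theorem caps_cross (k p : ℕ) (a : Kind) :
    UEqv R (caps k ++ [X p a]) ([X (p + 2 * k) a] ++ caps k : Word n) := by
  induction k generalizing p with
  | zero => exact .refl _
  | succ k ih =>
    have e1 := (ih p).append_left [(0, .cap)]
    have e2 := (cap_cross_of_le hR (n := n) (Nat.zero_le (p + 2 * k)) a).append_right (caps k)
    have e3 := e1.trans e2
    rwa [show p + 2 * k + 2 = p + 2 * (k + 1) by omega] at e3

theorem caps_cup (k p : ℕ) (i : Fin n) (s : Bool) :
    UEqv R (caps k ++ [(p, .cup i s)]) ([(p + 2 * k, .cup i s)] ++ caps k) := by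
  induction k generalizing p with
  | zero => exact .refl _
  | succ k ih =>
    have e1 := (ih p).append_left [(0, .cap)]
    have e2 := (cap_cup_of_le hR (n := n) (Nat.zero_le (p + 2 * k)) i s).append_right (caps k)
    have e3 := e1.trans e2
    rwa [show p + 2 * k + 2 = p + 2 * (k + 1) by omega] at e3

theorem caps_cap (k p : ℕ) :
    UEqv R (caps k ++ [(p, .cap)]) ([(p + 2 * k, .cap)] ++ caps k : Word n) := by
  induction k generalizing p with
  | zero => exact .refl _
  | succ k ih =>
    have e1 := (ih p).append_left [(0, .cap)]
    have e2 := (cap_cap_of_le hR (n := n) (Nat.zero_le (p + 2 * k))).append_right (caps k)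
    have e3 := e1.trans e2
    rwa [show p + 2 * k + 2 = p + 2 * (k + 1) by omega] at e3

/-- Every classical word is equivalent to a plat. -/
theorem exists_plat {w : Word n} (hw : ∀ p, (p, Piece.cross Kind.virt) ∉ w)
    (hrun : run w [] ≠ none) : ∃ c b k, Eqv R [] w (cups c ++ bw b ++ caps k) := by
  induction w using List.reverseRecOn with
  | nil => exact ⟨[], [], 0, .refl _⟩
  | append_singleton w g ih =>
    have hrun' : run w [] ≠ none := by
      intro h0; rw [run_append, h0] at hrun; exact hrun rfl
    obtain ⟨c, b, k, e⟩ := ih (fun p hp => hw p (List.mem_append_left _ hp)) hrun'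
    have e' := e.append_right [g]
    have hr : run (cups c ++ bw b ++ caps k ++ [g]) [] ≠ none := e'.1 ▸ hrun
    obtain ⟨p, g⟩ := g
    cases g with
    | cross a =>
      cases a with
      | virt => exact absurd (by simp) (hw p)
      | cl a =>
        refine ⟨c, b ++ [(p + 2 * k, a)], k, e'.trans ?_⟩
        have e1 := (caps_cross hR k p (.cl a)).append_left (cups c ++ bw b)
        rw [bw_append]
        simpa [bw, toW, X] using e1 []
    | cup i s =>
      -- The new minimum is pushed below the maxima, dragged to the left end at the cost of a braid
      -- `d`, and pushed below `b`, whose letters move right by two.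
      obtain ⟨d, hd⟩ := cup_to_zero hR (q := p + 2 * k) i s
      refine ⟨(i, s) :: c, b.map (fun x => (x.1 + 2, x.2)) ++ d, k, e'.trans ?_⟩
      have e1 := (caps_cup hR k p i s).append_left (cups c ++ bw b) []
      rw [← List.append_assoc] at e1
      have e2 : Eqv R [] ((cups c ++ bw b) ++ [(p + 2 * k, .cup i s)] ++ caps k)
          ((cups c ++ bw b) ++ ([(0, .cup i s)] ++ bw d) ++ caps k) := by
        refine Eqv.replace ?_ fun m hm h => hd m ?_
        · rw [← List.append_assoc] at e1
          exact e1.1 ▸ hr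
        · obtain ⟨k', hk'⟩ := Option.ne_none_iff_exists'.1 h
          rw [run_singleton] at hk'
          exact (length_of_act hk').1
      have e3 := ((toW_cup_of_le hR (b := b.map fun x => (x.1, .cl x.2)) (q := 0)
        (fun _ _ => Nat.zero_le _) i s).mid (cups c) (bw d ++ caps k)) []
      refine (Eqv.trans (by simpa using e1) e2).trans ?_
      have hb : up 2 (b.map fun x => (x.1, Kind.cl x.2)) =
          (b.map fun x => (x.1 + 2, x.2)).map fun x => (x.1, Kind.cl x.2) := by
        simp [up, Function.comp_def]
      rw [hb] at e3
      rw [bw_append]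
      simpa [cups, bw] using e3
    | cap =>
      obtain ⟨d, hd⟩ := cap_to_zero hR (n := n) (q := p + 2 * k)
      refine ⟨c, b ++ d, k + 1, e'.trans ?_⟩
      have e1 := (caps_cap hR k p).append_left (cups c ++ bw b) []
      rw [← List.append_assoc] at e1
      have e2 : Eqv R [] ((cups c ++ bw b) ++ [(p + 2 * k, .cap)] ++ caps k)
          ((cups c ++ bw b) ++ (bw d ++ [(0, .cap)]) ++ caps k) := by
        refine Eqv.replace ?_ fun m hm h => hd m ?_
        · rw [← List.append_assoc] at e1
          exact e1.1 ▸ hr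
        · obtain ⟨k', hk'⟩ := Option.ne_none_iff_exists'.1 h
          rw [run_singleton] at hk'
          exact (length_of_act hk').1
      refine (Eqv.trans (by simpa using e1) e2).trans ?_
      rw [bw_append, caps_succ]
      simp only [List.append_assoc]
      exact .refl _

end Plat

/-! ### Plat presentations and braids turning into minima -/

section Rep

variable {n : ℕ} {R : Move n} (hR : Base R)
include hR

theorem commute_gen {p q : ℕ} (h : p + 2 ≤ q) : Commute (gen hR p) (gen hR q) :=
  Units.ext (cls_eq_of_eqv (b := [(p, .cl true), (q, .cl true)])
    (c := [(q, .cl true), (p, .cl true)]) 0 fun l _ => cross_cross hR h _ _ l)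

omit hR in
theorem cls_tri {p : ℕ} {k₁ k₂ k₃ : Kind} (h : R (triUp p k₁ k₂ k₃) (triDown p k₁ k₂ k₃)) :
    cls R [(p, k₁), (p + 1, k₂), (p, k₃)] = cls R [(p + 1, k₃), (p, k₂), (p + 1, k₁)] :=
  cls_eq_of_eqv 0 fun l _ => .of_move h (run_tri p k₁ k₂ k₃ l)

theorem braid_gen (p : ℕ) : gen hR p * gen hR (p + 1) * gen hR p =
    gen hR (p + 1) * gen hR p * gen hR (p + 1) :=
  Units.ext (cls_tri (hR _ _ (.inr (.R3 p true true true (.inl rfl)))))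

theorem isDeltaFamily_gen (hd : ∀ p, Commute (gen hR p * gen hR p)
    (gen hR (p + 1) * gen hR (p + 1))) : IsDeltaFamily (gen hR) :=
  ⟨commute_gen hR, braid_gen hR, hd⟩

theorem isDeltaFamily_of_delta (h : ∀ u v, Delta u v → R u v) : IsDeltaFamily (gen hR) :=
  isDeltaFamily_gen hR fun p => (delta_iff_commute_sq (braid_gen hR p)).1
    (Units.ext (cls_tri (h _ _ (.delta p true))))

/-- The word `w` is equivalent to a plat with the minima `c` and the braid `g`. -/
def Rep (w : Word n) (c : List (Fin n × Bool)) (g : (CrossMonoid R)ˣ) : Prop :=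
  ∃ b, Wide b (2 * c.length) ∧ val hR b = g ∧
    Eqv R [] w (cups c ++ bw b ++ caps c.length)

/-- The braid `h` above the minima `c` is absorbed by them, which yields the minima `c'`. -/
def Turn (c : List (Fin n × Bool)) (h : (CrossMonoid R)ˣ) (c' : List (Fin n × Bool)) : Prop :=
  c'.length = c.length ∧ ∃ b, Wide b (2 * c.length) ∧ val hR b = h ∧
    Eqv R [] (cups c ++ bw b) (cups c')

variable {w : Word n} {c c' : List (Fin n × Bool)} {g h : (CrossMonoid R)ˣ}

theorem exists_rep (hw : ∀ p, (p, Piece.cross Kind.virt) ∉ w) (hrun : run w [] = some []) :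
    ∃ c, ∃ g ∈ braidGrp (gen hR) 0 (2 * c.length), Rep hR w c g := by
  obtain ⟨c, b, k, e⟩ := exists_plat hR hw (by simp [hrun])
  have h1 := e.1
  rw [hrun, List.append_assoc, run_append, run_cups, Option.bind_some, run_append, eq_comm,
    Option.bind_eq_some_iff] at h1
  obtain ⟨l, hl, h2⟩ := h1
  have hb : Wide b (2 * c.length) := by
    intro x hx
    rw [← length_cupLevel]
    exact of_run_toW (ne_of_eq_of_ne hl (Option.some_ne_none _)) (x.1, .cl x.2)
      (List.mem_map.2 ⟨x, hx, rfl⟩)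
  have h3 := hb.maps _ _ (length_cupLevel c) hl
  have h4 := length_of_run_caps h2
  -- The word is closed and braids preserve the number of strands, so there are as many maxima as
  -- minima.
  obtain rfl : k = c.length := by simp at h4; omega
  exact ⟨c, _, (mem_braidGrp_zero hR).2 ⟨b, hb, rfl⟩, b, hb, rfl, e⟩

theorem Rep.eqv {b : List (ℕ × Bool)} (h : Rep hR w c g) (hb : Wide b (2 * c.length))
    (hv : val hR b = g) : Eqv R [] w (cups c ++ bw b ++ caps c.length) := by
  obtain ⟨b', hb', hv', e⟩ := h
  refine e.trans (.append_right (.append_left fun m hm => ?_) _)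
  have := maps_cups rfl _ _ rfl hm
  exact bw_eqv hR (hv'.trans hv.symm) (this ▸ hb') (this ▸ hb)

theorem Rep.mul_left (hg : Rep hR w c g)
    (hh : (1, h) ∈ passGrp hR (cups c) 0 (2 * c.length) (maps_cups rfl)) :
    Rep hR w c (h * g) := by
  obtain ⟨b, hb, hv, e⟩ := hg
  obtain ⟨b', d, hb', hd, hv1, hv2, e'⟩ := hh
  refine ⟨d ++ b, hd.append hb, by rw [val_append, hv2, hv], e.trans ?_⟩
  have hb0 : b' = [] := List.eq_nil_iff_forall_not_mem.2 fun x hx => by have := hb' x hx; omega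
  subst hb0
  have := (e' [] rfl).append_right (bw b ++ caps c.length)
  rw [bw_append]
  simpa [bw, toW] using this

theorem Rep.mul_right (hg : Rep hR w c g)
    (hh : (h, 1) ∈ passGrp hR (caps c.length) (2 * c.length) 0 (maps_caps rfl)) :
    Rep hR w c (g * h) := by
  obtain ⟨b, hb, hv, e⟩ := hg
  obtain ⟨d, b', hd, hb', hv1, hv2, e'⟩ := hh
  refine ⟨b ++ d, hb.append hd, by rw [val_append, hv1, hv], e.trans ?_⟩
  have hb0 : b' = [] := List.eq_nil_iff_forall_not_mem.2 fun x hx => by have := hb' x hx; omega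
  subst hb0
  have : Eqv R [] (cups c ++ bw b ++ (bw d ++ caps c.length)) (cups c ++ bw b ++ (caps c.length ++ bw []))
      := by
    refine .append_left fun m hm => e' m ?_
    exact ((maps_cups rfl).append hb.maps) _ _ rfl hm
  rw [bw_append]
  simpa [bw, toW] using this.symm

theorem Rep.turn (hg : Rep hR w c (h * g)) (hh : Turn hR c h c')
    (hgm : g ∈ braidGrp (gen hR) 0 (2 * c.length)) : Rep hR w c' g := by
  obtain ⟨hlen, b, hb, hv, e⟩ := hh
  obtain ⟨d, hd, rfl⟩ := (mem_braidGrp_zero hR).1 hgm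
  refine ⟨d, hlen ▸ hd, rfl, ?_⟩
  have h1 := hg.eqv hR (b := b ++ d) (hb.append hd) (by rw [val_append, hv])
  have h2 := e.append_right (bw d ++ caps c.length)
  rw [hlen]
  rw [bw_append] at h1
  simp only [List.append_assoc] at h1 h2 ⊢
  exact h1.trans h2

/-! ### The braids absorbed by rows of minima and maxima -/

omit hR in
theorem exists_eq_append_cons {α : Type*} {c : List α} {i : ℕ} (hi : i < c.length) :
    ∃ c₁ x c₂, c = c₁ ++ x :: c₂ ∧ c₁.length = i :=
  ⟨c.take i, c.get ⟨i, hi⟩, c.drop (i + 1), by simp, by simp; omega⟩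

theorem turn_flip (c₁ c₂ : List (Fin n × Bool)) (x : Fin n × Bool) :
    Turn hR (c₁ ++ x :: c₂) (gen hR (2 * c₁.length)) (c₁ ++ (x.1, !x.2) :: c₂) := by
  refine ⟨by simp, [(2 * c₁.length, true)], by simp [Wide]; omega, by simp [val], ?_⟩
  have e1 := (cups_insert hR c₁ c₂ x).append_right (bw [(2 * c₁.length, true)]) []
  have e2 : Eqv R [] (cups (c₁ ++ c₂) ++ ([(2 * c₁.length, .cup x.1 x.2)] ++
      bw [(2 * c₁.length, true)])) (cups (c₁ ++ c₂) ++ [(2 * c₁.length, .cup x.1 !x.2)]) := by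
    refine .append_left fun m hm => cup_kink hR ?_ _ _ _
    rw [maps_cups rfl _ _ rfl hm]
    simp
  rw [List.append_assoc] at e1
  exact (e1.trans e2).trans ((cups_insert hR c₁ c₂ (x.1, !x.2)) []).symm

/-- The right minimum is dragged to the left through both legs of its neighbour. The letters occur
in the order of this motion and agree with `twist` because `gen hR p` and `gen hR (p + 2)` commute.
-/
theorem turn_twist (c₁ c₂ : List (Fin n × Bool)) (x y : Fin n × Bool) :
    Turn hR (c₁ ++ x :: y :: c₂) (twist (gen hR) (2 * c₁.length)) (c₁ ++ y :: x :: c₂) := by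
  set p := 2 * c₁.length with hp
  refine ⟨by simp, [(p + 1, true), (p + 2, true), (p, true), (p + 1, true)], ?_, ?_, ?_⟩
  · simp [Wide]; omega
  · have := (commute_gen hR (p := p) (q := p + 2) le_rfl).eq
    simp only [val, twist, List.map, List.prod_cons, List.prod_nil, mul_one, if_true]
    rw [mul_assoc, ← mul_assoc (gen hR p), this, mul_assoc]
  · have i1 := cups_insert hR (c₁ ++ [x]) c₂ y
    have i2 := cups_insert hR c₁ c₂ x
    have i3 := cups_insert hR c₁ (x :: c₂) y
    simp only [List.append_assoc, List.singleton_append, List.length_append, List.length_singleton,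
      Nat.mul_add, Nat.mul_one] at i1
    rw [← hp] at i1 i3
    have e1 : Eqv R [] (cups (c₁ ++ x :: c₂) ++ ([(p + 1 + 1, .cup y.1 y.2), X (p + 1) (.cl true),
        X (p + 1 + 1) (.cl true)] ++ [X p (.cl true), X (p + 1) (.cl true)]))
        (cups (c₁ ++ x :: c₂) ++ [(p, .cup y.1 y.2)]) := by
      refine .append_left fun m hm => ?_
      have hlen := maps_cups rfl _ _ rfl hm
      simp only [List.length_append, List.length_cons] at hlen
      exact ((cup_drag hR (p := p + 1) (by omega) y.1 y.2 true).append_right _).trans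
        (cup_drag hR (p := p) (by omega) y.1 y.2 true)
    have e0 := i1.append_right (bw [(p + 1, true), (p + 2, true), (p, true), (p + 1, true)]) []
    rw [List.append_assoc] at e0
    exact (e0.trans e1).trans (i3 []).symm

theorem pass_cups {h : (CrossMonoid R)ˣ} {i N : ℕ} (hi : i < c.length) (hN : 2 * c.length = N + 2)
    (hh : ∀ j s, (1, h) ∈ passGrp hR [(2 * i, .cup j s)] N (N + 2) (maps_cup _ j s N)) :
    (1, h) ∈ passGrp hR (cups c) 0 (2 * c.length) (maps_cups rfl) := by
  obtain ⟨c₁, x, c₂, rfl, rfl⟩ := exists_eq_append_cons hi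
  have e := passGrp_append hR (maps_cups (c := c₁ ++ c₂) (by simp at hN ⊢; omega)) _
    (one_mem _) (hh x.1 x.2)
  simp only [hN]
  exact passGrp_congr hR _ _ (fun l _ => (cups_insert hR c₁ c₂ x l).symm) e

theorem pass_caps {h : (CrossMonoid R)ˣ} {i m N : ℕ} (hi : i < m) (hN : 2 * m = N + 2)
    (hh : (h, 1) ∈ passGrp hR [(2 * i, .cap)] (N + 2) N (maps_cap _ N)) :
    (h, 1) ∈ passGrp hR (caps m) (2 * m) 0 (maps_caps rfl) := by
  obtain ⟨m, rfl⟩ : ∃ k, m = k + 1 := ⟨m - 1, by omega⟩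
  have e := passGrp_append hR _ (maps_caps (n := n) (m := m) (by omega)) hh (one_mem _)
  simp only [hN]
  exact passGrp_congr hR _ _ (fun l _ => (caps_insert hR (by omega) l).symm) e

variable (hs : IsDeltaFamily (gen hR)) {i y m : ℕ}

include hs in
theorem pass_cups_both (hi : i < c.length) (hy : y < 2 * c.length) (h1 : y ≠ 2 * i)
    (h2 : y ≠ 2 * i + 1) : (1, chord (gen hR) (2 * i) y * chord (gen hR) (2 * i + 1) y) ∈
      passGrp hR (cups c) 0 (2 * c.length) (maps_cups rfl) :=
  pass_cups hR (N := 2 * c.length - 2) hi (by omega) fun j s =>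
    passGrp_cup_both hR j s hs (by omega) h1 h2 (by omega)

theorem pass_cups_self (hi : i < c.length) : (1, chord (gen hR) (2 * i) (2 * i + 1)) ∈
    passGrp hR (cups c) 0 (2 * c.length) (maps_cups rfl) :=
  pass_cups hR (N := 2 * c.length - 2) hi (by omega) fun j s =>
    passGrp_cup_self hR j s (by omega)

include hs in
theorem pass_caps_both (hi : i < m) (hy : y < 2 * m) (h1 : y ≠ 2 * i)
    (h2 : y ≠ 2 * i + 1) : (chord (gen hR) (2 * i) y * chord (gen hR) (2 * i + 1) y, 1) ∈
      passGrp hR (caps m) (2 * m) 0 (maps_caps rfl) :=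
  pass_caps hR (N := 2 * m - 2) hi (by omega) 
    (passGrp_cap_both hR hs (by omega) h1 h2 (by omega))

theorem pass_caps_self (hi : i < m) : (chord (gen hR) (2 * i) (2 * i + 1), 1) ∈
    passGrp hR (caps m) (2 * m) 0 (maps_caps rfl) :=
  pass_caps hR (N := 2 * m - 2) hi (by omega) (passGrp_cap_self hR (by omega))

theorem pass_caps_gen (hi : i < m) : (gen hR (2 * i), 1) ∈
    passGrp hR (caps m) (2 * m) 0 (maps_caps rfl) :=
  pass_caps hR (N := 2 * m - 2) hi (by omega) ⟨[(2 * i, true)], [], by simp [Wide]; omega,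
    by simp [Wide], by simp [val], rfl, fun l _ => cap_kink hR _ _ l⟩

theorem pass_caps_twist (hi : i + 1 < m) : (twist (gen hR) (2 * i), 1) ∈
    passGrp hR (caps m) (2 * m) 0 (maps_caps rfl) := by
  obtain ⟨m, rfl⟩ : ∃ k, m = k + 2 := ⟨m - 2, by omega⟩
  set p := 2 * i with hp
  refine ⟨[(p + 1, true), (p + 2, true), (p, true), (p + 1, true)], [], by simp [Wide]; omega,
    by simp [Wide], ?_, rfl, fun l hl => ?_⟩
  · have := (commute_gen hR (p := p) (q := p + 2) le_rfl).eq
    simp only [val, twist, List.map, List.prod_cons, List.prod_nil, mul_one, if_true]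
    rw [mul_assoc, ← mul_assoc (gen hR p), this, mul_assoc]
  · have i1 := caps_insert hR (n := n) (t := i) (m := m + 1) (by omega)
    have i2 := caps_insert hR (n := n) (t := i + 1) (m := m + 1) (by omega)
    have e1 : Eqv R l ([X (p + 1) (.cl true), X (p + 2) (.cl true)] ++
        [X p (.cl true), X (p + 1) (.cl true), (p, .cap)])
        ([X (p + 1) (.cl true), X (p + 2) (.cl true)] ++ [(p + 1, .cap)]) := by
      refine .append_left fun k hk => cap_drag hR ?_ true
      have hw : Wide [(p + 1, true), (p + 2, true)] l.length := by simp [Wide]; omega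
      have := hw.maps l k rfl hk
      omega
    have e2 := (e1.trans (cap_drag hR (l := l) (p := p + 1) (by omega) true)).append_right
      (caps (m + 1))
    have e0 := (i1.append_left
      (bw [(p + 1, true), (p + 2, true), (p, true), (p + 1, true)])) l
    have e3 := (e0.trans e2).trans (i2 l).symm
    simpa [bw, toW] using e3

end Rep

theorem exists_mul_of_mem_sup {G : Type*} [Group G] {A K : Subgroup G}
    (hAK : ∀ a ∈ A, ∀ k ∈ K, Commute a k) {x : G} (hx : x ∈ A ⊔ K) :
    ∃ a ∈ A, ∃ k ∈ K, x = a * k := by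
  rw [Subgroup.sup_eq_closure] at hx
  induction hx using Subgroup.closure_induction with
  | mem x hx =>
    rcases hx with hx | hx
    · exact ⟨x, hx, 1, one_mem _, (mul_one x).symm⟩
    · exact ⟨1, one_mem _, x, hx, (one_mul x).symm⟩
  | one => exact ⟨1, one_mem _, 1, one_mem _, (mul_one 1).symm⟩
  | mul x y _ _ hx hy =>
    obtain ⟨a, ha, k, hk, rfl⟩ := hx
    obtain ⟨b, hb, l, hl, rfl⟩ := hy
    exact ⟨a * b, mul_mem ha hb, k * l, mul_mem hk hl, ((hAK b hb k hk).mul_mul_mul_comm a l).symm⟩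
  | inv x _ hx =>
    obtain ⟨a, ha, k, hk, rfl⟩ := hx
    refine ⟨a⁻¹, inv_mem ha, k⁻¹, inv_mem hk, ?_⟩
    rw [mul_inv_rev, (hAK _ (inv_mem ha) _ (inv_mem hk)).eq]

/-! ### Reduction of a plat to chords -/

section Reduce

variable {n : ℕ} {R : Move n} (hR : Base R) (hs : IsDeltaFamily (gen hR))
  {w : Word n} {c c' : List (Fin n × Bool)} {g h : (CrossMonoid R)ˣ}
include hs

omit hs in
/-- The chords which can be removed below the braid `g`. -/
def idle (w : Word n) (c : List (Fin n × Bool)) (g : (CrossMonoid R)ˣ) :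
    Subgroup (CrossMonoid R)ˣ where
  carrier := {k | k ∈ chordGrp (gen hR) (Set.Iio (2 * c.length)) ∧
    ∀ y ∈ chordGrp (gen hR) (Set.Iio (2 * c.length)), Rep hR w c (y * k * g) ↔ Rep hR w c (y * g)}
  one_mem' := ⟨one_mem _, fun y _ => by rw [mul_one]⟩
  mul_mem' := by
    rintro a b ⟨ha, ha'⟩ ⟨hb, hb'⟩
    refine ⟨mul_mem ha hb, fun y hy => ?_⟩
    rw [← mul_assoc, hb' _ (mul_mem hy ha), ha' y hy]
  inv_mem' := by
    rintro a ⟨ha, ha'⟩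
    refine ⟨inv_mem ha, fun y hy => ?_⟩
    rw [← ha' _ (mul_mem hy (inv_mem ha)), inv_mul_cancel_right]

omit hs in
theorem Rep.mul_left_iff
    (hh : (1, h) ∈ passGrp hR (cups c) 0 (2 * c.length) (maps_cups rfl)) :
    Rep hR w c (h * g) ↔ Rep hR w c g := by
  refine ⟨fun H => ?_, fun H => H.mul_left hR hh⟩
  have := H.mul_left hR (h := h⁻¹) (by simpa using inv_mem hh)
  rwa [inv_mul_cancel_left] at this

omit hs in
theorem Rep.mul_right_iff
    (hh : (h, 1) ∈ passGrp hR (caps c.length) (2 * c.length) 0 (maps_caps rfl)) :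
    Rep hR w c (g * h) ↔ Rep hR w c g := by
  refine ⟨fun H => ?_, fun H => H.mul_right hR hh⟩
  have := H.mul_right hR (h := h⁻¹) (by simpa using inv_mem hh)
  rwa [mul_inv_cancel_right] at this

/-- All chords commute, so `h` can be brought next to the minima, whatever other chords are present.
-/
theorem idle_of_cups (hm : h ∈ chordGrp (gen hR) (Set.Iio (2 * c.length)))
    (hh : (1, h) ∈ passGrp hR (cups c) 0 (2 * c.length) (maps_cups rfl)) :
    h ∈ idle hR w c g := by
  refine ⟨hm, fun y hy => ?_⟩
  rw [(hs.chordGrp_comm hy hm).eq, mul_assoc, Rep.mul_left_iff hR hh]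

omit hs in
-- Moving `h` up through the braid `g` conjugates it, and the conjugate is absorbed by the maxima.
theorem idle_of_caps (hm : h ∈ chordGrp (gen hR) (Set.Iio (2 * c.length)))
    (hh : (g⁻¹ * h * g, 1) ∈ passGrp hR (caps c.length) (2 * c.length) 0 (maps_caps rfl)) :
    h ∈ idle hR w c g := by
  refine ⟨hm, fun y hy => ?_⟩
  rw [show y * h * g = y * g * (g⁻¹ * h * g) by group, Rep.mul_right_iff hR hh]

theorem Rep.of_idle {S : Set ℕ} (hS : S ⊆ Set.Iio (2 * c.length)) {x : (CrossMonoid R)ˣ}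
    (hx : x ∈ chordGrp (gen hR) (Set.Iio (2 * c.length))) (H : Rep hR w c (x * g))
    (hc : ∀ z t, z < 2 * c.length → t < 2 * c.length → z ≠ t →
      chord (gen hR) z t ∈ chordGrp (gen hR) S ⊔ idle hR w c g) :
    ∃ x' ∈ chordGrp (gen hR) S, Rep hR w c (x' * g) := by
  have hle : chordGrp (gen hR) (Set.Iio (2 * c.length)) ≤ chordGrp (gen hR) S ⊔ idle hR w c g := by
    refine (Subgroup.closure_le _).2 ?_
    rintro _ ⟨z, t, hz, ht, h, rfl⟩
    exact hc z t hz ht h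
  obtain ⟨a, ha, k, hk, rfl⟩ := exists_mul_of_mem_sup (A := chordGrp (gen hR) S)
    (K := idle hR w c g) (fun a ha k hk => hs.chordGrp_comm (chordGrp_mono hS ha) hk.1) (hle hx)
  exact ⟨a, ha, (hk.2 a (chordGrp_mono hS ha)).1 H⟩

omit hs in
theorem idle_cancel {H : Subgroup (CrossMonoid R)ˣ} {a b : (CrossMonoid R)ˣ} (h : a * b ∈ H)
    (ha : a ∈ H) : b ∈ H := by
  simpa using mul_mem (inv_mem ha) h

/-! ### Sliding braids off the minima -/

/-- The leg `q + k` has to become the left leg of the minimum number `a`. The lowest letters of the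
braid either exchange two minima or turn one over, so the row absorbs them; what cannot be absorbed
stays to the right of `2 * a`. Each step decreases `k`, whence the strong induction. -/
theorem Rep.strip {q a k : ℕ} (hq : q ≤ 2 * a) (hk : 2 * a ≤ q + k) (hkc : q + k < 2 * c.length)
    (hg : g ∈ braidGrp (gen hR) 0 (2 * c.length)) (H : Rep hR w c (desc (gen hR) q k * g)) :
    ∃ c', c'.length = c.length ∧ ∃ h ∈ braidGrp (gen hR) (2 * a + 1) (2 * c.length),
      Rep hR w c' (desc (gen hR) q (2 * a - q) * h * g) := by
  have hd : ∀ {k}, q + k < 2 * c.length → desc (gen hR) q k ∈ braidGrp (gen hR) 0 (2 * c.length) :=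
    fun h => braidGrp_mono (Nat.zero_le _) le_rfl (desc_mem h)
  induction k using Nat.strong_induction_on generalizing c g with
  | _ k ih =>
  rcases Nat.eq_or_lt_of_le hk with h0 | h0
  · refine ⟨c, rfl, 1, one_mem _, ?_⟩
    rwa [mul_one, h0, Nat.add_sub_cancel_left]
  · rcases Nat.even_or_odd' (q + k) with ⟨i, hi | hi⟩
    · obtain ⟨i, rfl⟩ : ∃ j, i = j + 1 := ⟨i - 1, by omega⟩
      obtain ⟨k, rfl⟩ : ∃ j, k = j + 2 := ⟨k - 2, by omega⟩
      obtain ⟨c₁, x, c₂, rfl, hc₁⟩ := exists_eq_append_cons (c := c) (i := i) (by omega)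
      obtain ⟨y, c₂, rfl⟩ : ∃ y d, c₂ = y :: d := by
        cases c₂ with
        | nil => simp at hkc; omega
        | cons y d => exact ⟨y, d, rfl⟩
      have hlen : (c₁ ++ y :: x :: c₂).length = (c₁ ++ x :: y :: c₂).length := by simp
      have h1 : (gen hR (q + k + 1))⁻¹ * (gen hR (q + k + 2))⁻¹ ∈
          braidGrp (gen hR) (2 * a + 1) (2 * (c₁ ++ x :: y :: c₂).length) :=
        mul_mem (inv_mem (gen_mem (by omega) (by omega))) (inv_mem (gen_mem (by omega) (by omega)))
      have h2 := mul_mem (braidGrp_mono (Nat.zero_le _) le_rfl h1) hg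
      rw [hs.desc_add_two, mul_assoc, mul_assoc, show q + k = 2 * c₁.length by omega] at H
      have H' := H.turn hR (turn_twist hR c₁ c₂ x y) (mul_mem (hd (by omega)) (by
        rwa [show q + k = 2 * c₁.length by omega] at h2))
      obtain ⟨c', hc', h, hh, H''⟩ := ih k (by omega) (c := c₁ ++ y :: x :: c₂) (by omega) (by omega)
        (by rwa [show q + k = 2 * c₁.length by omega, ← hlen] at h2) H'
        (by rw [hlen]; exact hd)
      rw [hlen] at hh hc'
      refine ⟨c', hc', _, mul_mem hh h1, ?_⟩
      rw [show q + k = 2 * c₁.length by omega]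
      simpa only [mul_assoc] using H''
    · obtain ⟨k, rfl⟩ : ∃ j, k = j + 1 := ⟨k - 1, by omega⟩
      obtain ⟨c₁, x, c₂, rfl, hc₁⟩ := exists_eq_append_cons (c := c) (i := i) (by omega)
      have hlen : (c₁ ++ (x.1, !x.2) :: c₂).length = (c₁ ++ x :: c₂).length := by simp
      rw [desc, mul_assoc, show q + k = 2 * c₁.length by omega] at H
      have H' := H.turn hR (turn_flip hR c₁ c₂ x) (mul_mem (hd (by omega)) hg)
      obtain ⟨c', hc', h, hh, H''⟩ := ih k (by omega) (c := c₁ ++ (x.1, !x.2) :: c₂) (by omega)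
        (by omega) (by rwa [hlen]) H' (by rw [hlen]; exact hd)
      rw [hlen] at hh hc'
      exact ⟨c', hc', h, hh, H''⟩

/-! ### Merging two minima -/

/-- Chords that avoid the two legs are lifted from chords below the minimum, where the legs do not
exist. -/
theorem exists_below {N p : ℕ} (hp : p ≤ N) (i : Fin n) (s : Bool) {x : (CrossMonoid R)ˣ}
    (hx : x ∈ chordGrp (gen hR) {z | z < N + 2 ∧ z ≠ p ∧ z ≠ p + 1}) :
    ∃ y ∈ chordGrp (gen hR) (Set.Iio N),
      (y, x) ∈ passGrp hR [(p, .cup i s)] N (N + 2) (maps_cup p i s N) := by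
  induction hx using Subgroup.closure_induction with
  | mem x hx =>
    obtain ⟨z, t, hz, ht, h, rfl⟩ := hx
    have hl : ∀ z, z < N + 2 ∧ z ≠ p ∧ z ≠ p + 1 → ∃ z' < N, lift p z' = z := by
      rintro z ⟨h1, h2, h3⟩
      by_cases h4 : z < p
      · exact ⟨z, by omega, by simp [lift, h4]⟩
      · exact ⟨z - 2, by omega, by simp only [lift]; split_ifs <;> omega⟩
    obtain ⟨z', hz', rfl⟩ := hl z hz
    obtain ⟨t', ht', rfl⟩ := hl t ht
    have h' : z' ≠ t' := fun h0 => h (by rw [h0])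
    exact ⟨_, chord_mem hz' ht' h', passGrp_cup_chord hR i s hs h' hz' ht' hp⟩
  | one => exact ⟨1, one_mem _, one_mem _⟩
  | mul x y _ _ hx hy =>
    obtain ⟨a, ha, ha'⟩ := hx
    obtain ⟨b, hb, hb'⟩ := hy
    exact ⟨a * b, mul_mem ha hb, mul_mem ha' hb'⟩
  | inv x _ hx =>
    obtain ⟨a, ha, ha'⟩ := hx
    exact ⟨a⁻¹, inv_mem ha, inv_mem ha'⟩

omit hs in
theorem exists_above {N p : ℕ} {x : (CrossMonoid R)ˣ} (hx : x ∈ braidGrp (gen hR) (p + 2) (N + 2)) :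
    ∃ y ∈ braidGrp (gen hR) p N, (x, y) ∈ passGrp hR [(p, .cap)] (N + 2) N (maps_cap p N) := by
  induction hx using Subgroup.closure_induction with
  | mem x hx =>
    obtain ⟨j, h1, h2, rfl⟩ := hx
    obtain ⟨j, rfl⟩ : ∃ k, j = k + 2 := ⟨j - 2, by omega⟩
    exact ⟨_, gen_mem (by omega) (by omega), passGrp_cap_of_le hR (by omega) (by omega)⟩
  | one => exact ⟨1, one_mem _, one_mem _⟩
  | mul x y _ _ hx hy =>
    obtain ⟨a, ha, ha'⟩ := hx
    obtain ⟨b, hb, hb'⟩ := hy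
    exact ⟨a * b, mul_mem ha hb, mul_mem ha' hb'⟩
  | inv x _ hx =>
    obtain ⟨a, ha, ha'⟩ := hx
    exact ⟨a⁻¹, inv_mem ha, inv_mem ha'⟩

/-- Write `(z, y)` for a chord. The minimum number `t` makes `(2t, 2t+1)` and the products `(2t,
y)(2t+1, y)` removable. The braid leads the strands `2t` and `2t+2` to the maximum number `t`, so
`(2t, 2t+2)` and the products `(2t+2, y)(2t, y)` are removable as well. Hence every chord at `2t`,
and then every chord at `2t+1`, can be replaced by the inverse of a chord elsewhere or dropped,
until only chords avoiding both legs are left. -/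
theorem Rep.avoid {t : ℕ} (ht : t + 2 ≤ c.length)
    (hg : g ∈ braidGrp (gen hR) (2 * t + 2) (2 * c.length)) {x : (CrossMonoid R)ˣ}
    (hx : x ∈ chordGrp (gen hR) (Set.Iio (2 * c.length)))
    (H : Rep hR w c (x * (gen hR (2 * t + 1) * g))) :
    ∃ x' ∈ chordGrp (gen hR) {z | z < 2 * c.length ∧ z ≠ 2 * t ∧ z ≠ 2 * t + 1},
      Rep hR w c (x' * (gen hR (2 * t + 1) * g)) := by
  set N := 2 * c.length with hN
  refine Rep.of_idle hR hs (fun z hz => hz.1) hx H ?_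
  set g₀ := gen hR (2 * t + 1) * g
  set A := chordGrp (gen hR) {z | z < N ∧ z ≠ 2 * t ∧ z ≠ 2 * t + 1}
  obtain ⟨π, hπ1, hπ2, hπ3⟩ := hs.exists_perm hg
  have hconj : ∀ z u, z ≠ u → g₀⁻¹ * chord (gen hR) z u * g₀ =
      chord (gen hR) (π (Equiv.swap (2 * t + 1) (2 * t + 2) z))
        (π (Equiv.swap (2 * t + 1) (2 * t + 2) u)) := by
    intro z u h
    rw [mul_assoc, inv_mul_eq_iff_eq_mul, ← mul_assoc, hs.chord_mul h, mul_assoc,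
      hπ3 _ _ (by simpa using h), mul_assoc]
  have h2t : π (Equiv.swap (2 * t + 1) (2 * t + 2) (2 * t)) = 2 * t := by
    rw [Equiv.swap_apply_of_ne_of_ne (by omega) (by omega), hπ1 _ (by omega)]
  have h2t2 : π (Equiv.swap (2 * t + 1) (2 * t + 2) (2 * t + 2)) = 2 * t + 1 := by
    rw [Equiv.swap_apply_right, hπ1 _ (by omega)]
  have hlt : ∀ y < N, π (Equiv.swap (2 * t + 1) (2 * t + 2) y) < N := by
    intro y hy
    by_contra h
    have h1 := π.injective (hπ2 _ (not_lt.1 h))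
    rw [h1] at h
    simp only [Equiv.swap_apply_def] at h
    split_ifs at h <;> omega
  have mem : ∀ {z u}, z < N → u < N → z ≠ u → chord (gen hR) z u ∈ chordGrp (gen hR) (Set.Iio N) :=
    fun h1 h2 h => chord_mem h1 h2 h
  have K1 : chord (gen hR) (2 * t) (2 * t + 1) ∈ idle hR w c g₀ :=
    idle_of_cups hR hs (mem (by omega) (by omega) (by omega)) (pass_cups_self hR (by omega))
  have K2 : ∀ y, y < N → y ≠ 2 * t → y ≠ 2 * t + 1 →
      chord (gen hR) (2 * t) y * chord (gen hR) (2 * t + 1) y ∈ idle hR w c g₀ := fun y h1 h2 h3 =>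
    idle_of_cups hR hs (mul_mem (mem (by omega) (by omega) (by omega))
      (mem (by omega) (by omega) (by omega))) (pass_cups_both hR hs (by omega) (by omega) h2 h3)
  have K3 : chord (gen hR) (2 * t) (2 * t + 2) ∈ idle hR w c g₀ := by
    refine idle_of_caps hR (mem (by omega) (by omega) (by omega)) ?_
    rw [hconj _ _ (by omega), h2t, h2t2]
    exact pass_caps_self hR (by omega)
  have K4 : ∀ y, y < N → y ≠ 2 * t → y ≠ 2 * t + 2 →
      chord (gen hR) (2 * t + 2) y * chord (gen hR) (2 * t) y ∈ idle hR w c g₀ := by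
    intro y h1 h2 h3
    rw [(hs.chord_commute h3.symm h2.symm).eq]
    refine idle_of_caps hR (mul_mem (mem (by omega) (by omega) (by omega))
      (mem (by omega) (by omega) (by omega))) ?_
    rw [show g₀⁻¹ * (chord (gen hR) (2 * t) y * chord (gen hR) (2 * t + 2) y) * g₀ =
      (g₀⁻¹ * chord (gen hR) (2 * t) y * g₀) * (g₀⁻¹ * chord (gen hR) (2 * t + 2) y * g₀) by group,
      hconj _ _ h2.symm, hconj _ _ h3.symm, h2t, h2t2]
    refine pass_caps_both hR hs (by omega) (hlt y h1) ?_ ?_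
    · intro h0
      exact h2 ((Equiv.swap _ _).injective (π.injective (h0.trans h2t.symm)))
    · intro h0
      exact h3 ((Equiv.swap _ _).injective (π.injective (h0.trans h2t2.symm)))
  have I : idle hR w c g₀ ≤ A ⊔ idle hR w c g₀ := le_sup_right
  have key : ∀ y, y < N → y ≠ 2 * t → y ≠ 2 * t + 1 →
      chord (gen hR) (2 * t) y ∈ A ⊔ idle hR w c g₀ ∧
      chord (gen hR) (2 * t + 1) y ∈ A ⊔ idle hR w c g₀ := by
    intro y h1 h2 h3
    have h4 : chord (gen hR) (2 * t) y ∈ A ⊔ idle hR w c g₀ := by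
      by_cases h5 : y = 2 * t + 2
      · exact h5 ▸ I K3
      · refine idle_cancel (I (K4 y h1 h2 h5)) (le_sup_left (a := A) (chord_mem ?_ ?_ (Ne.symm h5)))
        · exact ⟨by omega, by omega, by omega⟩
        · exact ⟨h1, h2, h3⟩
    exact ⟨h4, idle_cancel (I (K2 y h1 h2 h3)) h4⟩
  intro z u hz hu hzu
  by_cases h1 : z = 2 * t
  · subst h1
    by_cases h2 : u = 2 * t + 1
    · exact h2 ▸ I K1
    · exact (key u hu hzu.symm h2).1
  by_cases h2 : z = 2 * t + 1
  · subst h2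
    by_cases h3 : u = 2 * t
    · rw [h3, chord_comm]
      exact I K1
    · exact (key u hu h3 hzu.symm).2
  by_cases h3 : u = 2 * t
  · rw [chord_comm]
    exact h3 ▸ (key z hz h1 h2).1
  by_cases h4 : u = 2 * t + 1
  · rw [chord_comm]
    exact h4 ▸ (key z hz h1 h2).2
  exact le_sup_left (a := A) (chord_mem ⟨hz, h1, h2⟩ ⟨hu, h3, h4⟩ hzu)

/-- Chords avoiding the legs of the minimum number `t` pass below it, and `g` passes above the
maximum number `t`. Between this minimum and this maximum a single crossing remains, which makes a
curl; R1 removes all three. -/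
theorem Rep.merge {t : ℕ} (hrun : run w [] ≠ none) (ht : t + 2 ≤ c.length)
    (hg : g ∈ braidGrp (gen hR) (2 * t + 2) (2 * c.length)) {x : (CrossMonoid R)ˣ}
    (hx : x ∈ chordGrp (gen hR) (Set.Iio (2 * c.length)))
    (H : Rep hR w c (gen hR (2 * t + 1) * g * x)) :
    ∃ c', c'.length + 1 = c.length ∧ ∃ g' ∈ braidGrp (gen hR) (2 * t) (2 * c'.length),
      ∃ x' ∈ chordGrp (gen hR) (Set.Iio (2 * c'.length)), Rep hR w c' (g' * x') := by
  set g₀ := gen hR (2 * t + 1) * g with hg₀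
  have hg₀m : g₀ ∈ braidGrp (gen hR) 0 (2 * c.length) :=
    mul_mem (gen_mem (by omega) (by omega)) (braidGrp_mono (Nat.zero_le _) le_rfl hg)
  rw [show g₀ * x = (g₀ * x * g₀⁻¹) * g₀ by group] at H
  obtain ⟨x₁, hx₁, H⟩ := Rep.avoid hR hs ht hg (hs.conj_mem' hg₀m hx) H
  obtain ⟨c₁, y, c₂, rfl, hc₁⟩ := exists_eq_append_cons (c := c) (i := t) (by omega)
  have hlen : (c₁ ++ c₂).length + 1 = (c₁ ++ y :: c₂).length := by simp; omega
  obtain ⟨N, hN⟩ : ∃ N, N = 2 * (c₁ ++ c₂).length := ⟨_, rfl⟩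
  have hN2 : 2 * (c₁ ++ y :: c₂).length = N + 2 := by omega
  have hNt : 2 * t + 2 ≤ N := by omega
  rw [hN2] at hg hx₁
  obtain ⟨x₂, hx₂, hpx⟩ := exists_below hR hs (p := 2 * t) (by omega) y.1 y.2 hx₁
  obtain ⟨g₂, hg₂, hpg⟩ := exists_above hR hg
  have hx₁m : x₁ ∈ braidGrp (gen hR) 0 (N + 2) :=
    chordGrp_le_braidGrp _ (chordGrp_mono (fun z hz => hz.1) hx₁)
  obtain ⟨b₁, hb₁, rfl⟩ := (mem_braidGrp_zero hR).1 hx₁m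
  obtain ⟨b₂, hb₂, rfl⟩ := (mem_braidGrp_zero hR).1 (chordGrp_le_braidGrp _ hx₂)
  obtain ⟨d, hd, rfl⟩ := (mem_braidGrp_zero hR).1 (braidGrp_mono (Nat.zero_le _) le_rfl hg)
  obtain ⟨d₂, hd₂, rfl⟩ := (mem_braidGrp_zero hR).1 (braidGrp_mono (Nat.zero_le _) le_rfl hg₂)
  have hw1 : Wide [(2 * t + 1, true)] (N + 2) := by simp [Wide]; omega
  have e0 := H.eqv hR (b := b₁ ++ ([(2 * t + 1, true)] ++ d))
    (hN2 ▸ hb₁.append (hw1.append hd)) (by rw [val_append, val_append]; simp [val])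
  rw [bw_append, bw_append, ← hlen] at e0
  have hm : Maps (cups (c₁ ++ c₂)) 0 N := maps_cups hN
  have e1 := ((cups_insert hR c₁ c₂ y).append_right (bw b₁ ++ (bw [(2 * t + 1, true)] ++ bw d) ++
    caps ((c₁ ++ c₂).length + 1))) []
  have e2 := ((caps_insert hR (n := n) (t := t) (m := (c₁ ++ c₂).length) (by omega)).append_left
    (cups (c₁ ++ c₂) ++ [(2 * c₁.length, .cup y.1 y.2)] ++ bw b₁ ++ bw [(2 * t + 1, true)] ++ bw d)) []
  rw [hc₁] at e1 e2
  have e3 : Eqv R [] (cups (c₁ ++ c₂) ++ ([(2 * t, .cup y.1 y.2)] ++ bw b₁))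
      (cups (c₁ ++ c₂) ++ (bw b₂ ++ [(2 * t, .cup y.1 y.2)])) :=
    .append_left fun m hm' => (Passes.eqv hR (maps_cup _ _ _ _) hpx hb₂ hb₁ rfl rfl
      (hm _ _ rfl hm')).symm
  have e4 : Eqv R [] ((cups (c₁ ++ c₂) ++ [(2 * t, .cup y.1 y.2)] ++ bw b₁ ++
      bw [(2 * t + 1, true)]) ++ (bw d ++ [(2 * t, .cap)]))
      ((cups (c₁ ++ c₂) ++ [(2 * t, .cup y.1 y.2)] ++ bw b₁ ++
      bw [(2 * t + 1, true)]) ++ ([(2 * t, .cap)] ++ bw d₂)) :=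
    .append_left fun m hm' => Passes.eqv hR (maps_cap _ _) hpg hd hd₂ rfl rfl
      ((((hm.append (maps_cup _ _ _ _)).append hb₁.maps).append hw1.maps) _ _ rfl hm')
  have e3' := e3.append_right (bw [(2 * t + 1, true)] ++ [(2 * t, .cap)] ++ bw d₂ ++
    caps (c₁ ++ c₂).length)
  have e4' := e4.append_right (caps (c₁ ++ c₂).length)
  simp only [List.append_assoc] at e0 e1 e2 e3' e4'
  have e5 := e0.trans (e1.trans (e2.trans (e4'.trans e3')))
  have e6 : Eqv R [] ((cups (c₁ ++ c₂) ++ bw b₂) ++ [(2 * t, .cup y.1 y.2), X (2 * t + 1) (.cl true),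
      (2 * t, .cap)] ++ (bw d₂ ++ caps (c₁ ++ c₂).length))
      ((cups (c₁ ++ c₂) ++ bw b₂) ++ [] ++ (bw d₂ ++ caps (c₁ ++ c₂).length)) := by
    refine Eqv.replace ?_ fun m _ h => kink_eqv hR (.left y.1 y.2) h
    have := e5.1
    simp only [bw, toW, List.map, List.append_assoc, List.cons_append, List.nil_append] at this ⊢
    rwa [← this]
  refine ⟨c₁ ++ c₂, hlen, val hR d₂, hN ▸ hg₂, (val hR d₂)⁻¹ * val hR b₂ * val hR d₂,
    hN ▸ hs.conj_mem ((mem_braidGrp_zero hR).2 ⟨d₂, hd₂, rfl⟩) hx₂, b₂ ++ d₂,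
    hN ▸ hb₂.append hd₂, ?_, ?_⟩
  · rw [val_append]; group
  · rw [bw_append]
    refine e5.trans ?_
    simpa [bw, toW] using e6

/-- A closed word can be transformed into a plat whose braid is a product of chords. -/
theorem Rep.reduce {k t : ℕ} (hrun : run w [] ≠ none) (hc : c.length = t + k)
    (hg : g ∈ braidGrp (gen hR) (2 * t) (2 * c.length)) {x : (CrossMonoid R)ˣ}
    (hx : x ∈ chordGrp (gen hR) (Set.Iio (2 * c.length))) (H : Rep hR w c (g * x)) :
    ∃ c', ∃ x' ∈ chordGrp (gen hR) (Set.Iio (2 * c'.length)), Rep hR w c' x' := by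
  induction k generalizing t c g x with
  | zero =>
    rw [braidGrp_eq_bot (by omega), Subgroup.mem_bot] at hg
    rw [hg, one_mul] at H
    exact ⟨c, x, hx, H⟩
  | succ k ih =>
    -- The number `k` counts the minima not yet treated. The leg which arrives at the position `2 *
    -- t` is split off and becomes the left leg of the minimum number `t`.
    obtain ⟨k₁, hk₁, g₁, hg₁, y, hy, rfl⟩ := hs.decomp (by omega) hg
    have z0 : ∀ {q N} {g : (CrossMonoid R)ˣ}, g ∈ braidGrp (gen hR) q N → g ∈ braidGrp (gen hR) 0 N :=
      fun h => braidGrp_mono (Nat.zero_le _) le_rfl h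
    have c0 : ∀ {x N}, x ∈ chordGrp (gen hR) (Set.Iio N) → x ∈ braidGrp (gen hR) 0 N :=
      fun h => chordGrp_le_braidGrp _ h
    rw [mul_assoc, mul_assoc] at H
    obtain ⟨c₁, hc₁, h, hh, H₁⟩ := Rep.strip hR hs (a := t) le_rfl (by omega) hk₁
      (mul_mem (z0 hg₁) (c0 (mul_mem hy hx))) H
    rw [Nat.sub_self, desc, one_mul, ← mul_assoc] at H₁
    rw [← hc₁] at hg₁ hh hx hy
    have hyx : y * x ∈ chordGrp (gen hR) (Set.Iio (2 * c₁.length)) := mul_mem hy hx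
    -- Likewise for the position `2 * t + 1`. If the right leg of the same minimum arrives there,
    -- this minimum faces its maximum and is finished; otherwise the arriving leg is made the left
    -- leg of the next minimum, and the two minima are merged.
    obtain ⟨k₂, hk₂, g₂, hg₂, y₂, hy₂, hd⟩ := hs.decomp (by omega) (mul_mem hh hg₁)
    rw [hd] at H₁
    rcases Nat.eq_zero_or_pos k₂ with rfl | hk0
    · rw [desc, one_mul, mul_assoc] at H₁
      have hxm : y₂ * (y * x) ∈ chordGrp (gen hR) (Set.Iio (2 * c₁.length)) := mul_mem hy₂ hyx
      exact ih (t := t + 1) (c := c₁) (g := g₂) (by omega) hg₂ hxm H₁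
    · rw [mul_assoc, mul_assoc] at H₁
      obtain ⟨c₂, hc₂, h₂, hh₂, H₂⟩ := Rep.strip hR hs (a := t + 1) (by omega) (by omega) hk₂
        (mul_mem (z0 hg₂) (c0 (mul_mem hy₂ hyx))) H₁
      rw [show 2 * (t + 1) - (2 * t + 1) = 1 by omega] at H₂
      simp only [desc, Nat.add_zero, mul_one] at H₂
      rw [← hc₂] at hh₂ hg₂ hyx hy₂ hk₂
      have hgm : h₂ * g₂ ∈ braidGrp (gen hR) (2 * t + 2) (2 * c₂.length) :=
        mul_mem (braidGrp_mono (by omega) le_rfl hh₂) hg₂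
      have hxm : y₂ * (y * x) ∈ chordGrp (gen hR) (Set.Iio (2 * c₂.length)) :=
        mul_mem hy₂ hyx
      rw [← mul_assoc, mul_assoc (gen hR (2 * t + 1)) h₂ g₂] at H₂
      obtain ⟨c₃, hc₃, g₃, hg₃, x₃, hx₃, H₃⟩ := Rep.merge hR hs hrun (by omega) hgm hxm H₂
      exact ih (t := t) (c := c₃) (g := g₃) (by omega) hg₃ hx₃ H₃

end Reduce

/-! ### IsPure braid words -/

/-- A word for the pure braid in which the strands `z` and `z + d + 1` are clasped. -/
def claspWord (z : ℕ) : ℕ → List (ℕ × Bool)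
  | 0 => [(z, true), (z, true)]
  | d + 1 => [(z + d + 1, false)] ++ claspWord z d ++ [(z + d + 1, true)]

/-- The braid word `b` does not permute the strands of levels of length `N`. -/
def IsPure (b : List (ℕ × Bool)) (N : ℕ) : Prop :=
  Wide b N ∧ ∀ {m : ℕ} (l : Level m), l.length = N → run (bw b) l = some l

theorem IsPure.append {b c : List (ℕ × Bool)} {N : ℕ} (hb : IsPure b N) (hc : IsPure c N) :
    IsPure (b ++ c) N :=
  ⟨hb.1.append hc.1, fun l hl => by rw [bw_append, run_append, hb.2 l hl]; exact hc.2 l hl⟩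

section Words

variable {n : ℕ}

theorem act_cross_append (a r : Level n) (x y : Fin n × Bool) (k : Kind) :
    act (X a.length k) (a ++ x :: y :: r) = some (a ++ y :: x :: r) := by
  simpa [X] using act_of_loc (.cross k x y) a r

theorem weight_cross_append {A : Type*} [AddCommGroup A] (φ : Bool → Fin n × Bool → Fin n × Bool → A)
    (a r : Level n) (x y : Fin n × Bool) (k : Bool) :
    weight φ (X a.length (.cl k)) (a ++ x :: y :: r) = φ k x y := by
  simp [weight, X]

theorem run_claspWord (a m r : Level n) (x y : Fin n × Bool) :
    run (bw (claspWord a.length m.length)) (a ++ x :: m ++ y :: r) = some (a ++ x :: m ++ y :: r) := by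
  induction m using List.reverseRecOn generalizing y r with
  | nil =>
    change run [X a.length (.cl true), X a.length (.cl true)] _ = _
    rw [run_cons]
    simp [act_cross_append, run_singleton]
  | append_singleton m u ih =>
    have h1 := act_cross_append (a ++ x :: m) r u y (.cl false)
    have h2 := act_cross_append (a ++ x :: m) r y u (.cl true)
    rw [show (a ++ x :: m).length = a.length + m.length + 1 by simp; omega] at h1 h2
    rw [List.length_append, List.length_singleton, claspWord, bw_append, bw_append, run_append,
      run_append]
    change ((run [X (a.length + m.length + 1) (.cl false)] _).bind _).bind
      (run [X (a.length + m.length + 1) (.cl true)]) = _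
    rw [run_singleton, show a ++ x :: (m ++ [u]) ++ y :: r = a ++ x :: m ++ u :: y :: r by simp,
      h1, Option.bind_some, ih, Option.bind_some, run_singleton, h2]

theorem total_claspWord {A : Type*} [AddCommGroup A] {φ : Bool → Fin n × Bool → Fin n × Bool → A}
    (hφ : IsWeight φ) (a m r : Level n) (x y : Fin n × Bool) :
    total φ (bw (claspWord a.length m.length)) (a ++ x :: m ++ y :: r) = φ true x y + φ true y x := by
  induction m using List.reverseRecOn generalizing y r with
  | nil =>
    change total φ [X a.length (.cl true), X a.length (.cl true)] _ = _
    simp only [total, List.append_assoc, List.cons_append, List.nil_append, act_cross_append,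
      weight_cross_append, Option.elim_some]
    simp
  | append_singleton m u ih =>
    have h1 := act_cross_append (a ++ x :: m) r u y (.cl false)
    have h2 := act_cross_append (a ++ x :: m) r y u (.cl true)
    have h3 := weight_cross_append φ (a ++ x :: m) r u y false
    have h4 := weight_cross_append φ (a ++ x :: m) r y u true
    rw [show (a ++ x :: m).length = a.length + m.length + 1 by simp; omega] at h1 h2 h3 h4
    rw [List.length_append, List.length_singleton, claspWord, bw_append, bw_append,
      show a ++ x :: (m ++ [u]) ++ y :: r = a ++ x :: m ++ u :: y :: r by simp]
    change total φ ([X (a.length + m.length + 1) (.cl false)] ++ _ ++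
      [X (a.length + m.length + 1) (.cl true)]) _ = _
    rw [List.append_assoc, total_append φ (k := a ++ x :: m ++ y :: u :: r)
      (by rw [run_singleton, h1]), total_append φ (run_claspWord a m (u :: r) x y), ih]
    simp only [total, h1, h2, h3, h4, Option.elim_some, add_zero]
    rw [add_comm, add_assoc, add_comm (φ true y u), ← Bool.not_false, hφ.inv, add_zero]

theorem exists_two_split {l : Level n} {z d : ℕ} (h : z + d + 1 < l.length) :
    ∃ a x m y r, l = a ++ x :: m ++ y :: r ∧ a.length = z ∧ m.length = d := by
  obtain ⟨a, x, t, rfl, ha⟩ := exists_eq_append_cons (c := l) (i := z) (by omega)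
  obtain ⟨m, y, r, rfl, hm⟩ := exists_eq_append_cons (c := t) (i := d)
    (by simp at h; omega)
  exact ⟨a, x, m, y, r, by simp, ha, hm⟩

end Words

theorem wide_claspWord {z d N : ℕ} (h : z + d + 1 < N) : Wide (claspWord z d) N := by
  induction d with
  | zero => simp [Wide, claspWord]; omega
  | succ d ih =>
    have h1 : ∀ s, Wide [(z + d + 1, s)] N := fun s => by simp [Wide]; omega
    exact ((h1 _).append (ih (by omega))).append (h1 _)

theorem pure_claspWord {z d N : ℕ} (h : z + d + 1 < N) : IsPure (claspWord z d) N := by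
  refine ⟨wide_claspWord h, fun l hl => ?_⟩
  obtain ⟨a, x, m, y, r, rfl, rfl, rfl⟩ := exists_two_split (l := l) (z := z) (d := d) (by omega)
  exact run_claspWord a m r x y

theorem run_cross_cross {n : ℕ} {p : ℕ} (k k' : Kind) {l : Level n} (h : p + 2 ≤ l.length) :
    run [X p k, X p k'] l = some l := by
  obtain ⟨a, x, m, y, r, rfl, rfl, hm⟩ := exists_two_split (l := l) (z := p) (d := 0) (by omega)
  obtain rfl := List.length_eq_zero_iff.1 hm
  rw [run_cons]
  simp [act_cross_append, run_singleton]

theorem run_binv {n : ℕ} {b : List (ℕ × Bool)} {N : ℕ} (hb : Wide b N) {l : Level n}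
    (hl : l.length = N) : run (bw (b ++ binv b)) l = some l := by
  induction b generalizing l with
  | nil => rfl
  | cons x b ih =>
    have e : x :: b ++ binv (x :: b) = [x] ++ ((b ++ binv b) ++ [(x.1, !x.2)]) := by simp [binv]
    have hx : Wide [x] N := fun y hy => hb y (by simp at hy; simp [hy])
    obtain ⟨k, hk, hk'⟩ := hx.run hl
    rw [e, bw_append, run_append, hk, Option.bind_some, bw_append, run_append,
      ih (fun y hy => hb y (by simp [hy])) hk', Option.bind_some]
    have := run_cross_cross (.cl x.2) (.cl !x.2) (l := l) (p := x.1) (hl ▸ hb x (by simp))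
    rw [run_cons] at this
    change run [X x.1 (.cl x.2)] l = _ at hk
    rw [run_singleton] at hk
    rwa [hk, Option.bind_some] at this

theorem IsPure.binv {b : List (ℕ × Bool)} {N : ℕ} (hb : IsPure b N) : IsPure (binv b) N := by
  refine ⟨hb.1.binv, fun l hl => ?_⟩
  have := run_binv hb.1 hl
  rwa [bw_append, run_append, hb.2 l hl] at this

theorem total_binv {n : ℕ} {A : Type*} [AddCommGroup A]
    {φ : Bool → Fin n × Bool → Fin n × Bool → A} (hφ : IsWeight φ) {b : List (ℕ × Bool)} {N : ℕ}
    (hb : Wide b N) {l : Level n} (hl : l.length = N) :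
    total φ (bw (b ++ binv b)) l = 0 := by
  induction b generalizing l with
  | nil => rfl
  | cons x b ih =>
    have e : x :: b ++ binv (x :: b) = [x] ++ ((b ++ binv b) ++ [(x.1, !x.2)]) := by simp [binv]
    have hx : Wide [x] N := fun y hy => hb y (by simp at hy; simp [hy])
    have hb' : Wide b N := fun y hy => hb y (by simp [hy])
    obtain ⟨a, u, m, v, r, rfl, ha, hm⟩ := exists_two_split (l := l) (z := x.1) (d := 0)
      (by have := hb x (by simp); omega)
    obtain rfl := List.length_eq_zero_iff.1 hm
    obtain ⟨p, s⟩ := x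
    obtain rfl : a.length = p := ha
    rw [show a ++ [u] ++ v :: r = a ++ u :: v :: r by simp] at hl ⊢
    have hrun : run (bw [(a.length, s)]) (a ++ u :: v :: r) = some (a ++ v :: u :: r) := by
      change run [X a.length (.cl s)] _ = _
      rw [run_singleton, act_cross_append]
    have hl' : (a ++ v :: u :: r).length = N := by rw [← hl]; simp
    rw [e, bw_append, total_append φ hrun, bw_append, total_append φ (run_binv hb' hl'),
      ih hb' hl', zero_add]
    change total φ [X a.length (.cl s)] _ + total φ [X a.length (.cl !s)] _ = 0
    simp only [total, weight_cross_append, act_cross_append, Option.elim_some, add_zero]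
    exact hφ.inv s u v

/-! ### Degrees of products of chords -/

section Chords

variable {n : ℕ} {R : Move n} (hR : Base R)

theorem val_claspWord (z d : ℕ) : val hR (claspWord z d) = clasp (gen hR) z d := by
  induction d with
  | zero => simp [val, claspWord, clasp]
  | succ d ih =>
    rw [claspWord, val_append, val_append, ih]
    simp [val, clasp]

/-- There is a pure word for `x` whose total weights are given by `e`. -/
def HasDegree {A ι : Type*} [AddCommGroup A] (φ : ι → Bool → Fin n × Bool → Fin n × Bool → A)
    (l : Level n) (x : (CrossMonoid R)ˣ) (e : ι → A) : Prop :=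
  ∃ b, IsPure b l.length ∧ val hR b = x ∧ ∀ i, total (φ i) (bw b) l = e i

variable {A ι : Type*} [AddCommGroup A] {φ : ι → Bool → Fin n × Bool → Fin n × Bool → A}
  {l : Level n} {x y : (CrossMonoid R)ˣ} {e e' : ι → A}

theorem hasDegree_one : HasDegree hR φ l 1 0 :=
  ⟨[], ⟨by simp [Wide], fun _ _ => rfl⟩, rfl, fun _ => rfl⟩

theorem HasDegree.mul (hx : HasDegree hR φ l x e) (hy : HasDegree hR φ l y e') :
    HasDegree hR φ l (x * y) (e + e') := by
  obtain ⟨b, hb, rfl, he⟩ := hx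
  obtain ⟨c, hc, rfl, he'⟩ := hy
  refine ⟨b ++ c, hb.append hc, val_append hR b c, fun i => ?_⟩
  rw [bw_append, total_append _ (hb.2 l rfl), he, he']
  rfl

theorem HasDegree.inv (hφ : ∀ i, IsWeight (φ i)) (hx : HasDegree hR φ l x e) :
    HasDegree hR φ l x⁻¹ (-e) := by
  obtain ⟨b, hb, rfl, he⟩ := hx
  refine ⟨binv b, hb.binv, val_binv hR b, fun i => ?_⟩
  have := total_binv (hφ i) hb.1 rfl (l := l)
  rw [bw_append, total_append _ (hb.2 l rfl), he, add_comm] at this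
  exact eq_neg_of_add_eq_zero_left this

theorem hasDegree_chord (hφ : ∀ i, IsWeight (φ i)) {z t : ℕ} (hzt : z ≠ t) (hz : z < l.length)
    (ht : t < l.length) : HasDegree hR φ l (chord (gen hR) z t) fun i =>
      φ i true (l.get ⟨z, hz⟩) (l.get ⟨t, ht⟩) + φ i true (l.get ⟨t, ht⟩) (l.get ⟨z, hz⟩) := by
  wlog h : z < t generalizing z t
  · rw [chord_comm]
    have := this hzt.symm ht hz (by omega)
    simpa only [add_comm] using this
  obtain ⟨d, rfl⟩ : ∃ d, t = z + d + 1 := ⟨t - z - 1, by omega⟩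
  refine ⟨claspWord z d, pure_claspWord ht, by rw [val_claspWord, chord_add], fun i => ?_⟩
  obtain ⟨a, x, m, y, r, rfl, rfl, rfl⟩ := exists_two_split ht
  rw [total_claspWord (hφ i)]
  have e1 : (a ++ x :: m ++ y :: r).get ⟨a.length, hz⟩ = x := by simp
  have e2 : (a ++ x :: m ++ y :: r).get ⟨a.length + m.length + 1, ht⟩ = y := by
    simp only [List.get_eq_getElem]
    rw [List.getElem_append_right (by simp; omega)]
    simp
  rw [e1, e2]

end Chords

/-! ### Standard plats -/

section Standard

variable {n : ℕ} {R : Move n}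

theorem IsLink.of_eqv (hL : ∀ u v, R u v → BiLifts u v) {w w' : Word n} (hw : IsLink w)
    (h : Eqv R [] w w') : IsLink w' := by
  have key : ∀ w w', Relation.EqvGen (Step R []) w w' → (IsLink w ↔ IsLink w') := by
    intro w w' h
    induction h with
    | rel x y h => exact isLink_iff_of_performs hL h
    | refl x => rfl
    | symm x y _ ih => exact ih.symm
    | trans x y z _ _ h1 h2 => exact h1.trans h2
  exact (key w w' (h.2 (by rw [hw.1]; simp))).1 hw

theorem run_caps_cupLevel (c : List (Fin n × Bool)) : run (caps c.length) (cupLevel c) = some [] := by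
  induction c with
  | nil => rfl
  | cons x c ih =>
    rw [List.length_cons, caps_succ, run_append, run_singleton]
    simpa [act, cupLevel] using ih

theorem hasCup_cups {c : List (Fin n × Bool)} {j : Fin n} :
    HasCup (cups c) j ↔ j ∈ c.map Prod.fst := by
  induction c with
  | nil => simp [HasCup, cups]
  | cons x c ih =>
    rw [cups, hasCup_append, ih, List.map_cons, List.mem_cons, or_comm]
    simp [HasCup, eq_comm]

theorem not_hasCup_caps (m : ℕ) (j : Fin n) : ¬ HasCup (caps m) j := by
  rintro ⟨p, s, h⟩
  simp [caps] at h

theorem recolor_cups {m : ℕ} (f : Fin m → Fin n) (c : List (Fin m × Bool)) :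
    recolor f (cups c) = cups (c.map fun x => (f x.1, x.2)) := by
  induction c with
  | nil => rfl
  | cons x c ih => rw [cups, recolor_append, ih]; rfl

theorem recolor_bw {m : ℕ} (f : Fin m → Fin n) (b : List (ℕ × Bool)) :
    recolor f (bw b) = bw b := by
  simp [bw, recolor, toW, X, Piece.recolor]

theorem recolor_caps {m : ℕ} (f : Fin m → Fin n) (k : ℕ) : recolor f (caps k) = caps k := by
  simp [caps, recolor, Piece.recolor]

/-- The minima of a plat with a pure braid lie on different components. -/
theorem perm_finRange_of_isLink {c : List (Fin n × Bool)} {b : List (ℕ × Bool)}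
    (hb : IsPure b (2 * c.length)) (h : IsLink (cups c ++ bw b ++ caps c.length)) :
    (c.map Prod.fst).Perm (List.finRange n) := by
  have hcup : ∀ i, i ∈ c.map Prod.fst := by
    intro i
    have := h.hasCup i
    rw [hasCup_append, hasCup_append, hasCup_cups] at this
    exact (this.resolve_right (not_hasCup_caps _ _)).resolve_right not_hasCup_toW
  have hnd : (c.map Prod.fst).Nodup := by
    -- Give every minimum a label of its own. As the braid is pure, the relabelled plat still closes
    -- up, so it is a lift of the link, and such a lift has one label above each component.
    set d : List (Fin c.length × Bool) := (List.finRange c.length).map fun j => (j, (c.get j).2)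
      with hd
    have hdl : d.length = c.length := by simp [hd]
    have hdc : d.map (fun x => ((c.get x.1).1, x.2)) = c := by
      rw [hd, List.map_map]
      exact List.map_get_finRange c
    have hrel : recolor (fun j => (c.get j).1) (cups d ++ bw b ++ caps c.length) =
        cups c ++ bw b ++ caps c.length := by
      rw [recolor_append, recolor_append, recolor_cups, recolor_bw, recolor_caps, hdc]
    have hrun : run (cups d ++ bw b ++ caps c.length) [] = some [] := by
      rw [List.append_assoc, run_append, run_cups, Option.bind_some, run_append,
        hb.2 _ (by rw [length_cupLevel, hdl]), Option.bind_some]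
      have := run_caps_cupLevel d
      rwa [hdl] at this
    have hcd : ∀ j, HasCup (cups d ++ bw b ++ caps c.length) j := by
      intro j
      rw [hasCup_append, hasCup_append, hasCup_cups]
      exact .inl (.inl (by simp [hd]))
    have hinj : Function.Injective fun j => (c.get j).1 := fun j j' hj =>
      h.monochrome _ _ _ hrel hrun j j' (hcd j) (hcd j') hj
    have : c.map Prod.fst = (List.finRange c.length).map fun j => (c.get j).1 := by
      conv_lhs => rw [← List.map_get_finRange c]
      rw [List.map_map]
      rfl
    rw [this]
    exact (List.nodup_finRange _).map hinj
  exact (List.perm_ext_iff_of_nodup hnd (List.nodup_finRange n)).2 fun i => by simp [hcup i]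

/-- The standard row of minima. -/
def std (n : ℕ) : List (Fin n × Bool) := (List.finRange n).map fun i => (i, true)

theorem length_std (n : ℕ) : (std n).length = n := by simp [std]

variable (hR : Base R) (hs : IsDeltaFamily (gen hR)) {w : Word n} {c c' : List (Fin n × Bool)}
  {x h : (CrossMonoid R)ˣ}

theorem exists_pure {N : ℕ} (hx : x ∈ chordGrp (gen hR) (Set.Iio N)) :
    ∃ b, IsPure b N ∧ val hR b = x := by
  induction hx using Subgroup.closure_induction with
  | mem x hx =>
    obtain ⟨z, t, hz, ht, h, rfl⟩ := hx
    wlog hzt : z < t generalizing z t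
    · rw [chord_comm]; exact this t z ht hz h.symm (by omega)
    obtain ⟨d, rfl⟩ : ∃ d, t = z + d + 1 := ⟨t - z - 1, by omega⟩
    exact ⟨_, pure_claspWord ht, by rw [val_claspWord, chord_add]⟩
  | one => exact ⟨[], ⟨by simp [Wide], fun _ _ => rfl⟩, rfl⟩
  | mul x y _ _ hx hy =>
    obtain ⟨b, hb, rfl⟩ := hx
    obtain ⟨d, hd, rfl⟩ := hy
    exact ⟨b ++ d, hb.append hd, val_append hR b d⟩
  | inv x _ hx =>
    obtain ⟨b, hb, rfl⟩ := hx
    exact ⟨binv b, hb.binv, val_binv hR b⟩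

include hs

/-- The braid `h` is created at the maxima, moved down through `x`, which it conjugates, and
absorbed by the minima. -/
theorem Rep.rearrange (hx : x ∈ chordGrp (gen hR) (Set.Iio (2 * c.length))) (H : Rep hR w c x)
    (ht : Turn hR c h c') (hh : h ∈ braidGrp (gen hR) 0 (2 * c.length))
    (hp : (h, 1) ∈ passGrp hR (caps c.length) (2 * c.length) 0 (maps_caps rfl)) :
    ∃ x' ∈ chordGrp (gen hR) (Set.Iio (2 * c'.length)), Rep hR w c' x' := by
  have hlen := ht.1
  refine ⟨h⁻¹ * x * h, hlen ▸ hs.conj_mem hh hx, ?_⟩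
  have H1 := H.mul_right hR hp
  rw [show x * h = h * (h⁻¹ * x * h) by group] at H1
  exact H1.turn hR ht (mul_mem (mul_mem (inv_mem hh) (chordGrp_le_braidGrp _ hx)) hh)

theorem Rep.perm {p : List (Fin n × Bool)} (hc : c.Perm c')
    (H : ∃ x ∈ chordGrp (gen hR) (Set.Iio (2 * (p ++ c).length)), Rep hR w (p ++ c) x) :
    ∃ x ∈ chordGrp (gen hR) (Set.Iio (2 * (p ++ c').length)), Rep hR w (p ++ c') x := by
  induction hc generalizing p with
  | nil => exact H
  | cons a _ ih =>
    have := ih (p := p ++ [a]) (by simpa using H)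
    simpa using this
  | swap a b l =>
    obtain ⟨x, hx, H⟩ := H
    have hlen : p.length + 1 < (p ++ b :: a :: l).length := by simp
    refine Rep.rearrange hR hs hx H (turn_twist hR p l b a) ?_ (pass_caps_twist hR hlen)
    exact mul_mem (mul_mem (gen_mem (by omega) (by omega)) (gen_mem (by omega) (by omega)))
      (mul_mem (gen_mem (by omega) (by omega)) (gen_mem (by omega) (by omega)))
  | trans _ _ ih1 ih2 => exact ih2 (ih1 H)

theorem Rep.orient {p : List (Fin n × Bool)}
    (H : ∃ x ∈ chordGrp (gen hR) (Set.Iio (2 * (p ++ c).length)), Rep hR w (p ++ c) x) :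
    ∃ x ∈ chordGrp (gen hR) (Set.Iio (2 * (p ++ c.map fun y => (y.1, true)).length)),
      Rep hR w (p ++ c.map fun y => (y.1, true)) x := by
  induction c generalizing p with
  | nil => exact H
  | cons y c ih =>
    obtain ⟨i, s⟩ := y
    have H' : ∃ x ∈ chordGrp (gen hR) (Set.Iio (2 * (p ++ (i, true) :: c).length)),
        Rep hR w (p ++ (i, true) :: c) x := by
      cases s with
      | true => exact H
      | false =>
        obtain ⟨x, hx, H⟩ := H
        have hlen : p.length < (p ++ (i, false) :: c).length := by simp
        exact Rep.rearrange hR hs hx H (turn_flip hR p c (i, false))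
          (gen_mem (by omega) (by omega)) (pass_caps_gen hR hlen)
    have := ih (p := p ++ [(i, true)]) (by simpa using H')
    simpa using this

/-- At each minimum the clasp of its two legs is removable, and a chord at the right leg is inverse
to the corresponding chord at the left leg. Left legs have even positions. -/
theorem Rep.even (hx : x ∈ chordGrp (gen hR) (Set.Iio (2 * c.length))) (H : Rep hR w c x) :
    ∃ x' ∈ chordGrp (gen hR) {z | z < 2 * c.length ∧ Even z}, Rep hR w c x' := by
  have := Rep.of_idle hR hs (S := {z | z < 2 * c.length ∧ Even z}) (g := 1) (fun z hz => hz.1) hx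
    (by simpa using H) ?_
  · simpa using this
  set A := chordGrp (gen hR) {z | z < 2 * c.length ∧ Even z}
  have I : idle hR w c 1 ≤ A ⊔ idle hR w c 1 := le_sup_right
  have mem : ∀ {z u}, z < 2 * c.length → u < 2 * c.length → z ≠ u →
      chord (gen hR) z u ∈ chordGrp (gen hR) (Set.Iio (2 * c.length)) :=
    fun h1 h2 h => chord_mem h1 h2 h
  have K1 : ∀ i, i < c.length → chord (gen hR) (2 * i) (2 * i + 1) ∈ A ⊔ idle hR w c 1 :=
    fun i hi => I (idle_of_cups hR hs (mem (by omega) (by omega) (by omega))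
      (pass_cups_self hR (by omega)))
  have K2 : ∀ i y, i < c.length → y < 2 * c.length → y ≠ 2 * i → y ≠ 2 * i + 1 →
      chord (gen hR) (2 * i) y ∈ A ⊔ idle hR w c 1 →
      chord (gen hR) (2 * i + 1) y ∈ A ⊔ idle hR w c 1 := fun i y h0 h1 h2 h3 h4 =>
    idle_cancel (I (idle_of_cups hR hs (mul_mem (mem (by omega) (by omega) (by omega))
      (mem (by omega) (by omega) (by omega))) (pass_cups_both hR hs (by omega) (by omega) h2 h3))) h4
  have key : ∀ i y, 2 * i < 2 * c.length → y < 2 * c.length → y ≠ 2 * i →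
      chord (gen hR) (2 * i) y ∈ A ⊔ idle hR w c 1 := by
    intro i y h0 h1 h2
    rcases Nat.even_or_odd' y with ⟨j, rfl | rfl⟩
    · exact le_sup_left (a := A) (chord_mem ⟨h0, even_two_mul i⟩ ⟨h1, even_two_mul j⟩ h2.symm)
    · by_cases hij : i = j
      · subst hij; exact K1 i (by omega)
      · rw [chord_comm]
        refine K2 j (2 * i) (by omega) h0 (by omega) (by omega) ?_
        exact le_sup_left (a := A) (chord_mem ⟨by omega, even_two_mul j⟩ ⟨h0, even_two_mul i⟩
          (by omega))
  intro z u hz hu hzu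
  rcases Nat.even_or_odd' z with ⟨i, rfl | rfl⟩
  · exact key i u hz hu hzu.symm
  · by_cases h : u = 2 * i
    · subst h
      rw [chord_comm]
      exact K1 i (by omega)
    · exact K2 i u (by omega) hu h hzu.symm (key i u (by omega) hu h)

/-- Every classical link diagram is equivalent to a standard plat. -/
theorem exists_standard (hL : ∀ u v, R u v → BiLifts u v) (hw : IsLink w)
    (hv : ∀ p, (p, Piece.cross Kind.virt) ∉ w) :
    ∃ x ∈ chordGrp (gen hR) {z | z < 2 * (std n).length ∧ Even z}, Rep hR w (std n) x := by
  obtain ⟨c, g, hg, H⟩ := exists_rep hR hv hw.1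
  obtain ⟨c, x, hx, H⟩ := Rep.reduce hR hs (w := w) (t := 0) (by simp [hw.1]) (Nat.zero_add _).symm
    (by simpa using hg) (one_mem _) (by simpa using H)
  obtain ⟨b, hb, hbx⟩ := exists_pure hR hx
  have hp := perm_finRange_of_isLink hb (hw.of_eqv hL (H.eqv hR hb.1 hbx))
  have H1 := Rep.orient hR hs (p := []) ⟨x, hx, H⟩
  have hp' : (c.map fun y => (y.1, true)).Perm (std n) := by
    have := hp.map fun i => (i, true)
    rwa [List.map_map] at this
  obtain ⟨x', hx', H2⟩ := Rep.perm hR hs (p := []) hp' H1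
  exact Rep.even hR hs hx' H2

omit hs in
theorem total_plat {A : Type*} [AddCommGroup A] (φ : Bool → Fin n × Bool → Fin n × Bool → A)
    {b : List (ℕ × Bool)} (hb : IsPure b (2 * c.length)) :
    total φ (cups c ++ bw b ++ caps c.length) [] = total φ (bw b) (cupLevel c) := by
  have h1 : ∀ (c : List (Fin n × Bool)), total φ (cups c) [] = 0 := by
    intro c
    induction c with
    | nil => rfl
    | cons x c ih => rw [cups, total_append φ (run_cups c), ih]; simp [total, weight, act]
  have h2 : ∀ m (l : Level n), total φ (caps m) l = 0 := by
    intro m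
    induction m with
    | zero => intro l; rfl
    | succ m ih =>
      intro l
      change weight φ (0, .cap) l + (act (0, .cap) l).elim 0 (total φ (caps m)) = 0
      cases act (0, Piece.cap) l <;> simp [weight, ih]
  rw [List.append_assoc, total_append φ (run_cups c), total_append φ (hb.2 _ (length_cupLevel c)),
    h1, h2, zero_add, add_zero]

end Standard

/-- In an abelian group generated by finitely many elements, elements are determined by their
exponents. -/
theorem exists_exponents {G ι : Type*} [Group G] [Fintype ι] [DecidableEq ι] (γ : ι → G)
    (hγ : ∀ i j, Commute (γ i) (γ j)) {P : G → (ι → ℤ) → Prop} (h1 : P 1 0)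
    (hmul : ∀ x y e e', P x e → P y e' → P (x * y) (e + e')) (hinv : ∀ x e, P x e → P x⁻¹ (-e))
    (hgen : ∀ i, P (γ i) (Pi.single i 1)) : ∃ F : Multiplicative (ι → ℤ) →* G,
      (∀ i, F (.ofAdd (Pi.single i 1)) = γ i) ∧
      ∀ x ∈ Subgroup.closure (Set.range γ), ∃ e, F (.ofAdd e) = x ∧ P x e := by
  have hcomm : IsMulCommutative (Subgroup.closure (Set.range γ)) :=
    Subgroup.isMulCommutative_closure (by
      rintro _ ⟨i, rfl⟩ _ ⟨j, rfl⟩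
      exact hγ i j)
  let _ : CommGroup (Subgroup.closure (Set.range γ)) :=
    { (inferInstance : Group (Subgroup.closure (Set.range γ))) with
      mul_comm := hcomm.is_comm.comm }
  let δ : ι → Subgroup.closure (Set.range γ) := fun i => ⟨γ i, Subgroup.subset_closure ⟨i, rfl⟩⟩
  let E : Multiplicative (ι → ℤ) →* Subgroup.closure (Set.range γ) :=
    { toFun := fun e => ∏ i, δ i ^ (e.toAdd i)
      map_one' := by simp
      map_mul' := fun e e' => by
        simp only [toAdd_mul, Pi.add_apply, zpow_add, Finset.prod_mul_distrib] }
  have hone : ∀ i, E (.ofAdd (Pi.single i 1)) = δ i := fun i => by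
    change ∏ j, δ j ^ ((Pi.single i (1 : ℤ) : ι → ℤ) j) = δ i
    rw [Finset.prod_eq_single i]
    · simp
    · intro j _ hj; simp [hj]
    · simp
  refine ⟨(Subgroup.subtype _).comp E, fun i => congrArg Subtype.val (hone i), fun x hx => ?_⟩
  induction hx using Subgroup.closure_induction with
  | mem x hx =>
    obtain ⟨i, rfl⟩ := hx
    exact ⟨Pi.single i 1, congrArg Subtype.val (hone i), hgen i⟩
  | one => exact ⟨0, map_one _, h1⟩
  | mul x y _ _ hx hy =>
    obtain ⟨e, he, hp⟩ := hx
    obtain ⟨e', he', hp'⟩ := hy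
    exact ⟨e + e', by rw [ofAdd_add, map_mul, he, he'], hmul x y e e' hp hp'⟩
  | inv x _ hx =>
    obtain ⟨e, he, hp⟩ := hx
    exact ⟨-e, by rw [ofAdd_neg, map_inv, he], hinv x e hp⟩

/-! ### Classification of classical links up to Δ -/

section DeltaLinks

variable {n : ℕ}

theorem Rep.trans_symm {R : Move n} (hR : Base R) {w w' : Word n} {c : List (Fin n × Bool)}
    {x : (CrossMonoid R)ˣ} (H : Rep hR w c x) (H' : Rep hR w' c x) : Eqv R [] w w' := by
  obtain ⟨b, hb, hv, e⟩ := H'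
  exact (H.eqv hR hb hv).trans e.symm

theorem Rep.total_eq {M : Move n} {A ι : Type*} [AddCommGroup A]
    {φ : ι → Bool → Fin n × Bool → Fin n × Bool → A} (hφ : ∀ i, IsWeight (φ i))
    (hL : ∀ u v, M u v → BiLifts u v) (hT : ∀ i u v, M u v → SameTotal (φ i) u v) {w : Word n}
    (hw : run w [] ≠ none) {c : List (Fin n × Bool)} {x : (CrossMonoid (Cls M))ˣ} {e : ι → A}
    (H : Rep (base_cls M) w c x) (hx : HasDegree (base_cls M) φ (cupLevel c) x e) (i : ι) :
    total (φ i) w [] = e i := by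
  obtain ⟨b, hb, hv, he⟩ := hx
  rw [length_cupLevel] at hb
  rw [total_eq_of_eqv (hφ i) hL (hT i) (H.eqv _ hb.1 hv) hw, total_plat _ hb, he]

theorem get_cupLevel {c : List (Fin n × Bool)} {i : ℕ} (hi : i < c.length)
    (h : 2 * i < (cupLevel c).length) : (cupLevel c).get ⟨2 * i, h⟩ = c.get ⟨i, hi⟩ := by
  induction c generalizing i with
  | nil => simp at hi
  | cons x c ih =>
    cases i with
    | zero => rfl
    | succ i =>
      have hi' : i < c.length := by simpa using hi
      exact ih hi' (by rw [length_cupLevel]; omega)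

theorem get_cupLevel_std (i : Fin n) (h : 2 * i.1 < (cupLevel (std n)).length) :
    (cupLevel (std n)).get ⟨2 * i.1, h⟩ = (i, true) := by
  rw [get_cupLevel (by rw [length_std]; exact i.2) h]
  simp [std]

/-- The degree of a clasp of two components of the standard plat. -/
theorem hasDegree_chord_std {R : Move n} (hR : Base R) {A ι : Type*} [AddCommGroup A]
    {φ : ι → Bool → Fin n × Bool → Fin n × Bool → A} (hφ : ∀ i, IsWeight (φ i)) {i j : Fin n}
    (h : i ≠ j) {e : ι → A}
    (he : ∀ k, φ k true (i, true) (j, true) + φ k true (j, true) (i, true) = e k) :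
    HasDegree hR φ (cupLevel (std n)) (chord (gen hR) (2 * i) (2 * j)) e := by
  have hl : ∀ i : Fin n, 2 * i.1 < (cupLevel (std n)).length := fun i => by
    rw [length_cupLevel, length_std]; omega
  have := hasDegree_chord hR hφ (l := cupLevel (std n)) (z := 2 * i) (t := 2 * j)
    (fun h' => h (Fin.ext (by omega))) (hl i) (hl j)
  simp only [get_cupLevel_std, he] at this
  exact this

/-- Pairs of components. -/
abbrev Pairs (n : ℕ) := {q : Fin n × Fin n // q.1 < q.2}

theorem chordGrp_std_le {R : Move n} (hR : Base R) :
    chordGrp (gen hR) {z | z < 2 * (std n).length ∧ Even z} ≤ Subgroup.closure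
      (Set.range fun q : Pairs n => chord (gen hR) (2 * q.1.1) (2 * q.1.2)) := by
  refine (Subgroup.closure_le _).2 ?_
  rintro _ ⟨z, t, ⟨hz, hz'⟩, ⟨ht, ht'⟩, h, rfl⟩
  wlog hzt : z < t generalizing z t
  · rw [chord_comm]; exact this t z ht ht' hz hz' h.symm (by omega)
  rw [length_std] at hz ht
  obtain ⟨i, rfl⟩ := even_iff_exists_two_mul.1 hz'
  obtain ⟨j, rfl⟩ := even_iff_exists_two_mul.1 ht'
  exact Subgroup.subset_closure ⟨⟨(⟨i, by omega⟩, ⟨j, by omega⟩), Fin.mk_lt_mk.2 (by omega)⟩, rfl⟩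

/-- Classical links up to `Δ` are determined by their linking numbers. -/
theorem exists_delta_exponents (n : ℕ) : ∃ F : (Pairs n → ℤ) → (CrossMonoid (Cls (Delta (n := n))))ˣ,
    ∀ w : Word n, IsLink w → (∀ p, (p, Piece.cross Kind.virt) ∉ w) →
      ∃ e, Rep (base_cls Delta) w (std n) (F e) ∧ ∀ q : Pairs n,
        total (overWeight q.1.1 q.1.2) w [] = e q ∧
        total (crossWeight q.1.1 q.1.2) w [] = 2 * e q := by
  have hs := isDeltaFamily_of_delta (base_cls (Delta (n := n))) fun u v h => .inr (.inr h)
  have hne : ∀ q : Pairs n, q.1.1 ≠ q.1.2 := fun q => q.2.ne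
  have ho : ∀ q : Pairs n, IsWeight (overWeight q.1.1 q.1.2) := fun q => isWeight_overWeight (hne q)
  have hc : ∀ q : Pairs n, IsWeight (crossWeight q.1.1 q.1.2) := fun q =>
    isWeight_crossWeight (hne q)
  obtain ⟨F, -, hF⟩ := exists_exponents
    (fun q : Pairs n => chord (gen (base_cls (Delta (n := n)))) (2 * q.1.1) (2 * q.1.2))
    (fun q q' => hs.chord_commute (fun h => hne q (Fin.ext (by omega)))
      (fun h => hne q' (Fin.ext (by omega))))
    -- A clasp of the components `i` and `j` contains one crossing in which `i` is over and one in
    -- which `j` is over, both positive. Hence its exponent counts once in `overWeight` and twice in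
    -- `crossWeight`.
    (P := fun x e =>
      HasDegree (base_cls _) (fun q : Pairs n => overWeight q.1.1 q.1.2) (cupLevel (std n)) x e ∧
      HasDegree (base_cls _) (fun q : Pairs n => crossWeight q.1.1 q.1.2) (cupLevel (std n)) x
        (e + e))
    ⟨hasDegree_one _, by rw [add_zero]; exact hasDegree_one _⟩
    (fun x y e e' hx hy => ⟨hx.1.mul _ hy.1, by
      rw [add_add_add_comm]; exact hx.2.mul _ hy.2⟩)
    (fun x e hx => ⟨hx.1.inv _ ho, by rw [← neg_add]; exact hx.2.inv _ hc⟩)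
    (fun q => by
      have key : ∀ k : Pairs n, overWeight k.1.1 k.1.2 true (q.1.1, true) (q.1.2, true) +
          overWeight k.1.1 k.1.2 true (q.1.2, true) (q.1.1, true) =
          (Pi.single q (1 : ℤ) : Pairs n → ℤ) k := by
        intro k
        have h1 := k.2
        have h2 := q.2
        have h3 : ¬ (q.1.2 = k.1.1 ∧ q.1.1 = k.1.2) := fun h => by
          rw [h.1, h.2] at h2; exact absurd h1 (asymm h2)
        by_cases h : k = q
        · subst h
          simp [overWeight, sgn, h3]
        · have h4 : ¬ (q.1.1 = k.1.1 ∧ q.1.2 = k.1.2) := fun h' =>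
            h (Subtype.ext (Prod.ext h'.1.symm h'.2.symm))
          simp [overWeight, h3, h4, h]
      refine ⟨hasDegree_chord_std _ ho (hne q) key, hasDegree_chord_std _ hc (hne q) fun k => ?_⟩
      rw [Pi.add_apply, ← key k]
      simp only [crossWeight, overWeight, if_true, and_comm]
      ring)
  refine ⟨fun e => F (.ofAdd e), fun w hw hv => ?_⟩
  have hL : ∀ u v : Word n, Delta u v → BiLifts u v := fun u v h => biLifts_delta h
  have hT : ∀ {φ : Bool → Fin n × Bool → Fin n × Bool → ℤ} (u v : Word n), Delta u v →
      SameTotal φ u v := by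
    rintro φ u v ⟨p, a⟩
    exact sameTotal_tri p _ _ _
  obtain ⟨x, hx, H⟩ := exists_standard (base_cls Delta) hs (biLifts_cls hL) hw hv
  obtain ⟨e, rfl, h1, h2⟩ := hF x (chordGrp_std_le _ hx)
  have hrun : run w [] ≠ none := by rw [hw.1]; simp
  refine ⟨e, H, fun q => ⟨H.total_eq ho hL (fun _ => hT) hrun h1 q, ?_⟩⟩
  rw [H.total_eq hc hL (fun _ => hT) hrun h2 q, Pi.add_apply, two_mul]

theorem eqv_delta_of_overWeight {w w' : Word n} (hw : IsLink w)
    (hv : ∀ p, (p, Piece.cross Kind.virt) ∉ w) (hw' : IsLink w')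
    (hv' : ∀ p, (p, Piece.cross Kind.virt) ∉ w')
    (h : ∀ i j, i ≠ j → total (overWeight i j) w [] = total (overWeight i j) w' []) :
    Eqv (Cls Delta) [] w w' := by
  obtain ⟨F, hF⟩ := exists_delta_exponents n
  obtain ⟨e, H, he⟩ := hF w hw hv
  obtain ⟨e', H', he'⟩ := hF w' hw' hv'
  obtain rfl : e = e' := funext fun q => by
    rw [← (he q).1, ← (he' q).1, h _ _ q.2.ne]
  exact H.trans_symm _ H'

theorem eqv_delta_of_crossWeight {w w' : Word n} (hw : IsLink w)
    (hv : ∀ p, (p, Piece.cross Kind.virt) ∉ w) (hw' : IsLink w')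
    (hv' : ∀ p, (p, Piece.cross Kind.virt) ∉ w')
    (h : ∀ i j, i ≠ j → total (crossWeight i j) w [] = total (crossWeight i j) w' []) :
    Eqv (Cls Delta) [] w w' := by
  obtain ⟨F, hF⟩ := exists_delta_exponents n
  obtain ⟨e, H, he⟩ := hF w hw hv
  obtain ⟨e', H', he'⟩ := hF w' hw' hv'
  obtain rfl : e = e' := funext fun q => by
    have := (he q).2.symm.trans ((h _ _ q.2.ne).trans (he' q).2)
    omega
  exact H.trans_symm _ H'

end DeltaLinks

/-! ### The moves on virtual diagrams -/

section Algebra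

variable {G : Type*} [Group G] {a b v w : G}

/-- The relation of the move `Δ` follows from the one of the fused move. -/
theorem delta_of_fused (hv : v * v = 1) (hw : w * w = 1) (hvw : v * w * v = w * v * w)
    (h13 : v * b * v = w * a * w) (hF : a * w * a = b * v * b) :
    a * b⁻¹ * a = b * a⁻¹ * b := by
  have hv' : ∀ z, v * (v * z) = z := fun z => by rw [← mul_assoc, hv, one_mul]
  have hw' : ∀ z, w * (w * z) = z := fun z => by rw [← mul_assoc, hw, one_mul]
  have hvi : v⁻¹ = v := inv_eq_of_mul_eq_one_right hv
  have hwi : w⁻¹ = w := inv_eq_of_mul_eq_one_right hw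
  have hr : w * (v * w) = v * (w * v) := by simpa only [mul_assoc] using hvw.symm
  have hr' : ∀ z, w * (v * (w * z)) = v * (w * (v * z)) := fun z => by
    simpa only [mul_assoc] using congrArg (· * z) hvw.symm
  obtain rfl : b = v * w * a * w * v := by
    have := congrArg (fun z => v * z * v) h13
    simpa only [mul_assoc, hv', hv, mul_one] using this
  -- Each of `a * v`, `v * w * a * v * w * v` and `w * v * a * w` induces the trivial permutation.
  -- The relation `hF`, multiplied by suitable virtual words, says in three ways that two of them
  -- commute.
  have hxy : (a * v) * (v * w * a * v * w * v) = (v * w * a * v * w * v) * (a * v) := by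
    have := congrArg (fun z => z * (v * w * v)) hF
    simpa only [mul_assoc, hv, hw, hv', hw', hr, hr', mul_one] using this
  have hxt : (a * v) * (w * v * a * w) = (w * v * a * w) * (a * v) := by
    have := congrArg (fun z => w * v * z * v) hF
    simpa only [mul_assoc, hv, hw, hv', hw', hr, hr', mul_one] using this.symm
  have hyt : (v * w * a * v * w * v) * (w * v * a * w) =
      (w * v * a * w) * (v * w * a * v * w * v) := by
    have := congrArg (fun z => v * w * z * w) hF
    simpa only [mul_assoc, hv, hw, hv', hw', hr, hr', mul_one] using this
  have hxy : Commute (a * v) (v * w * a * v * w * v) := hxy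
  have hxt : Commute (a * v) (w * v * a * w) := hxt
  have hyt : Commute (v * w * a * v * w * v) (w * v * a * w) := hyt
  -- With `x`, `y`, `t` for the three commuting elements, `x * t⁻¹ * y = y * t⁻¹ * x`. Multiplied by
  -- the virtual half twist, this is the relation of Δ.
  have key := congrArg (fun z => z * (v * w * v))
    ((hxt.inv_right.mul_right hxy).eq.trans (by
      rw [← hyt.inv_right.eq, mul_assoc] :
        (w * v * a * w)⁻¹ * (v * w * a * v * w * v) * (a * v) =
        (v * w * a * v * w * v) * ((w * v * a * w)⁻¹ * (a * v))))
  simpa only [mul_inv_rev, hvi, hwi, mul_assoc, hv, hw, hv', hw', hr, hr', mul_one] using key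

/-- The relation of the fused move follows from those of the over-commute move and of virtual
conjugation. -/
theorem fused_of_conj (hv : v * v = 1) (hw : w * w = 1) (hvw : v * w * v = w * v * w)
    (h13 : v * b * v = w * a * w) (hC : v * a * v = a) (hO : a * b * v = w * a * b) :
    a * w * a = b * v * b := by
  have hv' : ∀ z, v * (v * z) = z := fun z => by rw [← mul_assoc, hv, one_mul]
  have hw' : ∀ z, w * (w * z) = z := fun z => by rw [← mul_assoc, hw, one_mul]
  have hr : w * (v * w) = v * (w * v) := by simpa only [mul_assoc] using hvw.symm
  have hr' : ∀ z, w * (v * (w * z)) = v * (w * (v * z)) := fun z => by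
    simpa only [mul_assoc] using congrArg (· * z) hvw.symm
  -- Virtual conjugation means that the classical and the virtual crossing commute; with this, the
  -- over-commute relation can be rearranged into the fused one.
  have hc : a * v = v * a := by
    have := congrArg (v * ·) hC
    simpa only [mul_assoc, hv'] using this
  have hc' : ∀ z, a * (v * z) = v * (a * z) := fun z => by
    simpa only [mul_assoc] using congrArg (· * z) hc
  obtain rfl : b = v * w * a * w * v := by
    have := congrArg (fun z => v * z * v) h13
    simpa only [mul_assoc, hv', hv, mul_one] using this
  have := congrArg (fun z => v * z * w) hO
  simpa only [mul_assoc, hv, hw, hv', hw', hr, hr', hc, hc', mul_one] using this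

end Algebra

/-! ### Δ from F and from VC, and BP from wBP -/

section Welded

variable {n : ℕ} {M : Move n}

theorem cls_eq_of_move {R : Move n} {b c : List (ℕ × Kind)} (h : R (toW b) (toW c))
    (hb : BiLifts (toW b : Word n) (toW c)) : cls R b = cls R c := by
  -- The sum is merely a convenient bound: it is at least the number of strands required by any
  -- letter.
  refine cls_eq_of_eqv ((b ++ c).map fun x => x.1 + 2).sum fun l hl => ?_
  have key : ∀ d : List (ℕ × Kind), (∀ x ∈ d, x ∈ b ++ c) → run (toW d) l ≠ none := by
    intro d hd
    obtain ⟨k, hk, -⟩ := run_toW_isSome (b := d) (l := l) fun x hx =>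
      (List.le_sum_of_mem (List.mem_map.2 ⟨x, hd x hx, rfl⟩)).trans hl
    exact ne_of_eq_of_ne hk (by simp)
  exact .of_biLifts h hb (key b fun x hx => List.mem_append_left _ hx)
    (key c fun x hx => List.mem_append_right _ hx)

theorem ueqv_of_cls_eq {R : Move n} (hR : Base R) {b c : List (ℕ × Kind)} (h : cls R b = cls R c)
    (hbc : ∀ N, (∀ x ∈ b, x.1 + 2 ≤ N) ↔ ∀ x ∈ c, x.1 + 2 ≤ N) : UEqv R (toW b) (toW c) := by
  intro l
  by_cases hl : ∀ x ∈ b, x.1 + 2 ≤ l.length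
  · exact eqv_of_cls_eq hR h hl ((hbc _).1 hl)
  · have h1 : run (toW b) l = none := by
      by_contra h0
      exact hl (of_run_toW h0)
    have h2 : run (toW c) l = none := by
      by_contra h0
      exact hl ((hbc _).2 (of_run_toW h0))
    exact ⟨h1.trans h2.symm, fun h0 => absurd h1 h0⟩

/-- The class of a virtual crossing. -/
def vgen (M : Move n) (p : ℕ) : (CrossMonoid (Wld M))ˣ :=
  have h : cls (Wld M) [(p, .virt)] * cls (Wld M) [(p, .virt)] = 1 :=
    cls_eq_of_move (b := [(p, .virt), (p, .virt)]) (c := []) (.inr (.inr (.inl (.vR2 p))))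
      (biLifts_virtualMoves (.vR2 p))
  { val := cls (Wld M) [(p, .virt)], inv := cls (Wld M) [(p, .virt)], val_inv := h, inv_val := h }

theorem vgen_mul_self (p : ℕ) : vgen M p * vgen M p = 1 := Units.ext (vgen M p).mul_inv

theorem vgen_braid (p : ℕ) :
    vgen M p * vgen M (p + 1) * vgen M p = vgen M (p + 1) * vgen M p * vgen M (p + 1) :=
  Units.ext (cls_tri (.inr (.inr (.inl (.vR3 p)))))

theorem vgen_mixed (p : ℕ) : vgen M p * gen (base_wld M) (p + 1) * vgen M p =
    vgen M (p + 1) * gen (base_wld M) p * vgen M (p + 1) :=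
  Units.ext (cls_tri (.inr (.inr (.inl (.mixed13 p true)))))

theorem vgen_over (p : ℕ) : gen (base_wld M) p * gen (base_wld M) (p + 1) * vgen M p =
    vgen M (p + 1) * gen (base_wld M) p * gen (base_wld M) (p + 1) :=
  Units.ext (cls_tri (.inr (.inr (.inl (.OC1 p)))))

theorem eqv_delta_of_gen (h : ∀ p, gen (base_wld M) p * (gen (base_wld M) (p + 1))⁻¹ *
    gen (base_wld M) p = gen (base_wld M) (p + 1) * (gen (base_wld M) p)⁻¹ *
    gen (base_wld M) (p + 1)) {u v : Word n} (hD : Delta u v) : UEqv (Wld M) u v := by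
  obtain ⟨p, a⟩ := hD
  intro l
  have hc : cls (Wld M) [(p, .cl a), (p + 1, .cl !a), (p, .cl a)] =
      cls (Wld M) [(p + 1, .cl a), (p, .cl !a), (p + 1, .cl a)] := by
    cases a with
    | true => exact congrArg Units.val (h p)
    | false =>
      have := congrArg (fun x => x⁻¹) (h p)
      simp only [mul_inv_rev, inv_inv, ← mul_assoc] at this
      exact congrArg Units.val this
  exact ueqv_of_cls_eq (base_wld M) hc (fun N => by simp; omega) l

theorem eqv_delta_fused {u v : Word n} (hD : Delta u v) : UEqv (Wld Fused) u v :=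
  eqv_delta_of_gen (fun p => delta_of_fused (vgen_mul_self p) (vgen_mul_self (p + 1))
    (vgen_braid p) (vgen_mixed p) (Units.ext (cls_tri (.inr (.inr (.inr (.F2 p true))))))) hD

theorem eqv_delta_virtualConj {u v : Word n} (hD : Delta u v) : UEqv (Wld VirtualConj) u v := by
  refine eqv_delta_of_gen (fun p => delta_of_fused (vgen_mul_self p) (vgen_mul_self (p + 1))
    (vgen_braid p) (vgen_mixed p) (fused_of_conj (vgen_mul_self p) (vgen_mul_self (p + 1))
    (vgen_braid p) (vgen_mixed p) (Units.ext ?_) (vgen_over p))) hD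
  exact cls_eq_of_move (R := Wld VirtualConj) (b := [(p, .virt), (p, .cl true), (p, .virt)])
    (c := [(p, .cl true)]) (.inr (.inr (.inr (.VC p true)))) (biLifts_virtualConj (.VC p true))

/-- Two versions of wBP, with the conjugated crossing at the bottom or on the left, start from the
same grid. Comparing their results and cancelling yields the relation. -/
theorem vgen_gen_wbp (p : ℕ) :
    gen (base_wld (WeldedBandPass (n := n))) (p + 1) * vgen WeldedBandPass (p + 1) *
      gen (base_wld WeldedBandPass) (p + 1) * vgen WeldedBandPass (p + 1) =
    vgen WeldedBandPass p * gen (base_wld WeldedBandPass) p * vgen WeldedBandPass p *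
      gen (base_wld WeldedBandPass) p := by
  have h1 := cls_eq_of_move (R := Wld (WeldedBandPass (n := n)))
    (b := [(p + 1, .cl true), (p, .cl true), (p + 2, .cl true), (p + 1, .cl true)])
    (c := [(p + 1, .virt), (p + 1, .cl true), (p + 1, .virt), (p, .cl false), (p + 2, .cl false),
      (p + 1, .cl false)])
    (.inr (.inr (.inr (.bottom p true)))) (biLifts_weldedBandPass (.bottom p true))
  have h2 := cls_eq_of_move (R := Wld (WeldedBandPass (n := n)))
    (b := [(p + 1, .cl true), (p, .cl true), (p + 2, .cl true), (p + 1, .cl true)])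
    (c := [(p + 1, .cl false), (p, .virt), (p, .cl true), (p, .virt), (p + 2, .cl false),
      (p + 1, .cl false)])
    (.inr (.inr (.inr (.left p true)))) (biLifts_weldedBandPass (.left p true))
  set a := gen (base_wld (WeldedBandPass (n := n))) p with ha
  set b := gen (base_wld (WeldedBandPass (n := n))) (p + 1) with hb
  set c := gen (base_wld (WeldedBandPass (n := n))) (p + 2) with hc
  set v := vgen (WeldedBandPass (n := n)) p with hv
  set w := vgen (WeldedBandPass (n := n)) (p + 1) with hw
  have h3 : w * b * w * a⁻¹ * c⁻¹ * b⁻¹ = b⁻¹ * v * a * v * c⁻¹ * b⁻¹ :=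
    Units.ext (h1.symm.trans h2)
  rw [mul_left_inj, mul_left_inj, mul_inv_eq_iff_eq_mul] at h3
  have h4 := congrArg (fun z => b * z) h3
  simpa only [mul_assoc, mul_inv_cancel_left] using h4

/-- A crossing word between the legs of a minimum is absorbed by it. -/
theorem cup_kinks (M : Move n) {l : Level n} {q : ℕ} (hq : q ≤ l.length) (i : Fin n) (s : Bool) :
    Eqv (Wld M) l ([(q, .cup i s)] ++ toW [(q, .cl true), (q, .virt), (q, .cl true), (q, .virt)])
      [(q, .cup i s)] := by
  have hv := fun s => cup_kink_of (base_wld M) (k := .virt)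
    (fun p u h => .inr (.inr (.inl (.vR1 p u h)))) hq i s
  have hc := fun s => cup_kink (base_wld M) hq i s true
  have key : ∀ s, Eqv (Wld M) l [(q, .cup i s), X q (.cl true), X q .virt] [(q, .cup i s)] := by
    intro s
    have := ((hc s).append_right [X q .virt]).trans (hv !s)
    rwa [Bool.not_not] at this
  exact ((key s).append_right [X q (.cl true), X q .virt]).trans (key s)

/-- By a zigzag on the strand `p + 1`, the strands at the positions `p + 1` and `p + 2` become the
legs of a minimum. The word at `p` equals the reversed word at `p + 1` by `vgen_gen_wbp`, and there
it is absorbed as a succession of classical and virtual curls. In other words, virtual conjugation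
inverts a generator. -/
theorem vgen_gen_sq_wbp (p : ℕ) :
    vgen WeldedBandPass p * gen (base_wld (WeldedBandPass (n := n))) p * vgen WeldedBandPass p *
      gen (base_wld WeldedBandPass) p = 1 := by
  have hR := base_wld (WeldedBandPass (n := n))
  refine Units.ext (cls_eq_of_eqv (R := Wld (WeldedBandPass (n := n)))
    (b := [(p, .virt), (p, .cl true), (p, .virt), (p, .cl true)]) (c := []) (p + 2) fun l hl => ?_)
  obtain ⟨x, y, r, rfl, hx⟩ := exists_eq_append_cons (c := l) (i := p + 1) (by omega)
  have hrun : run [(p + 1, .cup y.1 y.2), (p + 1 + 1, .cap)] (x ++ y :: r) ≠ none := by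
    have := run_shift [(0, .cup y.1 y.2), (1, .cap)] x (y :: r)
    rw [hx] at this
    change run [(p + 1, .cup y.1 y.2), (p + 1 + 1, .cap)] (x ++ y :: r) = _ at this
    rw [this]
    simp [run, act]
  have e0 := zagzig_eqv hR hrun
  have e1 := e0.symm.append_right (toW [(p, .virt), (p, .cl true), (p, .virt), (p, .cl true)])
  have e2 := ((cap_toW_of_add_le hR (q := p + 1 + 1)
    (b := [(p, .virt), (p, .cl true), (p, .virt), (p, .cl true)]) (by simp)).symm.append_left
    [(p + 1, .cup y.1 y.2)]) (x ++ y :: r)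
  have e3 : Eqv (Wld WeldedBandPass) (x ++ y :: r) ([(p + 1, .cup y.1 y.2)] ++
      toW [(p, .virt), (p, .cl true), (p, .virt), (p, .cl true)]) ([(p + 1, .cup y.1 y.2)] ++
      toW [(p + 1, .cl true), (p + 1, .virt), (p + 1, .cl true), (p + 1, .virt)]) := by
    refine .append_left fun m hm => ?_
    rw [run_singleton] at hm
    have hlen := (length_of_act hm).2
    simp only [Piece.dom, Piece.cod] at hlen
    exact eqv_of_cls_eq hR (congrArg Units.val (vgen_gen_wbp p).symm) (by simp; omega)
      (by simp; omega)
  have e4 := (e3.trans (cup_kinks WeldedBandPass (by omega) y.1 y.2)).append_right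
    [(p + 1 + 1, .cap)]
  simp only [List.append_assoc] at e2 e4
  exact e1.trans (e2.trans (e4.trans e0))

/-- The conjugated crossing of wBP may be replaced by a changed crossing, because the virtual
conjugate of a generator is its inverse. All four crossings are then changed. -/
theorem eqv_bandPass_weldedBandPass {u v : Word n} (h : BandPass u v) :
    UEqv (Wld WeldedBandPass) u v := by
  obtain ⟨p⟩ := h
  refine ueqv_of_cls_eq (base_wld _)
    (b := [(p + 1, .cl true), (p, .cl true), (p + 2, .cl true), (p + 1, .cl true)])
    (c := [(p + 1, .cl false), (p, .cl false), (p + 2, .cl false), (p + 1, .cl false)]) ?_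
    (fun N => by simp)
  have h1 := cls_eq_of_move (R := Wld (WeldedBandPass (n := n)))
    (b := [(p + 1, .cl true), (p, .cl true), (p + 2, .cl true), (p + 1, .cl true)])
    (c := [(p + 1, .virt), (p + 1, .cl true), (p + 1, .virt), (p, .cl false), (p + 2, .cl false),
      (p + 1, .cl false)])
    (.inr (.inr (.inr (.bottom p true)))) (biLifts_weldedBandPass (.bottom p true))
  have h2 := congrArg Units.val (eq_inv_of_mul_eq_one_left (vgen_gen_sq_wbp (n := n) (p + 1)))
  have h3 : cls (Wld (WeldedBandPass (n := n))) [(p + 1, .virt), (p + 1, .cl true), (p + 1, .virt)]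
      = cls (Wld WeldedBandPass) [(p + 1, .cl false)] := h2
  have h4 := congrArg (fun z => z * cls (Wld WeldedBandPass) [(p, .cl false), (p + 2, .cl false),
      (p + 1, .cl false)]) h3
  exact h1.trans h4

end Welded

/-! ### Classical links up to the band-pass move -/

section Algebra

variable {G : Type*} [Group G]

/-- The full twist of two bands. -/
theorem band_twist {a b c : G} (hab : a * b * a = b * a * b) (hbc : b * c * b = c * b * c)
    (hac : Commute a c) (h : b * a * c * b = b⁻¹ * a⁻¹ * c⁻¹ * b⁻¹) :
    b * (a * a) * b * c * (b * (a * a) * b) = c := by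
  -- The grid `b * a * c * b` is an involution by `h` and carries `c` to `a`; the rest is
  -- bookkeeping with braid relations.
  have h1 : b * a * c * b * (b * a * c * b) = 1 := by
    nth_rewrite 2 [h]
    rw [show b⁻¹ * a⁻¹ * c⁻¹ * b⁻¹ = b⁻¹ * (c * a)⁻¹ * b⁻¹ by group, ← hac.eq]
    group
  have h2 : b * a * c * b * c = a * (b * a * c * b) :=
    calc b * a * c * b * c = b * a * (c * b * c) := by group
      _ = (b * a * b) * c * b := by rw [← hbc]; group
      _ = _ := by rw [← hab]; group
  symm
  calc c = b * a * c * b * (b * a * c * b * c) := by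
        rw [← mul_assoc (b * a * c * b), h1, one_mul]
    _ = b * a * c * (b * a * b) * a * c * b := by rw [h2]; group
    _ = b * a * (c * a) * b * a * (a * c) * b := by rw [← hab]; group
    _ = b * a * a * (c * b) * a * (c * a) * b := by rw [hac.eq.symm]; group
    _ = b * a * a * (c * b) * (a * c) * a * b := by group
    _ = b * a * a * (c * b * c) * a * a * b := by rw [hac.eq]; group
    _ = _ := by rw [← hbc]; group

theorem commute_of_involutions {x y : G} (hx : x * x = 1) (hy : y * y = 1)
    (hxy : x * y * (x * y) = 1) : Commute x y := by
  have h1 : x⁻¹ = x := inv_eq_of_mul_eq_one_right hx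
  have h2 : y⁻¹ = y := inv_eq_of_mul_eq_one_right hy
  have h3 := eq_inv_of_mul_eq_one_left hxy
  rwa [mul_inv_rev, h1, h2] at h3

/-- The elements `b * (a * a) * b⁻¹` and `b * b` are involutions, and so is their product `b * (a *
a) * b`. Hence they commute, and conjugation by `b` gives the claim. -/
theorem commute_sq_of_band {a b : G} (ha : a * a * (a * a) = 1) (hb : b * b * (b * b) = 1)
    (h : b * (a * a) * b * (b * (a * a) * b) = 1) : Commute (a * a) (b * b) := by
  have h1 : Commute (b * (a * a) * b⁻¹) (b * b) := by
    refine commute_of_involutions ?_ hb ?_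
    · rw [show b * (a * a) * b⁻¹ * (b * (a * a) * b⁻¹) = b * (a * a * (a * a)) * b⁻¹ by group, ha]
      group
    · rw [← h]; group
  have h2 : b * (a * a * (b * b)) * b⁻¹ = b * (b * b * (a * a)) * b⁻¹ := by
    have := h1.eq
    calc b * (a * a * (b * b)) * b⁻¹ = b * (a * a) * b⁻¹ * (b * b) := by group
      _ = b * b * (b * (a * a) * b⁻¹) := this
      _ = _ := by group
  exact mul_left_cancel (mul_right_cancel h2)

variable {s : ℕ → G} (hs : IsDeltaFamily s)

theorem clasp_sq (h : ∀ p, s p * s p * (s p * s p) = 1) (z d : ℕ) :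
    clasp s z d * clasp s z d = 1 := by
  induction d with
  | zero => exact h z
  | succ d ih =>
    rw [clasp, show (s (z + d + 1))⁻¹ * clasp s z d * s (z + d + 1) *
      ((s (z + d + 1))⁻¹ * clasp s z d * s (z + d + 1)) =
      (s (z + d + 1))⁻¹ * (clasp s z d * clasp s z d) * s (z + d + 1) by group, ih]
    group

theorem chord_sq (h : ∀ p, s p * s p * (s p * s p) = 1) (z t : ℕ) :
    chord s z t * chord s z t = 1 := clasp_sq h _ _

/-- The clasps of the strands `z` and `y` with the strands `u` and `v` cancel. -/
def BandRel (s : ℕ → G) (z y u v : ℕ) : Prop :=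
  chord s z u * chord s y u * (chord s z v * chord s y v) = 1

include hs

theorem bandRel_swap_succ {z y u v : ℕ} (hzu : z ≠ u) (hyu : y ≠ u) (hzv : z ≠ v) (hyv : y ≠ v)
    (i : ℕ) (h : BandRel s z y u v) : BandRel s (Equiv.swap i (i + 1) z) (Equiv.swap i (i + 1) y)
      (Equiv.swap i (i + 1) u) (Equiv.swap i (i + 1) v) := by
  have h1 : chord s z u * chord s y u * (chord s z v * chord s y v) * s i = s i := by
    rw [h, one_mul]
  rw [mul_assoc, mul_assoc (chord s z v), hs.chord_mul hyv, ← mul_assoc (chord s z v),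
    hs.chord_mul hzv, mul_assoc (chord s z u), mul_assoc (s i), ← mul_assoc (chord s y u),
    hs.chord_mul hyu, mul_assoc (s i), ← mul_assoc (chord s z u), hs.chord_mul hzu,
    mul_assoc (s i), mul_eq_left] at h1
  rw [BandRel, ← h1]
  group

theorem bandRel_swap {z y u v : ℕ} (hzu : z ≠ u) (hyu : y ≠ u) (hzv : z ≠ v) (hyv : y ≠ v)
    (i j : ℕ) (h : BandRel s z y u v) : BandRel s (Equiv.swap i j z) (Equiv.swap i j y)
      (Equiv.swap i j u) (Equiv.swap i j v) := by
  wlog hij : i < j generalizing i j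
  · rcases eq_or_ne i j with rfl | hne
    · simpa using h
    · rw [Equiv.swap_comm]
      exact this j i (by omega)
  obtain ⟨d, rfl⟩ : ∃ d, j = i + d + 1 := ⟨j - i - 1, by omega⟩
  clear hij
  induction d generalizing z y u v with
  | zero => exact bandRel_swap_succ hs hzu hyu hzv hyv i h
  | succ d ih =>
    have e : Equiv.swap i (i + (d + 1) + 1) = Equiv.swap (i + d + 1) (i + d + 1 + 1) *
        Equiv.swap i (i + d + 1) * Equiv.swap (i + d + 1) (i + d + 1 + 1) := by
      rw [Equiv.swap_mul_swap_mul_swap (by omega) (by omega), Equiv.swap_comm]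
      rfl
    rw [e]
    simp only [Equiv.Perm.mul_apply]
    have hn : ∀ {a b : ℕ} (f : Equiv.Perm ℕ), a ≠ b → f a ≠ f b := fun f h => f.injective.ne h
    have h1 := bandRel_swap_succ hs hzu hyu hzv hyv (i + d + 1) h
    have h2 := ih (hn _ hzu) (hn _ hyu) (hn _ hzv) (hn _ hyv) h1
    exact bandRel_swap_succ hs (hn _ (hn _ hzu)) (hn _ (hn _ hyu)) (hn _ (hn _ hzv))
      (hn _ (hn _ hyv)) (i + d + 1) h2

/-- Transpositions of strands preserve the relation. Move `0`, `1`, `2`, `3` to `z`, `y`, `u`, `v`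
one at a time, each transposition fixing the strands already in place. -/
theorem bandRel_of_zero (h : BandRel s 0 1 2 3) {z y u v : ℕ} (hzy : z ≠ y) (hzu : z ≠ u)
    (hyu : y ≠ u) (hzv : z ≠ v) (hyv : y ≠ v) (huv : u ≠ v) : BandRel s z y u v := by
  have hn : ∀ {a b : ℕ} (f : Equiv.Perm ℕ), a ≠ b → f a ≠ f b := fun f h => f.injective.ne h
  obtain ⟨y₁, u₁, v₁, n1, n2, n3, n4, n5, n6, h1⟩ : ∃ y₁ u₁ v₁, z ≠ y₁ ∧ z ≠ u₁ ∧ z ≠ v₁ ∧ y₁ ≠ u₁ ∧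
      y₁ ≠ v₁ ∧ u₁ ≠ v₁ ∧ BandRel s z y₁ u₁ v₁ := by
    have := bandRel_swap hs (by omega) (by omega) (by omega) (by omega) 0 z h
    rw [Equiv.swap_apply_left] at this
    have e : z = Equiv.swap 0 z 0 := (Equiv.swap_apply_left 0 z).symm
    exact ⟨_, _, _, by nth_rewrite 1 [e]; exact hn _ (by omega),
      by nth_rewrite 1 [e]; exact hn _ (by omega), by nth_rewrite 1 [e]; exact hn _ (by omega),
      hn _ (by omega), hn _ (by omega), hn _ (by omega), this⟩
  obtain ⟨u₂, v₂, m1, m2, m3, m4, m5, h2⟩ : ∃ u₂ v₂, z ≠ u₂ ∧ z ≠ v₂ ∧ y ≠ u₂ ∧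
      y ≠ v₂ ∧ u₂ ≠ v₂ ∧ BandRel s z y u₂ v₂ := by
    have := bandRel_swap hs n2 n4 n3 n5 y₁ y h1
    have ez : Equiv.swap y₁ y z = z := Equiv.swap_apply_of_ne_of_ne n1 hzy
    rw [Equiv.swap_apply_left, ez] at this
    have e : y = Equiv.swap y₁ y y₁ := (Equiv.swap_apply_left y₁ y).symm
    refine ⟨_, _, ?_, ?_, ?_, ?_, hn _ n6, this⟩
    · exact ne_of_eq_of_ne ez.symm (hn _ n2)
    · exact ne_of_eq_of_ne ez.symm (hn _ n3)
    · exact ne_of_eq_of_ne e (hn _ n4)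
    · exact ne_of_eq_of_ne e (hn _ n5)
  obtain ⟨v₃, k1, k2, k3, h3⟩ : ∃ v₃, z ≠ v₃ ∧ y ≠ v₃ ∧ u ≠ v₃ ∧ BandRel s z y u v₃ := by
    have := bandRel_swap hs m1 m3 m2 m4 u₂ u h2
    have ez : Equiv.swap u₂ u z = z := Equiv.swap_apply_of_ne_of_ne m1 hzu
    have ey : Equiv.swap u₂ u y = y := Equiv.swap_apply_of_ne_of_ne m3 hyu
    have e : u = Equiv.swap u₂ u u₂ := (Equiv.swap_apply_left u₂ u).symm
    rw [Equiv.swap_apply_left, ez, ey] at this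
    exact ⟨_, ne_of_eq_of_ne ez.symm (hn _ m2), ne_of_eq_of_ne ey.symm (hn _ m4),
      ne_of_eq_of_ne e (hn _ m5), this⟩
  have := bandRel_swap hs hzu hyu k1 k2 v₃ v h3
  rwa [Equiv.swap_apply_left, Equiv.swap_apply_of_ne_of_ne k1 hzv,
    Equiv.swap_apply_of_ne_of_ne k2 hyv, Equiv.swap_apply_of_ne_of_ne k3 huv] at this

/-- The factor `s 1 * (s 0 * s 0) * s 1` is the product of the chords from `0` and `1` to `2`.
Moving it past `s 2` changes the end `2` into `3`, and `s 2` cancels. -/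
theorem bandRel_zero (h : s 1 * (s 0 * s 0) * s 1 * s 2 * (s 1 * (s 0 * s 0) * s 1) = s 2) :
    BandRel s 0 1 2 3 := by
  have h1 : chord s 0 2 = (s 1)⁻¹ * (s 0 * s 0) * s 1 := rfl
  have h2 : chord s 1 2 = s 1 * s 1 := rfl
  have h3 : s 1 * (s 0 * s 0) * s 1 = chord s 0 2 * chord s 1 2 := by
    rw [h1, h2]
    have := (hs.sq 0).eq
    calc s 1 * (s 0 * s 0) * s 1 = (s 1)⁻¹ * (s 1 * s 1 * (s 0 * s 0)) * s 1 := by group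
      _ = _ := by rw [← this]; group
  have h4 : chord s 0 2 * chord s 1 2 * s 2 = s 2 * (chord s 0 3 * chord s 1 3) := by
    rw [mul_assoc, hs.chord_mul (by omega), ← mul_assoc, hs.chord_mul (by omega), mul_assoc]
    rfl
  rw [h3, h4, mul_assoc, mul_eq_left] at h
  have e : Commute (chord s 0 2 * chord s 1 2) (chord s 0 3 * chord s 1 3) :=
    ((hs.chord_commute (by omega) (by omega)).mul_right (hs.chord_commute (by omega)
      (by omega))).mul_left ((hs.chord_commute (by omega) (by omega)).mul_right
      (hs.chord_commute (by omega) (by omega)))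
  rw [BandRel, e.eq, h]

end Algebra

/-! ### Curls of bands and of strands -/

section BandPassLinks

variable {n : ℕ} {R : Move n} (hR : Base R)
include hR

/-- A curl of a band of two strands is a full twist. -/
theorem band_kink {p : ℕ} (x r : Level n) (hx : x.length = p) (y z : Fin n × Bool) (a : Bool) :
    Eqv R (x ++ y :: z :: r) ([(p + 2, .cup y.1 y.2), (p + 3, .cup z.1 z.2)] ++ grid p a ++
      [(p + 3, .cap), (p + 2, .cap)]) [X p (.cl a), X p (.cl a)] := by
  have hrun : run ([(p + 2, .cup y.1 y.2), (p + 3, .cup z.1 z.2)] ++ grid p a ++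
      [(p + 3, .cap), (p + 2, .cap)]) (x ++ y :: z :: r) = some (x ++ y :: z :: r) := by
    have := run_shift ([(2, .cup y.1 y.2), (3, .cup z.1 z.2)] ++ grid 0 a ++
      [(3, .cap), (2, .cap)]) x (y :: z :: r)
    rw [hx] at this
    change run ([(p + 2, .cup y.1 y.2), (p + 3, .cup z.1 z.2)] ++ grid p a ++
      [(p + 3, .cap), (p + 2, .cap)]) (x ++ y :: z :: r) = _ at this
    rw [this]
    simp [run, act, grid, X]
  -- Once everything else has been slid away from it, the curl of one strand of the band is removed
  -- by R1. An R3 move then pulls a crossing of the remaining three out of the way, so that the curl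
  -- of the other strand can be removed; two crossings of the band with itself are left.
  have e1 := ((toW_cup_of_add_le hR (q := p + 3) (b := [(p + 1, .cl a), (p, .cl a)])
    (by simp) z.1 z.2).symm.mid [(p + 2, .cup y.1 y.2)]
    [X (p + 2) (.cl a), X (p + 1) (.cl a), (p + 3, .cap), (p + 2, .cap)])
  have e2 := (cap_cross_of_add_le hR (p := p + 1) (q := p + 3) (by omega) (.cl a)).symm.mid
    [(p + 2, .cup y.1 y.2), X (p + 1) (.cl a), X p (.cl a), (p + 3, .cup z.1 z.2),
      X (p + 2) (.cl a)] [(p + 2, .cap)]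
  have e3 := (e1.trans e2) (x ++ y :: z :: r)
  have hrun3 := e3.1.symm.trans hrun
  have e4 : Eqv R (x ++ y :: z :: r) ([(p + 2, .cup y.1 y.2), X (p + 1) (.cl a), X p (.cl a)] ++
      [(p + 2 + 1, .cup z.1 z.2), X (p + 2) (.cl a), (p + 2 + 1, .cap)] ++
      [X (p + 1) (.cl a), (p + 2, .cap)])
      ([(p + 2, .cup y.1 y.2), X (p + 1) (.cl a), X p (.cl a)] ++ [] ++
      [X (p + 1) (.cl a), (p + 2, .cap)]) :=
    .replace (ne_of_eq_of_ne hrun3 (by simp)) fun m _ h => kink_eqv hR (.right z.1 z.2) h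
  have e5 := ((UEqv.of_move (R := R) (hR _ _ (.inr (.R3 p a a a (.inl rfl))))
    (run_tri p _ _ _)).symm.mid [(p + 2, .cup y.1 y.2)] [(p + 2, .cap)]) (x ++ y :: z :: r)
  have e6 := ((cross_cup_of_add_le hR (p := p) (q := p + 2) le_rfl (.cl a) y.1 y.2).symm.append_right
    [X (p + 1) (.cl a), X p (.cl a), (p + 2, .cap)]) (x ++ y :: z :: r)
  have e7 := ((cap_cross_of_add_le hR (p := p) (q := p + 2) le_rfl (.cl a)).symm.append_left
    [X p (.cl a), (p + 2, .cup y.1 y.2), X (p + 1) (.cl a)]) (x ++ y :: z :: r)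
  have e8 := e3.trans (e4.trans (e5.trans (e6.trans e7)))
  have hrun8 := e8.1.symm.trans hrun
  have e9 : Eqv R (x ++ y :: z :: r) ([X p (.cl a)] ++ [(p + 1 + 1, .cup y.1 y.2), X (p + 1) (.cl a),
      (p + 1 + 1, .cap)] ++ [X p (.cl a)]) ([X p (.cl a)] ++ [] ++ [X p (.cl a)]) :=
    .replace (ne_of_eq_of_ne hrun8 (by simp)) fun m _ h => kink_eqv hR (.right y.1 y.2) h
  exact e8.trans e9

/-- A braid which becomes trivial after conjugating one of its copies by a crossing with one more
strand is an involution. -/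
theorem val_mul_self_of_kink {b : List (ℕ × Bool)} {p : ℕ} (hw : Wide b (p + 3))
    (hb : ∀ l : Level n, p + 3 ≤ l.length → run (bw b) l = some l)
    (h : val hR b * gen hR (p + 2) * val hR b = gen hR (p + 2)) : val hR b * val hR b = 1 := by
  rw [← val_append]
  refine Units.ext ?_
  rw [coe_val]
  refine cls_eq_of_eqv (c := []) (p + 3) fun l hl => ?_
  change Eqv R l (bw (b ++ b)) []
  have hrl := hb l hl
  obtain ⟨x, y, r, rfl, hx⟩ := exists_eq_append_cons (c := l) (i := p + 2) (by omega)
  have hrun : run [(p + 2 + 1, .cup y.1 y.2), X (p + 2) (.cl true), (p + 2 + 1, .cap)]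
      (x ++ y :: r) ≠ none := by
    have := run_shift [(1, .cup y.1 y.2), X 0 (.cl true), (1, .cap)] x (y :: r)
    rw [hx] at this
    change run [(p + 2 + 1, .cup y.1 y.2), X (p + 2) (.cl true), (p + 2 + 1, .cap)]
      (x ++ y :: r) = _ at this
    rw [this]
    simp [run, act, X]
  have hb' : ∀ z ∈ b.map fun x => (x.1, Kind.cl x.2), z.1 + 2 ≤ p + 3 := by
    intro z hz
    obtain ⟨t, ht, rfl⟩ := List.mem_map.1 hz
    exact hw t ht
  -- A curl on the strand `p + 2` is inserted between the two copies of `b`. Both copies slide into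
  -- the region between its minimum and its maximum, where `h` cancels them against the crossing of
  -- the curl.
  have e0 := kink_eqv hR (.right y.1 y.2) hrun
  have e1 : Eqv R (x ++ y :: r) (bw b ++ []) (bw b ++ [(p + 2 + 1, .cup y.1 y.2),
      X (p + 2) (.cl true), (p + 2 + 1, .cap)]) := by
    refine .append_left fun m hm => ?_
    rw [hrl, Option.some.injEq] at hm
    exact hm ▸ e0.symm
  have e2 := e1.append_right (bw b)
  have e3 := (toW_cup_of_add_le hR hb' y.1 y.2).append_right
    ([X (p + 2) (.cl true), (p + 2 + 1, .cap)] ++ bw b) (x ++ y :: r)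
  have e4 := (cap_toW_of_add_le hR hb').symm.append_left ([(p + 2 + 1, .cup y.1 y.2)] ++ bw b ++
    [X (p + 2) (.cl true)]) (x ++ y :: r)
  have e5 : Eqv R (x ++ y :: r) ([(p + 2 + 1, .cup y.1 y.2)] ++ bw (b ++ [(p + 2, true)] ++ b))
      ([(p + 2 + 1, .cup y.1 y.2)] ++ bw [(p + 2, true)]) := by
    refine .append_left fun m hm => ?_
    rw [run_singleton] at hm
    have hlen := (length_of_act hm).2
    simp only [Piece.dom, Piece.cod] at hlen
    have hwm : Wide b m.length := fun z hz => (hw z hz).trans (by omega)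
    have hgm : Wide [(p + 2, true)] m.length := by simp [Wide]; omega
    refine bw_eqv hR ?_ ((hwm.append hgm).append hwm) hgm
    have hg : val hR [(p + 2, true)] = gen hR (p + 2) := by simp [val]
    rw [val_append, val_append, hg, h]
  have e6 := (e5.append_right [(p + 2 + 1, .cap)]).trans e0
  rw [bw_append]
  rw [bw_append, bw_append] at e6
  simp only [List.append_assoc, List.append_nil, List.cons_append, List.nil_append] at e2 e3 e4 e6 ⊢
  exact e2.trans (e3.trans (e4.trans e6))

end BandPassLinks

/-! ### The braid group modulo BP -/

section BandPassFamily

variable {n : ℕ}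

theorem gen_band (p : ℕ) :
    gen (base_cls (BandPass (n := n))) (p + 1) * gen (base_cls BandPass) p *
      gen (base_cls BandPass) (p + 2) * gen (base_cls BandPass) (p + 1) =
    (gen (base_cls BandPass) (p + 1))⁻¹ * (gen (base_cls BandPass) p)⁻¹ *
      (gen (base_cls BandPass) (p + 2))⁻¹ * (gen (base_cls BandPass) (p + 1))⁻¹ :=
  Units.ext (cls_eq_of_move (R := Cls (BandPass (n := n)))
    (b := [(p + 1, .cl true), (p, .cl true), (p + 2, .cl true), (p + 1, .cl true)])
    (c := [(p + 1, .cl false), (p, .cl false), (p + 2, .cl false), (p + 1, .cl false)])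
    (.inr (.inr (.BP p))) (biLifts_bandPass (.BP p)))

/-- The curl of a band equals a full twist whose sign depends on the crossings of the curl, and BP
changes these crossings. So the square of a generator equals its own inverse. -/
theorem gen_pow_four (p : ℕ) : gen (base_cls (BandPass (n := n))) p * gen (base_cls BandPass) p *
    (gen (base_cls BandPass) p * gen (base_cls BandPass) p) = 1 := by
  have hR := base_cls (BandPass (n := n))
  suffices h : gen hR p * gen hR p = (gen hR p)⁻¹ * (gen hR p)⁻¹ by
    nth_rewrite 2 [h]
    group
  refine Units.ext (cls_eq_of_eqv (R := Cls (BandPass (n := n))) (b := [(p, .cl true), (p, .cl true)])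
    (c := [(p, .cl false), (p, .cl false)]) (p + 2) fun l hl => ?_)
  obtain ⟨x, y, m, z, r, rfl, hx, hm⟩ := exists_two_split (l := l) (z := p) (d := 0) (by omega)
  obtain rfl := List.length_eq_zero_iff.1 hm
  have e1 := fun a => band_kink hR x r hx y z a
  simp only [List.append_assoc, List.cons_append, List.nil_append] at e1 ⊢
  refine (e1 true).symm.trans (.trans ?_ (e1 false))
  have hrun : run ([(p + 2, .cup y.1 y.2), (p + 3, .cup z.1 z.2)] ++ grid p true ++
      [(p + 3, .cap), (p + 2, .cap)]) (x ++ y :: z :: r) ≠ none := by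
    have h2 := (e1 true).1
    obtain ⟨k, hk, -⟩ := run_toW_isSome (b := [(p, .cl true), (p, .cl true)])
      (l := x ++ y :: z :: r) (by simp; omega)
    exact ne_of_eq_of_ne (h2.trans hk) (by simp)
  exact Eqv.replace (a := [(p + 2, .cup y.1 y.2), (p + 3, .cup z.1 z.2)])
    (b := [(p + 3, .cap), (p + 2, .cap)]) hrun fun m _ h =>
      eqv_of_cls_eq hR (congrArg Units.val (gen_band p))
        (of_run_toW (b := [(p + 1, .cl true), (p, .cl true), (p + 2, .cl true), (p + 1, .cl true)]) h)
        (by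
          have := of_run_toW
            (b := [(p + 1, .cl true), (p, .cl true), (p + 2, .cl true), (p + 1, .cl true)]) h
          simpa using this)

theorem gen_band_twist (p : ℕ) :
    gen (base_cls (BandPass (n := n))) (p + 1) * (gen (base_cls BandPass) p *
      gen (base_cls BandPass) p) * gen (base_cls BandPass) (p + 1) * gen (base_cls BandPass) (p + 2) *
      (gen (base_cls BandPass) (p + 1) * (gen (base_cls BandPass) p * gen (base_cls BandPass) p) *
      gen (base_cls BandPass) (p + 1)) = gen (base_cls BandPass) (p + 2) :=
  band_twist (braid_gen _ p) (braid_gen _ (p + 1)) (commute_gen _ le_rfl) (gen_band p)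

/-- The pure braid `s (p + 1) * (s p * s p) * s (p + 1)`, where `s` stands for the generators, is an
involution by `gen_band_twist` and `val_mul_self_of_kink`. As the fourth powers are trivial,
`commute_sq_of_band` applies. -/
theorem isDeltaFamily_bandPass (n : ℕ) : IsDeltaFamily (gen (base_cls (BandPass (n := n)))) := by
  refine isDeltaFamily_gen _ fun p => commute_sq_of_band (gen_pow_four p) (gen_pow_four (p + 1)) ?_
  have hR := base_cls (BandPass (n := n))
  have hval : val hR [(p + 1, true), (p, true), (p, true), (p + 1, true)] =
      gen hR (p + 1) * (gen hR p * gen hR p) * gen hR (p + 1) := by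
    simp [val, mul_assoc]
  rw [← hval]
  refine val_mul_self_of_kink hR (p := p) (by simp [Wide]) (fun l hl => ?_) ?_
  · obtain ⟨x, y, m, z, r, rfl, hx, hm⟩ := exists_two_split (l := l) (z := p) (d := 1) (by omega)
    obtain ⟨t, rfl⟩ := List.length_eq_one_iff.1 hm
    have := run_shift (bw [(1, true), (0, true), (0, true), (1, true)]) x (y :: t :: z :: r)
    rw [hx] at this
    change run (bw [(p + 1, true), (p, true), (p, true), (p + 1, true)]) _ = _ at this
    simp only [List.append_assoc, List.cons_append, List.nil_append] at this ⊢
    rw [this]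
    simp [bw, toW, X, run, act]
  · rw [hval]
    exact gen_band_twist p

theorem bandRel_bandPass {z y u v : ℕ} (hzy : z ≠ y) (hzu : z ≠ u) (hyu : y ≠ u) (hzv : z ≠ v)
    (hyv : y ≠ v) (huv : u ≠ v) : BandRel (gen (base_cls (BandPass (n := n)))) z y u v :=
  bandRel_of_zero (isDeltaFamily_bandPass n)
    (bandRel_zero (isDeltaFamily_bandPass n) (gen_band_twist 0)) hzy hzu hyu hzv hyv huv

end BandPassFamily

/-! ### Classification of classical links up to BP -/

section Parity

variable {n : ℕ}

theorem sameTotal_bandPass (i : Fin n) {u v : Word n} (h : BandPass u v) :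
    SameTotal (parityWeight i) u v := by
  obtain ⟨p⟩ := h
  suffices h : SameTotal (parityWeight i) (grid 0 true) (grid 0 false) from
    h.shift p (by simp [grid])
  intro l k hu _
  obtain ⟨x, y, z, w, r, rfl, rfl⟩ := run_grid_of_four (k₁ := .cl true) (k₂ := .cl true)
    (k₃ := .cl true) (k₄ := .cl true) hu
  change parityWeight i true y z + (parityWeight i true x z + (parityWeight i true y w +
    (parityWeight i true x w + 0))) = parityWeight i (!true) y z + (parityWeight i (!true) x z +
    (parityWeight i (!true) y w + (parityWeight i (!true) x w + 0)))
  have h2 : ∀ t : ZMod 2, t + t = 0 := by decide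
  simp only [parityWeight_add]
  generalize (if x.1 = i then (1 : ZMod 2) else 0) = X
  generalize (if y.1 = i then (1 : ZMod 2) else 0) = Y
  generalize (if z.1 = i then (1 : ZMod 2) else 0) = Z
  generalize (if w.1 = i then (1 : ZMod 2) else 0) = W
  linear_combination -(h2 X) - (h2 Y) - (h2 Z) - (h2 W)

/-- The components other than the first one. -/
abbrev Rest (n : ℕ) := {j : Fin n // j.1 ≠ 0}

/-- Every classical link diagram is equivalent up to the band-pass move to a standard plat in which
only the first component is linked with others. -/
theorem exists_star {w : Word n} (hw : IsLink w) (hv : ∀ p, (p, Piece.cross Kind.virt) ∉ w) :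
    ∃ x ∈ Subgroup.closure (Set.range fun j : Rest n =>
        chord (gen (base_cls (BandPass (n := n)))) 0 (2 * j.1)),
      Rep (base_cls BandPass) w (std n) x := by
  have hs := isDeltaFamily_bandPass n
  have hR := base_cls (BandPass (n := n))
  have hlen := length_std n
  obtain ⟨x, hx, H⟩ := exists_standard hR hs
    (biLifts_cls fun u v h => biLifts_bandPass h) hw hv
  set K := Subgroup.closure (Set.range fun j : Rest n => chord (gen hR) 0 (2 * j.1)) with hK
  have hKI : K ≤ chordGrp (gen hR) (Set.Iio (2 * (std n).length)) := by
    refine (Subgroup.closure_le _).2 ?_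
    rintro _ ⟨j, rfl⟩
    have := j.1.2
    exact chord_mem (Set.mem_Iio.2 (by omega)) (Set.mem_Iio.2 (by omega)) (by have := j.2; omega)
  have star : ∀ j, 0 < j → j < n → chord (gen hR) 0 (2 * j) ∈ K ⊔ idle hR w (std n) 1 :=
    fun j h0 hj => le_sup_left (a := K) (Subgroup.subset_closure ⟨⟨⟨j, hj⟩, h0.ne'⟩, rfl⟩)
  have mem : ∀ {z u}, z < 2 * n → u < 2 * n → z ≠ u →
      chord (gen hR) z u ∈ chordGrp (gen hR) (Set.Iio (2 * (std n).length)) :=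
    fun h1 h2 h => chord_mem (Set.mem_Iio.2 (by omega)) (Set.mem_Iio.2 (by omega)) h
  have I : idle hR w (std n) 1 ≤ K ⊔ idle hR w (std n) 1 := le_sup_right
  have key : ∀ i j, i < j → j < n → chord (gen hR) (2 * i) (2 * j) ∈ K ⊔ idle hR w (std n) 1 := by
    intro i j hij hj
    rcases Nat.eq_zero_or_pos i with rfl | hi
    · exact star j hij hj
    have h1 : chord (gen hR) (2 * i + 1) (2 * i) ∈ K ⊔ idle hR w (std n) 1 := by
      rw [chord_comm]
      exact I (idle_of_cups hR hs (mem (by omega) (by omega) (by omega))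
        (pass_cups_self hR (by omega)))
    have h2 : chord (gen hR) (2 * i + 1) 0 ∈ K ⊔ idle hR w (std n) 1 :=
      idle_cancel (I (idle_of_cups hR hs (mul_mem (mem (by omega) (by omega) (by omega))
        (mem (by omega) (by omega) (by omega))) (pass_cups_both hR hs (by omega) (by omega)
        (by omega) (by omega)))) (by rw [chord_comm]; exact star i hi (by omega))
    -- The relation is applied to the strands `0` and `2i` on one side, and to the other leg `2i+1`
    -- of the minimum and `2j` on the other side. Three of its four chords are already under
    -- control: `(2i, 2i+1)` is removable and `(0, 2i+1)` is inverse to `(0, 2i)` modulo removable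
    -- elements, while `(0, 2j)` is among the generators. This disposes of `(2i, 2j)`.
    have h3 : BandRel (gen hR) 0 (2 * i) (2 * i + 1) (2 * j) :=
      bandRel_bandPass (by omega) (by omega) (by omega) (by omega) (by omega) (by omega)
    rw [chord_comm] at h1 h2
    refine idle_cancel (a := chord (gen hR) 0 (2 * j)) ?_ (star j (by omega) hj)
    refine idle_cancel (a := chord (gen hR) 0 (2 * i + 1) * chord (gen hR) (2 * i) (2 * i + 1)) ?_
      (mul_mem h2 h1)
    rw [show _ = (1 : (CrossMonoid (Cls (BandPass (n := n))))ˣ) from h3]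
    exact one_mem _
  have hx' : x ∈ K ⊔ idle hR w (std n) 1 := by
    refine (Subgroup.closure_le _).2 ?_ (chordGrp_std_le hR hx)
    rintro _ ⟨q, rfl⟩
    exact key _ _ q.2 q.1.2.2
  obtain ⟨a, ha, k, hk, rfl⟩ := exists_mul_of_mem_sup
    (A := K) (K := idle hR w (std n) 1) (fun a ha k hk => hs.chordGrp_comm (hKI ha) hk.1) hx'
  refine ⟨a, ha, ?_⟩
  have := (hk.2 a (hKI ha)).1 (by simpa using H)
  simpa using this

theorem eq_of_even_sub {G ι : Type*} [Group G] [Fintype ι] [DecidableEq ι]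
    (F : Multiplicative (ι → ℤ) →* G)
    (hF : ∀ i, F (.ofAdd (Pi.single i 1)) * F (.ofAdd (Pi.single i 1)) = 1) {e e' : ι → ℤ}
    (h : ∀ i, (e i : ZMod 2) = e' i) : F (.ofAdd e) = F (.ofAdd e') := by
  have h1 : ∀ i, ∃ m : ℤ, e i - e' i = m * 2 := fun i => by
    have := (ZMod.intCast_eq_intCast_iff_dvd_sub (e' i) (e i) 2).1 (h i).symm
    obtain ⟨m, hm⟩ := this
    exact ⟨m, by rw [hm]; push_cast; ring⟩
  choose m hm using h1
  have h2 : Multiplicative.ofAdd (e - e') = ∏ i, (Multiplicative.ofAdd (Pi.single i (1 : ℤ) : ι → ℤ) *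
      Multiplicative.ofAdd (Pi.single i (1 : ℤ) : ι → ℤ)) ^ m i := by
    have : e - e' = ∑ i, m i • ((Pi.single i (1 : ℤ) : ι → ℤ) + Pi.single i (1 : ℤ)) := by
      funext j
      rw [Finset.sum_apply, Finset.sum_eq_single j]
      · simp [hm]
      · intro i _ hij
        simp [hij.symm]
      · simp
    rw [this, ofAdd_sum]
    rfl
  have h3 : Multiplicative.ofAdd (e - e') ∈ F.ker := by
    rw [h2]
    refine Subgroup.prod_mem _ fun i _ => Subgroup.zpow_mem _ ?_ _
    rw [MonoidHom.mem_ker, map_mul, hF]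
  rw [MonoidHom.mem_ker, ofAdd_sub, map_div, div_eq_one] at h3
  exact h3

/-- Classical links up to the band-pass move are determined by the parities of the linking numbers
of their components with the rest of the link. -/
theorem eqv_bandPass_of_parityWeight {w w' : Word n} (hw : IsLink w)
    (hv : ∀ p, (p, Piece.cross Kind.virt) ∉ w) (hw' : IsLink w')
    (hv' : ∀ p, (p, Piece.cross Kind.virt) ∉ w')
    (h : ∀ i, total (parityWeight i) w [] = total (parityWeight i) w' []) :
    Eqv (Cls BandPass) [] w w' := by
  have hs := isDeltaFamily_bandPass n
  have hφ : ∀ j : Rest n, IsWeight (parityWeight j.1) := fun j => isWeight_parityWeight j.1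
  obtain ⟨F, hF1, hF⟩ := exists_exponents
    (fun j : Rest n => chord (gen (base_cls (BandPass (n := n)))) 0 (2 * j.1))
    (fun i j => hs.chord_commute (by have := i.2; omega) (by have := j.2; omega))
    (P := fun x e => HasDegree (base_cls _) (fun j : Rest n => parityWeight j.1) (cupLevel (std n)) x
      fun j => (e j : ZMod 2))
    (by simpa [Pi.zero_def] using hasDegree_one _)
    (fun x y e e' hx hy => by simpa [Pi.add_def] using hx.mul _ hy)
    (fun x e hx => by simpa [Pi.neg_def] using hx.inv _ hφ)
    -- In the clasp of the first component with `j`, exactly one crossing has `j` on top, and no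
    -- other component of `Rest n` is involved. The parity of the first component is not needed.
    (fun j => by
      have h0 : 0 < n := by have := j.1.2; omega
      refine hasDegree_chord_std (i := ⟨0, h0⟩) (j := j.1) _ hφ
        (fun h => j.2 (congrArg Fin.val h).symm) fun k => ?_
      have hk : (⟨0, h0⟩ : Fin n) ≠ k.1 := fun h => k.2 (congrArg Fin.val h).symm
      have hj : (⟨0, h0⟩ : Fin n) ≠ j.1 := fun h => j.2 (congrArg Fin.val h).symm
      by_cases hkj : k = j
      · subst hkj
        simp [parityWeight, hk, hk.symm]
      · have : j.1 ≠ k.1 := fun h => hkj (Subtype.ext h.symm)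
        simp [parityWeight, hk, this, hkj])
  have hL : ∀ u v : Word n, BandPass u v → BiLifts u v := fun u v h => biLifts_bandPass h
  have hT : ∀ (j : Rest n) (u v : Word n), BandPass u v → SameTotal (parityWeight j.1) u v :=
    fun j u v => sameTotal_bandPass j.1
  obtain ⟨x, hx, H⟩ := exists_star hw hv
  obtain ⟨x', hx', H'⟩ := exists_star hw' hv'
  obtain ⟨e, rfl, he⟩ := hF x hx
  obtain ⟨e', rfl, he'⟩ := hF x' hx'
  have hrun : ∀ {w : Word n}, IsLink w → run w [] ≠ none := fun hw => by rw [hw.1]; simp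
  have hee : F (.ofAdd e) = F (.ofAdd e') := by
    refine eq_of_even_sub F (fun j => ?_) fun j => ?_
    · rw [hF1]
      exact chord_sq gen_pow_four _ _
    · rw [← H.total_eq hφ hL hT (hrun hw) he j, ← H'.total_eq hφ hL hT (hrun hw') he' j, h]
  exact H.trans_symm _ (hee ▸ H')

end Parity

/-! ### Comparison of classical and welded links -/

section Comparison

variable {n : ℕ} {M M' : Move n}

theorem incl_mk_eq (hM' : ∀ u v, M' u v → BiLifts u v) (hU : ∀ u v, M u v → UEqv (Wld M') u v)
    {D D' : ClassicalDiagram n} (h : ClassicalLinks.mk M D = ClassicalLinks.mk M D') :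
    WeldedLinks.mk M' (incl D) = WeldedLinks.mk M' (incl D') := by
  let f : ClassicalLinks n M → WeldedLinks n M' := Quot.lift (fun D => WeldedLinks.mk M' (incl D)) (by
    rintro D D' (h | h | ⟨a, u, v, b, h, e, e'⟩)
    · exact Quot.sound (.inl h)
    · exact Quot.sound (.inr (.inl h))
    · refine WeldedLinks.mk_eq hM' ?_
      change Eqv (Wld M') [] D.1.1 D'.1.1
      rw [e, e']
      exact (hU u v h).mid a b [])
  exact congrArg f h

/-- The scheme common to three of the four maps: `hU` makes the map well defined and `hI`, the
classification by invariants, makes it injective. -/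
theorem exists_injective_of_eqv (hM : ∀ u v, M u v → BiLifts u v)
    (hV : ∀ u v, M u v → (HasVirt u ↔ HasVirt v)) (hM' : ∀ u v, M' u v → BiLifts u v)
    (hU : ∀ u v, M u v → UEqv (Wld M') u v)
    (hI : ∀ D D' : ClassicalDiagram n, WeldedLinks.mk M' (incl D) = WeldedLinks.mk M' (incl D') →
      Eqv (Cls M) [] D.1.1 D'.1.1) :
    ∃ f : ClassicalLinks n M → WeldedLinks n M',
      (∀ D, f (ClassicalLinks.mk M D) = WeldedLinks.mk M' (incl D)) ∧ Function.Injective f := by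
  refine ⟨Quot.lift (fun D => WeldedLinks.mk M' (incl D)) fun D D' h =>
    incl_mk_eq hM' hU (Quot.sound h), fun D => rfl, ?_⟩
  rintro ⟨D⟩ ⟨D'⟩ h
  exact ClassicalLinks.mk_eq hM hV (hI D D' h)

theorem eqv_delta_of_fused_mk_eq {D D' : ClassicalDiagram n}
    (h : WeldedLinks.mk Fused (incl D) = WeldedLinks.mk Fused (incl D')) :
    Eqv (Cls Delta) [] D.1.1 D'.1.1 :=
  eqv_delta_of_overWeight D.1.2 D.2 D'.1.2 D'.2 fun _ _ hij =>
    total_eq_of_mk_eq (isWeight_overWeight hij) (fun _ _ => biLifts_fused)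
      (fun _ _ => sameTotal_fused) h

theorem eqv_delta_of_virtualConj_mk_eq {D D' : ClassicalDiagram n}
    (h : WeldedLinks.mk VirtualConj (incl D) = WeldedLinks.mk VirtualConj (incl D')) :
    Eqv (Cls Delta) [] D.1.1 D'.1.1 :=
  eqv_delta_of_crossWeight D.1.2 D.2 D'.1.2 D'.2 fun i j hij =>
    total_eq_of_mk_eq (isWeight_crossWeight hij) (fun _ _ => biLifts_virtualConj)
      (fun _ _ => sameTotal_virtualConj (crossWeight_comm i j)) h

theorem eqv_bandPass_of_weldedBandPass_mk_eq {D D' : ClassicalDiagram n}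
    (h : WeldedLinks.mk WeldedBandPass (incl D) = WeldedLinks.mk WeldedBandPass (incl D')) :
    Eqv (Cls BandPass) [] D.1.1 D'.1.1 :=
  eqv_bandPass_of_parityWeight D.1.2 D.2 D'.1.2 D'.2 fun i =>
    total_eq_of_mk_eq (isWeight_parityWeight i) (fun _ _ => biLifts_weldedBandPass)
      (fun _ _ => sameTotal_weldedBandPass i) h

theorem delta_mk_eq {D D' : ClassicalDiagram n} (h : Eqv (Cls Delta) [] D.1.1 D'.1.1) :
    ClassicalLinks.mk Delta D = ClassicalLinks.mk Delta D' :=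
  ClassicalLinks.mk_eq (fun _ _ => biLifts_delta) (fun _ _ => hasVirt_delta) h

/-- For classical diagrams, equivalence through VC and equivalence through F both amount to
equivalence through Δ, so Δ mediates in both directions. -/
theorem exists_injective_virtualConj_fused (n : ℕ) :
    ∃ f : ClassicalLinksUpTo n VirtualConj → WeldedLinks n Fused,
      (∀ D, f (ClassicalLinksUpTo.mk VirtualConj D) = WeldedLinks.mk Fused (incl D)) ∧
        Function.Injective f := by
  refine ⟨Quot.lift (fun D => WeldedLinks.mk Fused (incl D)) fun D D' h =>
    incl_mk_eq (fun _ _ => biLifts_fused) (fun _ _ => eqv_delta_fused)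
      (delta_mk_eq (eqv_delta_of_virtualConj_mk_eq h)), fun D => rfl, ?_⟩
  rintro ⟨D⟩ ⟨D'⟩ h
  exact Quot.sound (incl_mk_eq (fun _ _ => biLifts_virtualConj) (fun _ _ => eqv_delta_virtualConj)
    (delta_mk_eq (eqv_delta_of_fused_mk_eq h)))

end Comparison

end LinkDiag

theorem mainTheorem2 (n : ℕ) :
    (∃ f : LinkDiag.ClassicalLinks n LinkDiag.Delta → LinkDiag.WeldedLinks n LinkDiag.Fused,
      (∀ D, f (LinkDiag.ClassicalLinks.mk LinkDiag.Delta D) =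
        LinkDiag.WeldedLinks.mk LinkDiag.Fused (LinkDiag.incl D)) ∧ Function.Injective f) ∧
    (∃ f : LinkDiag.ClassicalLinks n LinkDiag.Delta →
        LinkDiag.WeldedLinks n LinkDiag.VirtualConj,
      (∀ D, f (LinkDiag.ClassicalLinks.mk LinkDiag.Delta D) =
        LinkDiag.WeldedLinks.mk LinkDiag.VirtualConj (LinkDiag.incl D)) ∧
        Function.Injective f) ∧
    (∃ f : LinkDiag.ClassicalLinksUpTo n LinkDiag.VirtualConj →
        LinkDiag.WeldedLinks n LinkDiag.Fused,
      (∀ D, f (LinkDiag.ClassicalLinksUpTo.mk LinkDiag.VirtualConj D) =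
        LinkDiag.WeldedLinks.mk LinkDiag.Fused (LinkDiag.incl D)) ∧ Function.Injective f) ∧
    (∃ f : LinkDiag.ClassicalLinks n LinkDiag.BandPass →
        LinkDiag.WeldedLinks n LinkDiag.WeldedBandPass,
      (∀ D, f (LinkDiag.ClassicalLinks.mk LinkDiag.BandPass D) =
        LinkDiag.WeldedLinks.mk LinkDiag.WeldedBandPass (LinkDiag.incl D)) ∧
        Function.Injective f) := by
  open LinkDiag in
  exact ⟨exists_injective_of_eqv (fun _ _ => biLifts_delta) (fun _ _ => hasVirt_delta)
      (fun _ _ => biLifts_fused) (fun _ _ => eqv_delta_fused) fun _ _ => eqv_delta_of_fused_mk_eq,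
    exists_injective_of_eqv (fun _ _ => biLifts_delta) (fun _ _ => hasVirt_delta)
      (fun _ _ => biLifts_virtualConj) (fun _ _ => eqv_delta_virtualConj)
      fun _ _ => eqv_delta_of_virtualConj_mk_eq,
    exists_injective_virtualConj_fused n,
    exists_injective_of_eqv (fun _ _ => biLifts_bandPass) (fun _ _ => hasVirt_bandPass)
      (fun _ _ => biLifts_weldedBandPass) (fun _ _ => eqv_bandPass_weldedBandPass)
      fun _ _ => eqv_bandPass_of_weldedBandPass_mk_eq⟩
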